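/- **Setting.** Fix the number of rounds $\ell\in\mathbb N$ and write $[\ell]=\{1,\dots,\ell\}$. Quantum circuits $C^{(\cdot)}$ act on a finite register of qubits initialised to $|0\rangle$, use Hadamard, $T$, CNOT and oracle gates $|x\rangle|y\rangle\mapsto|x\rangle|y\oplus O(x)\rangle$ for an oracle $O:\{0,1\}^*\to\{0,1\}^*$, and have a designated output register; circuits and tuples are encoded as bit strings by a fixed injective self-delimiting encoding. For $v=(C_1,s_1,\dots,C_t,s_t)$ (circuits on a common register), $|\psi_v^O\rangle$ is obtained from $|0\rangle$ by applying, for $j=1,\dots,t$, $C_j^O$ and then postselecting (and renormalising) on the outcome $s_j$ of the output register of $C_j$; it is undefined if some postselected outcome has probability $0$. For $S=(H,\mathsf{Check},O)$ and $i\in[\ell]$, the distribution $\mathcal D^{S,i}_x$ is as follows. If $x$ is not of the form $(v,\sigma,C)$ with $v=(C_1,s_1,\dots,C_{i-1},s_{i-1})$, or if $i\ge 2$ and $\mathsf{Check}((v,i-1),\sigma)\ne1$, or if $|\psi^O_v\rangle$ is undefined, output the symbol $\bot$. Otherwise measure the output register of $C^O|\psi_v^O\rangle$ to get $s$ and output $(s,H(v,C,s,i))$.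 For a family $(\mathcal D_x)_x$ of distributions let $|\mathcal D_x\rangle=\sum_z\sqrt{\Pr_{\mathcal D_x}[z]}\,|z\rangle$; let the database register $\mathsf D=\bigotimes_x\mathsf D_x$ consist of cells with an additional basis state $|\mathrm{empty}\rangle$ orthogonal to all outputs $|z\rangle$ (including the output $\bot$). The compression unitary is $U=\sum_x|x\rangle\langle x|\otimes U_x$, where $U_x$ acts on $\mathsf D_x$, exchanges $|\mathrm{empty}\rangle$ and $|\mathcal D_x\rangle$, and is the identity on the orthogonal complement of their span. Let $W^S_i$ be the compression unitary of $(\mathcal D^{S,i}_x)_x$ and $W^S=(W^S_i)_{i\in[\ell]}$. A $q$-query algorithm is a computationally unbounded quantum algorithm that makes at most $q$ (quantum) queries, each on strings of length at most $q$; it holds all registers, including the database registers. A classical string that it outputs has length at most $q$. **Theorem (one-way to hiding for the breaking oracle).** For every $\ell\in\mathbb N$ there is a polynomial $p$ such that the following holds for all $\lambda,q\in\mathbb N$. Let $(O,O',z)$ be joint random variables, where $O,O':\{0,1\}^*\to\{0,1\}^*$ are oracles and $z$ is side information, and let $T=\{x:O(x)\neq O'(x)\}$. Let $H:\{0,1\}^*\to\{0,1\}^\lambda$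 be a random oracle independent of $(O,O',z)$, let $\mathsf{Check}(x,y)=\mathbf 1\{H(x)=y\}$, and put $S=(H,\mathsf{Check},O)$, $S'=(H,\mathsf{Check},O')$. Suppose that every $q$-query algorithm $\mathcal B$ satisfies $$\Pr_{O,O',z,H}\big[\mathcal B^{W^S}(z)\in T\big]\le\Delta .$$ Then for every $q$-query algorithm $\mathcal A$ and every two-outcome measurement $\mathcal M$ of its final state, where $\mathcal M$ may depend on $O,O',H,z$, $$\Big|\Pr_{O,O',H,z}\big[\mathcal M(\mathcal A^{W^S}(z))=1\big]-\Pr_{O,O',H,z}\big[\mathcal M(\mathcal A^{W^{S'}}(z))=1\big]\Big|\le p(q)\cdot\widetilde\Delta^{\,1/(2\cdot4^\ell)},\qquad \widetilde\Delta=\max(\Delta,2^{-\lambda/2}).$$ -/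

import Mathlib

open MeasureTheory
open scoped ComplexOrder

universe u

/-! Bit strings, oracles, and encodings -/

/-- Bit strings `{0,1}*`. -/
abbrev BitStr := List Bool

/-- Classical oracles: functions from bit strings to bit strings. -/
abbrev Oracle := BitStr → BitStr

instance instMeasurableSpaceBitStr : MeasurableSpace (List Bool) := ⊤

/-- Bit strings of length at most `q`. -/
abbrev BStr (q : ℕ) := {x : BitStr // x.length ≤ q}

noncomputable instance instFintypeBStr (q : ℕ) : Fintype (BStr q) :=
  (List.finite_length_le Bool q).fintype

/-- Self-delimiting encoding of a bit string. -/
def encStr : BitStr → BitStr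
  | [] => [false]
  | b :: l => true :: b :: encStr l

/-- Self-delimiting binary encoding of a natural number. -/
def encNat (k : ℕ) : BitStr := encStr k.bits

/-- Self-delimiting encoding of a list, from a self-delimiting encoding of its entries. -/
def encList {α : Type} (f : α → BitStr) : List α → BitStr
  | [] => [false]
  | a :: l => true :: (f a ++ encList f l)

/-! Quantum circuits with oracle gates -/

/-- Gates on `n` qubits: Hadamard, `T`, controlled-NOT (control `c`, target `t`), and an oracle
gate with query register `xs` and response register `ys` (disjoint lists of wires). -/
inductive Gate (n : ℕ) : Type
  | hadamard (k : Fin n) : Gate n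
  | tGate (k : Fin n) : Gate n
  | cnot (c t : Fin n) (h : c ≠ t) : Gate n
  | query (xs ys : List (Fin n)) (h : List.Disjoint xs ys) : Gate n

/-- An oracle circuit on `n` qubits: its gates in order of application, and the list of wires that
form its output register (the "first register"). -/
structure Circuit (n : ℕ) : Type where
  gates : List (Gate n)
  out : List (Fin n)

/-- The string that the wires `xs` carry in the basis state `b`. -/
def readWires {n : ℕ} (xs : List (Fin n)) (b : Fin n → Bool) : BitStr := xs.map b

/-- The Pauli operator `X^w` on the wires `ys`, on basis states: the `j`-th wire of `ys` is flipped
iff the `j`-th bit of `w` exists and is `1`. -/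
def xorWires {n : ℕ} : List (Fin n) → BitStr → (Fin n → Bool) → (Fin n → Bool)
  | k :: ks, c :: cs, b => xorWires ks cs (Function.update b k (xor (b k) c))
  | _, _, b => b

/-- The matrix of a gate relative to the oracle `O`; `Gate.mat O g b' b` is the amplitude of the
basis state `b'` in the image of `b`. -/
noncomputable def Gate.mat {n : ℕ} (O : Oracle) :
    Gate n → Matrix (Fin n → Bool) (Fin n → Bool) ℂ
  | .hadamard k => Matrix.of fun b' b =>
      if ∀ j, j ≠ k → b' j = b j then
        (if b' k = true ∧ b k = true then -1 else 1) / (Real.sqrt 2 : ℂ)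
      else 0
  | .tGate k => Matrix.of fun b' b =>
      if b' = b then (if b k = true then Complex.exp (Complex.I * Real.pi / 4) else 1) else 0
  | .cnot c t _ => Matrix.of fun b' b => if b' = Function.update b t (xor (b t) (b c)) then 1 else 0
  | .query xs ys _ => Matrix.of fun b' b => if b' = xorWires ys (O (readWires xs b)) b then 1 else 0

/-- `C^O |ψ⟩`. -/
noncomputable def Circuit.run {n : ℕ} (O : Oracle) (C : Circuit n)
    (ψ : EuclideanSpace ℂ (Fin n → Bool)) : EuclideanSpace ℂ (Fin n → Bool) :=
  C.gates.foldl (fun φ g => Matrix.toEuclideanCLM (𝕜 := ℂ) (g.mat O) φ) ψ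

/-- The projector `|s⟩⟨s| ⊗ I`, where the first register consists of the wires `xs`. -/
noncomputable def projOnto {n : ℕ} (xs : List (Fin n)) (s : BitStr)
    (ψ : EuclideanSpace ℂ (Fin n → Bool)) : EuclideanSpace ℂ (Fin n → Bool) :=
  WithLp.toLp 2 fun b => if readWires xs b = s then ψ b else 0

/-- The encoding of gates as bit strings. -/
def encGate {n : ℕ} : Gate n → BitStr
  | .hadamard k => false :: false :: encNat k
  | .tGate k => false :: true :: encNat k
  | .cnot c t _ => true :: false :: (encNat c ++ encNat t)
  | .query xs ys _ => true :: true ::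
      (encList (fun k : Fin n => encNat k) xs ++ encList (fun k : Fin n => encNat k) ys)

/-- The encoding of circuits as bit strings. -/
def encCircuit {n : ℕ} (C : Circuit n) : BitStr :=
  encList encGate C.gates ++ encList (fun k : Fin n => encNat k) C.out

/-- A partial transcript `v = (C₁, s₁, …, C_t, s_t)`; its circuits act on one `n`-qubit register. -/
abbrev Transcript (n : ℕ) := List (Circuit n × BitStr)

def encTranscript {n : ℕ} : Transcript n → BitStr :=
  encList fun p => encCircuit p.1 ++ encStr p.2

/-- The string encoding of the pair `(v, j)`. -/
def encPoint (n : ℕ) (v : Transcript n) (j : ℕ) : BitStr :=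
  encNat n ++ (encTranscript v ++ encNat j)

/-- Inputs `(v, σ, C)` of the breaking oracle. -/
structure BreakInput : Type where
  n : ℕ
  v : Transcript n
  σ : BitStr
  C : Circuit n

/-- The string encoding of `(v, σ, C)`. -/
def BreakInput.encode (a : BreakInput) : BitStr :=
  encNat a.n ++ (encTranscript a.v ++ (encStr a.σ ++ encCircuit a.C))

/-! The encodings are uniquely decodable. -/

/-- A uniquely decodable (self-delimiting) encoding. -/
def SelfDelim {α : Type} (f : α → BitStr) : Prop :=
  ∀ a b r r', f a ++ r = f b ++ r' → a = b ∧ r = r'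

theorem selfDelim_encStr : SelfDelim encStr := by
  intro a
  induction a with
  | nil => intro b r r' h; cases b <;> simp_all [encStr]
  | cons x l ih =>
    intro b r r' h
    cases b with
    | nil => simp [encStr] at h
    | cons y m =>
      simp only [encStr, List.cons_append, List.cons.injEq, true_and] at h
      obtain ⟨h1, h2⟩ := ih m r r' h.2
      exact ⟨by rw [h.1, h1], h2⟩

theorem selfDelim_encNat : SelfDelim encNat := by
  intro a b r r' h
  obtain ⟨h1, h2⟩ := selfDelim_encStr _ _ _ _ h
  refine ⟨?_, h2⟩
  apply Nat.digits.injective 2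
  rw [Nat.digits_two_eq_bits, Nat.digits_two_eq_bits, h1]

theorem selfDelim_encList {α : Type} {f : α → BitStr} (hf : SelfDelim f) :
    SelfDelim (encList f) := by
  intro a
  induction a with
  | nil => intro b r r' h; cases b <;> simp_all [encList]
  | cons x l ih =>
    intro b r r' h
    cases b with
    | nil => simp [encList] at h
    | cons y m =>
      simp only [encList, List.cons_append, List.cons.injEq, true_and, List.append_assoc] at h
      obtain ⟨h1, h2⟩ := hf _ _ _ _ h
      obtain ⟨h3, h4⟩ := ih m r r' h2
      exact ⟨by rw [h1, h3], h4⟩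

theorem selfDelim_encWire {n : ℕ} : SelfDelim (fun k : Fin n => encNat k) := by
  intro a b r r' h
  obtain ⟨h1, h2⟩ := selfDelim_encNat _ _ _ _ h
  exact ⟨Fin.ext h1, h2⟩

theorem selfDelim_encGate {n : ℕ} : SelfDelim (encGate (n := n)) := by
  intro a b r r' h
  cases a <;> cases b <;>
    simp only [encGate, List.cons_append, List.cons.injEq, true_and, List.append_assoc,
      reduceCtorEq, false_and] at h
  · obtain ⟨h1, h2⟩ := selfDelim_encWire _ _ _ _ h
    exact ⟨by rw [h1], h2⟩
  · obtain ⟨h1, h2⟩ := selfDelim_encWire _ _ _ _ h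
    exact ⟨by rw [h1], h2⟩
  · obtain ⟨h1, h2⟩ := selfDelim_encWire _ _ _ _ h
    obtain ⟨h3, h4⟩ := selfDelim_encWire _ _ _ _ h2
    subst h1 h3
    exact ⟨rfl, h4⟩
  · obtain ⟨h1, h2⟩ := selfDelim_encList selfDelim_encWire _ _ _ _ h
    obtain ⟨h3, h4⟩ := selfDelim_encList selfDelim_encWire _ _ _ _ h2
    subst h1 h3
    exact ⟨rfl, h4⟩

theorem selfDelim_encCircuit {n : ℕ} : SelfDelim (encCircuit (n := n)) := by
  rintro ⟨g, o⟩ ⟨g', o'⟩ r r' h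
  simp only [encCircuit, List.append_assoc] at h
  obtain ⟨h1, h2⟩ := selfDelim_encList selfDelim_encGate _ _ _ _ h
  obtain ⟨h3, h4⟩ := selfDelim_encList selfDelim_encWire _ _ _ _ h2
  exact ⟨by rw [h1, h3], h4⟩

theorem selfDelim_encTranscript {n : ℕ} : SelfDelim (encTranscript (n := n)) := by
  apply selfDelim_encList
  rintro ⟨C, s⟩ ⟨C', s'⟩ r r' h
  simp only [List.append_assoc] at h
  obtain ⟨h1, h2⟩ := selfDelim_encCircuit _ _ _ _ h
  obtain ⟨h3, h4⟩ := selfDelim_encStr _ _ _ _ h2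
  exact ⟨by rw [h1, h3], h4⟩

theorem BreakInput.encode_injective : Function.Injective BreakInput.encode := by
  rintro ⟨n, v, σ, C⟩ ⟨n', v', σ', C'⟩ h
  simp only [BreakInput.encode] at h
  obtain ⟨h1, h2⟩ := selfDelim_encNat _ _ _ _ h
  subst h1
  obtain ⟨h3, h4⟩ := selfDelim_encTranscript _ _ _ _ h2
  obtain ⟨h5, h6⟩ := selfDelim_encStr _ _ _ _ h4
  obtain ⟨h7, -⟩ := selfDelim_encCircuit C C' [] [] (by simpa using h6)
  rw [h3, h5, h7]

theorem encPoint_injective {n n' : ℕ} {v : Transcript n} {v' : Transcript n'} {j j' : ℕ}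
    (h : encPoint n v j = encPoint n' v' j') : n = n' ∧ HEq v v' ∧ j = j' := by
  simp only [encPoint] at h
  obtain ⟨h1, h2⟩ := selfDelim_encNat _ _ _ _ h
  subst h1
  obtain ⟨h3, h4⟩ := selfDelim_encTranscript _ _ _ _ h2
  obtain ⟨h5, -⟩ := selfDelim_encNat j j' [] [] (by simpa using h4)
  exact ⟨rfl, heq_of_eq h3, h5⟩

open Classical in
/-- Parse a bit string as `(v, σ, C)`, if it is of this form. -/
noncomputable def parseBreakInput (x : BitStr) : Option BreakInput :=
  if h : ∃ a : BreakInput, a.encode = x then some h.choose else none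

/-! The breaking oracle -/

/-- A set of oracles `S = (H, Check, O)`; the value `none` of `H` is `⊥`. -/
structure OracleSet (lam : ℕ) where
  H : BitStr → Option (Fin lam → Bool)
  check : BitStr → BitStr → Bool
  O : Oracle

/-- `Check(x, y) = 1{H(x) = y ≠ ⊥}`. -/
def checkOf {lam : ℕ} (H : BitStr → Option (Fin lam → Bool)) (x y : BitStr) : Bool :=
  match H x with
  | none => false
  | some h => decide (List.ofFn h = y)

/-- The state `|ψ_v^O⟩`: start from `|0⟩`, and for each `(C_j, s_j)` apply `C_j^O` and postselect
(with renormalization) on the outcome `s_j`. It is the zero vector, which stands for "undefined",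
if some postselection has probability `0`. -/
noncomputable def postState {n : ℕ} (O : Oracle) (v : Transcript n) :
    EuclideanSpace ℂ (Fin n → Bool) :=
  v.foldl
    (fun φ p =>
      ((‖projOnto p.1.out p.2 (p.1.run O φ)‖⁻¹ : ℝ) : ℂ) • projOnto p.1.out p.2 (p.1.run O φ))
    (EuclideanSpace.single (fun _ => false) 1)

/-- The outputs of the breaking oracle: `none` is the symbol `⊥` (rejection), `some (s, h)` is the
pair `(s, h)`. -/
abbrev BreakOut (lam : ℕ) := Option (BitStr × Option (Fin lam → Bool))

/-- The probability mass function of `𝒟^{S,i+1}_x` (the rounds `1, …, ℓ` are numbered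
`i = 0, …, ℓ - 1` here). If `x` is not of the form `(v, σ, C)` with `v` consisting of `i` pairs, or
the check of round `i + 1 ≥ 2` fails, or `|ψ_v^O⟩` is undefined, the output is `⊥`. Otherwise the
output register of `C^O |ψ_v^O⟩` is measured and `(s, H(v, C, s, i + 1))` is returned. -/
noncomputable def breakDist {lam : ℕ} (S : OracleSet lam) (i : ℕ) (x : BitStr) :
    BreakOut lam → ℝ :=
  open Classical in
  match parseBreakInput x with
  | none => Pi.single none 1
  | some a =>
    if a.v.length = i ∧ (i = 0 ∨ S.check (encPoint a.n a.v i) a.σ = true) ∧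
        postState S.O a.v ≠ 0 then
      fun o =>
        match o with
        | none => 0
        | some (s, h) =>
          if h = S.H (encPoint a.n (a.v ++ [(a.C, s)]) (i + 1)) then
            ‖projOnto a.C.out s (a.C.run S.O (postState S.O a.v))‖ ^ 2
          else 0
    else Pi.single none 1

/-! Compression unitaries -/

section Compression

variable {ι Out : Type} [Fintype ι] [DecidableEq ι] [Fintype Out] [DecidableEq Out]

/-- `|𝒟_x⟩ = ∑_z √(Pr[z]) |z⟩` on a database cell; the basis state `none` is the empty cell
`|⊥⟩`. -/
noncomputable def distKet (p : Out → ℝ) : Option Out → ℂ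
  | none => 0
  | some z => (Real.sqrt (p z) : ℂ)

/-- `U_x = |𝒟_x⟩⟨⊥| + |⊥⟩⟨𝒟_x| + (I - |⊥⟩⟨⊥| - |𝒟_x⟩⟨𝒟_x|)`. -/
noncomputable def cellUnitary (p : Out → ℝ) : Matrix (Option Out) (Option Out) ℂ :=
  let d := distKet p
  let e : Option Out → ℂ := Pi.single none 1
  Matrix.vecMulVec d (star e) + Matrix.vecMulVec e (star d) +
    (1 - Matrix.vecMulVec e (star e) - Matrix.vecMulVec d (star d))

/-- The compression unitary `U = ∑_x |x⟩⟨x| ⊗ U_x` of the product distribution `⨂_x 𝒟_x`, where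
`U_x` acts on the cell `D_x` of the database register `D = ⨂_x D_x`. -/
noncomputable def compressionUnitary (p : ι → Out → ℝ) :
    Matrix (ι × (ι → Option Out)) (ι × (ι → Option Out)) ℂ :=
  Matrix.of fun a b =>
    if a.1 = b.1 ∧ ∀ y, y ≠ a.1 → a.2 y = b.2 y then
      cellUnitary (p a.1) (a.2 a.1) (b.2 a.1)
    else 0

/-- One query to `U` by an algorithm with query register, database register and `w`-dimensional
workspace. The basis state `none` of the query register means that no query is made. -/
def queryOp (U : Matrix (ι × (ι → Option Out)) (ι × (ι → Option Out)) ℂ) (w : ℕ) :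
    Matrix (Option ι × (ι → Option Out) × Fin w) (Option ι × (ι → Option Out) × Fin w) ℂ :=
  Matrix.of fun a b =>
    if a.2.2 = b.2.2 then
      match a.1, b.1 with
      | none, none => if a.2.1 = b.2.1 then 1 else 0
      | some x, some y => U (x, a.2.1) (y, b.2.1)
      | _, _ => 0
    else 0

end Compression

/-- Contents of a nonempty database cell, for queries of length at most `q`; the measured strings
then have length at most `q` too. -/
abbrev CellOut (q lam : ℕ) := Option (BStr q × Option (Fin lam → Bool))

instance instDecidableEqCellOut (q lam : ℕ) : DecidableEq (CellOut q lam) := inferInstance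

/-- A query `(i, x)`: the query `x`, of length at most `q`, to `W_{i+1}`. -/
abbrev QueryIdx (ℓ q : ℕ) := Fin ℓ × BStr q

/-- `W^S = (W^S_1, …, W^S_ℓ)` on queries of length at most `q`, as the single unitary
`|i⟩|ψ⟩ ↦ |i⟩ ⊗ W^S_i |ψ⟩`. It is the compression unitary of `⨂_{i,x} 𝒟^{S,i}_x`. -/
noncomputable def breakUnitary (ℓ q : ℕ) {lam : ℕ} (S : OracleSet lam) :
    Matrix (QueryIdx ℓ q × (QueryIdx ℓ q → Option (CellOut q lam)))
      (QueryIdx ℓ q × (QueryIdx ℓ q → Option (CellOut q lam))) ℂ :=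
  compressionUnitary fun ix o =>
    breakDist S ix.1.val ix.2.val (o.map fun r => (r.1.val, r.2))

/-! Query algorithms -/

/-- The computational basis of an algorithm with access to `W^S`: query register, database
register, workspace. -/
abbrev AlgBasis (ℓ q lam w : ℕ) :=
  Option (QueryIdx ℓ q) × (QueryIdx ℓ q → Option (CellOut q lam)) × Fin w

noncomputable instance instDecidableEqDatabase (ℓ q lam : ℕ) :
    DecidableEq (QueryIdx ℓ q → Option (CellOut q lam)) := inferInstance

noncomputable instance instDecidableEqAlgBasis (ℓ q lam w : ℕ) :
    DecidableEq (AlgBasis ℓ q lam w) := instDecidableEqProd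

/-- A computationally unbounded quantum algorithm with side information in `Z`: a workspace
dimension, an initial state, and the unitary that it applies after its `t`-th query
(`t = 0, 1, …`). The algorithm may act on all registers, including the database register. -/
structure QueryAlg (Z : Type u) [MeasurableSpace Z] (ℓ q lam : ℕ) where
  w : ℕ
  init : Z → EuclideanSpace ℂ (AlgBasis ℓ q lam w)
  step : ℕ → Z → Matrix (AlgBasis ℓ q lam w) (AlgBasis ℓ q lam w) ℂ
  norm_init : ∀ z, ‖init z‖ = 1
  step_unitary : ∀ t z, step t z ∈ Matrix.unitaryGroup (AlgBasis ℓ q lam w) ℂ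
  measurable_init : ∀ a, Measurable fun z => init z a
  measurable_step : ∀ t a b, Measurable fun z => step t z a b

section Algorithms

variable {Z : Type u} [MeasurableSpace Z] {ℓ q lam : ℕ}

/-- The state of `A^{W^S}(z)` after `k` queries. -/
noncomputable def QueryAlg.state (A : QueryAlg Z ℓ q lam) (S : OracleSet lam) (z : Z) :
    ℕ → EuclideanSpace ℂ (AlgBasis ℓ q lam A.w)
  | 0 => A.init z
  | k + 1 => Matrix.toEuclideanCLM (𝕜 := ℂ) (A.step k z)
      (Matrix.toEuclideanCLM (𝕜 := ℂ) (queryOp (breakUnitary ℓ q S) A.w) (A.state S z k))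

/-- The final state of `A^{W^S}(z)`: it makes `q` queries (or fewer, when the query register holds
`none`), each of length at most `q`. -/
noncomputable def QueryAlg.final (A : QueryAlg Z ℓ q lam) (S : OracleSet lam) (z : Z) :
    EuclideanSpace ℂ (AlgBasis ℓ q lam A.w) :=
  A.state S z q

/-- The probability that a two-outcome measurement with accepting effect `M` accepts the final
state of `A^{W^S}(z)`. -/
noncomputable def QueryAlg.acceptProb (A : QueryAlg Z ℓ q lam) (S : OracleSet lam) (z : Z)
    (M : Matrix (AlgBasis ℓ q lam A.w) (AlgBasis ℓ q lam A.w) ℂ) : ℝ :=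
  (inner ℂ (A.final S z) (Matrix.toEuclideanCLM (𝕜 := ℂ) M (A.final S z))).re

open Classical in
/-- The probability that `A^{W^S}(z)` outputs an element of `T`, where the output is the string
`out a` if the measurement of the final state in the computational basis gives `a`. -/
noncomputable def QueryAlg.hitProb (A : QueryAlg Z ℓ q lam) (S : OracleSet lam) (z : Z)
    (out : AlgBasis ℓ q lam A.w → BStr q) (T : Set BitStr) : ℝ :=
  ∑ a, if (out a).val ∈ T then ‖A.final S z a‖ ^ 2 else 0

end Algorithms

/-- `M` is the accepting effect of a two-outcome measurement: `0 ≤ M ≤ I`. -/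
def IsEffect {β : Type} [Fintype β] [DecidableEq β] (M : Matrix β β ℂ) : Prop :=
  M.PosSemidef ∧ (1 - M).PosSemidef

/-! The random experiment -/

/-- Values of `((O, O', z), H)`. -/
abbrev Sample (Z : Type u) (lam : ℕ) :=
  (Oracle × Oracle × Z) × (BitStr → (Fin lam → Bool))

/-- The law of a random oracle `{0,1}* → {0,1}^lam`: independent uniform values. -/
noncomputable def randomOracle (lam : ℕ) : Measure (BitStr → (Fin lam → Bool)) :=
  Measure.infinitePi fun _ => (PMF.uniformOfFintype (Fin lam → Bool)).toMeasure

namespace Sample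

variable {Z : Type u} {lam : ℕ}

/-- The set of oracles `(H, Check, Q)` for the random oracle `H` of the sample. -/
def withOracle (ω : Sample Z lam) (Q : Oracle) : OracleSet lam where
  H := fun x => some (ω.2 x)
  check := checkOf fun x => some (ω.2 x)
  O := Q

/-- `S = (H, Check, O)`. -/
def S (ω : Sample Z lam) : OracleSet lam := Sample.withOracle ω ω.1.1

/-- `S' = (H, Check, O')`. -/
def S' (ω : Sample Z lam) : OracleSet lam := Sample.withOracle ω ω.1.2.1

/-- The side information `z`. -/
def z (ω : Sample Z lam) : Z := ω.1.2.2

/-- `T = {x : O(x) ≠ O'(x)}`. -/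
def T (ω : Sample Z lam) : Set BitStr := {x | ω.1.1 x ≠ ω.1.2.1 x}

end Sample

/-! The unitary `W^S` depends on `O` through whole circuits and through the postselections of
earlier rounds. The usual bound by query weight on `T` does not apply directly: a circuit may query
`T` heavily, and postselection on an unlikely outcome may amplify a small difference of states. Two
modifications of the breaking oracle remove these two effects, and the proof passes through the
modified worlds, each time by a hybrid argument over the `q` queries.

Masking. A circuit is revealing if one of its oracle gates, run with `O` on the postselected state,
has weight at least `δ` on `T`. The masked world rejects such circuits. It differs from the real one
only on accepted queries with revealing circuits. In the real world for `O` these are rare: stopping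
the circuit before the heavy gate and declaring the query register of this gate as output gives
another accepted query, whose recorded outcome lies in `T` with probability at least `δ`. The
algorithm `QueryAlg.sampler` asks this query coherently with an empty second database, where the
compression unitary simply writes the distribution. The hypothesis on `Δ` then bounds the weight of
the revealing queries by `q * Δ / δ` (`integral_massOn_revealQuery_le`).

Puncturing. A transcript of `t` rounds is far if its postselected states for `O` and `O'` differ by
more than `η t`; the punctured world sets `H` to `⊥` there, so that no far transcript passes the
check. From a transcript that is not far, a circuit that is not revealing keeps the states within `η
i + 2 * q * √δ`, which the choice of `η` bounds by `ε * η (i + 1)`. Hence a measurement leads to a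
far transcript with probability at most `4 * ε ^ 2` (`sum_norm_projOnto_sq_far_le`): small states
differences are amplified only on outcomes that are unlikely. The puncture can also be noticed by
submitting the true value of `H` at a far point, but the state in the punctured world is independent
of this value, so the guess succeeds with probability at most `2 ^ (-lam)`
(`integral_massOn_farQuery_le`).

In the punctured world every accepted query starts from close states and runs a circuit that is not
revealing, so exchanging `O` and `O'` changes every cell distribution by little in Hellinger
distance. This distance controls the compression unitaries, because each cell unitary is a
reflection along `|empty⟩ - |𝒟⟩`.

The chain is: real, masked, punctured for `O`, then punctured, masked, real for `O'`. The last link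
needs the weight of revealing queries in a world with `O'`, about which nothing is assumed. But the
part of the chain already established puts the masked state for `O'` near the real state for `O`,
and the square root of a query weight is Lipschitz in the state (`sqrt_sum_qmass_le`).

With `δ = ε ^ (2 * ℓ)` and `η t = 2 * t * q * ε ^ (ℓ - t)` all errors are `O(ε)` up to a polynomial
in `q`, provided that `Δ ≤ δ * ε ^ 2` and `2 ^ (-lam) ≤ ε ^ 2`. So `ε` can be the power `1 / (2 * (ℓ
+ 1))` of the maximum in the theorem, which is more than required since `ℓ + 1 ≤ 4 ^ ℓ`. -/

set_option linter.unusedSectionVars false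

/-! Matrices acting on Euclidean vectors -/

section Act

variable {β : Type} [Fintype β]

/-- A matrix acting on a Euclidean vector. -/
noncomputable def act (M : Matrix β β ℂ) (v : EuclideanSpace ℂ β) : EuclideanSpace ℂ β :=
  WithLp.toLp 2 (M.mulVec v.ofLp)

theorem toEuclideanCLM_eq_act [DecidableEq β] (M : Matrix β β ℂ) (v : EuclideanSpace ℂ β) :
    Matrix.toEuclideanCLM (𝕜 := ℂ) M v = act M v := rfl

theorem act_apply (M : Matrix β β ℂ) (v : EuclideanSpace ℂ β) (a : β) :
    act M v a = ∑ b, M a b * v b := rfl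

theorem act_sub (M : Matrix β β ℂ) (v w : EuclideanSpace ℂ β) :
    act M (v - w) = act M v - act M w := by
  simp [act, Matrix.mulVec_sub]

theorem act_mul (M N : Matrix β β ℂ) (v : EuclideanSpace ℂ β) :
    act (M * N) v = act M (act N v) := by
  simp [act, Matrix.mulVec_mulVec]

theorem act_one [DecidableEq β] (v : EuclideanSpace ℂ β) : act (1 : Matrix β β ℂ) v = v := by
  simp [act]

theorem sub_act (M N : Matrix β β ℂ) (v : EuclideanSpace ℂ β) :
    act (M - N) v = act M v - act N v := by
  simp [act, Matrix.sub_mulVec]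

theorem norm_act_of_star_mul_self [DecidableEq β] {M : Matrix β β ℂ} (hM : star M * M = 1)
    (v : EuclideanSpace ℂ β) : ‖act M v‖ = ‖v‖ := by
  have h : inner ℂ (act M v) (act M v) = inner ℂ v v := by
    simp only [EuclideanSpace.inner_eq_star_dotProduct, act, Matrix.star_mulVec]
    rw [dotProduct_comm, ← Matrix.dotProduct_mulVec, Matrix.mulVec_mulVec,
      ← Matrix.star_eq_conjTranspose, hM, Matrix.one_mulVec, dotProduct_comm]
  have h2 : ‖act M v‖ ^ 2 = ‖v‖ ^ 2 := by
    rw [inner_self_eq_norm_sq_to_K, inner_self_eq_norm_sq_to_K] at h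
    exact_mod_cast h
  exact (sq_eq_sq₀ (norm_nonneg _) (norm_nonneg _)).mp h2

theorem norm_act_of_mem_unitaryGroup [DecidableEq β] {M : Matrix β β ℂ}
    (hM : M ∈ Matrix.unitaryGroup β ℂ) (v : EuclideanSpace ℂ β) : ‖act M v‖ = ‖v‖ :=
  norm_act_of_star_mul_self (Unitary.star_mul_self_of_mem hM) v

/-- A permutation of the basis, as a matrix. -/
noncomputable def permMat (σ : Equiv.Perm β) : Matrix β β ℂ :=
  open Classical in Matrix.of fun a b => if σ b = a then 1 else 0

theorem act_permMat (σ : Equiv.Perm β) (v : EuclideanSpace ℂ β) (a : β) :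
    act (permMat σ) v a = v (σ.symm a) := by
  classical
  rw [act_apply, Finset.sum_eq_single (σ.symm a)]
  · simp [permMat]
  · intro b _ hb
    have : σ b ≠ a := fun h => hb (by simp [← h])
    simp [permMat, this]
  · simp

theorem permMat_mem_unitaryGroup [DecidableEq β] (σ : Equiv.Perm β) :
    permMat σ ∈ Matrix.unitaryGroup β ℂ := by
  rw [Matrix.mem_unitaryGroup_iff]
  ext a b
  rw [Matrix.mul_apply, Finset.sum_eq_single (σ.symm a)]
  · by_cases h : a = b <;> simp [permMat, Matrix.one_apply, Matrix.star_apply, h, eq_comm]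
  · intro c _ hc
    have : σ c ≠ a := fun h => hc (by simp [← h])
    simp [permMat, this]
  · simp

end Act

/-! Compression unitaries -/

/-- A probability mass function on a finite type. -/
def IsDist {Out : Type} [Fintype Out] (p : Out → ℝ) : Prop :=
  (∀ o, 0 ≤ p o) ∧ ∑ o, p o = 1

/-- (Twice) the squared Hellinger distance. -/
noncomputable def hell {Out : Type} [Fintype Out] (p p' : Out → ℝ) : ℝ :=
  ∑ o, (√(p o) - √(p' o)) ^ 2

section Hell

variable {Out : Type} [Fintype Out]

theorem hell_nonneg (p p' : Out → ℝ) : 0 ≤ hell p p' :=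
  Finset.sum_nonneg fun _ _ => sq_nonneg _

theorem hell_self (p : Out → ℝ) : hell p p = 0 := by simp [hell]

theorem hell_le_two {p p' : Out → ℝ} (hp : IsDist p) (hp' : IsDist p') : hell p p' ≤ 2 := by
  calc hell p p' ≤ ∑ o, (p o + p' o) := by
        refine Finset.sum_le_sum fun o _ => ?_
        nlinarith [Real.sq_sqrt (hp.1 o), Real.sq_sqrt (hp'.1 o), Real.sqrt_nonneg (p o),
          Real.sqrt_nonneg (p' o), mul_nonneg (Real.sqrt_nonneg (p o)) (Real.sqrt_nonneg (p' o))]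
    _ = 2 := by rw [Finset.sum_add_distrib, hp.2, hp'.2]; norm_num

theorem isDist_single [DecidableEq Out] (o : Out) : IsDist (Pi.single o (1 : ℝ)) := by
  refine ⟨fun a => ?_, by simp⟩
  by_cases h : a = o
  · subst h; simp
  · simp [h]

end Hell

/-! ### Cell unitaries as reflections -/

section Cell

variable {Out : Type} [Fintype Out] [DecidableEq Out]

/-- The vector `|⊥⟩ - |𝒟⟩`, whose reflection is the cell unitary. -/
noncomputable def cellVec (p : Out → ℝ) : EuclideanSpace ℂ (Option Out) :=
  WithLp.toLp 2 (Pi.single none 1 - distKet p)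

theorem act_cellUnitary (p : Out → ℝ) (v : EuclideanSpace ℂ (Option Out)) :
    act (cellUnitary p) v = v - inner ℂ (cellVec p) v • cellVec p := by
  have : cellUnitary p = 1 - Matrix.vecMulVec (cellVec p).ofLp (star (cellVec p).ofLp) := by
    simp only [cellUnitary, cellVec, star_sub, Matrix.sub_vecMulVec, Matrix.vecMulVec_sub]
    abel
  rw [this, sub_act, act_one]
  congr 1
  ext a
  simp only [act, Matrix.vecMulVec_mulVec, EuclideanSpace.inner_eq_star_dotProduct]
  simp [dotProduct_comm, mul_comm]

theorem norm_cellVec_sq {p : Out → ℝ} (hp : IsDist p) : ‖cellVec p‖ ^ 2 = 2 := by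
  rw [EuclideanSpace.norm_sq_eq, Fintype.sum_option]
  have : ∀ o, ‖(cellVec p) (some o)‖ ^ 2 = p o := fun o => by
    simp [cellVec, distKet, Real.sq_sqrt (hp.1 o)]
  simp only [this, hp.2]
  simp [cellVec, distKet]
  norm_num

theorem norm_cellVec_sub_sq (p p' : Out → ℝ) : ‖cellVec p - cellVec p'‖ ^ 2 = hell p p' := by
  rw [EuclideanSpace.norm_sq_eq, Fintype.sum_option]
  have : ∀ o, ‖(cellVec p - cellVec p') (some o)‖ ^ 2 = (√(p o) - √(p' o)) ^ 2 := fun o => by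
    have : (cellVec p - cellVec p') (some o) = ((√(p' o) - √(p o) : ℝ) : ℂ) := by
      simp [cellVec, distKet]
    rw [this, Complex.norm_real, Real.norm_eq_abs, sq_abs]
    ring
  simp only [this, hell]
  simp [cellVec, distKet]

theorem norm_act_cellUnitary {p : Out → ℝ} (hp : IsDist p)
    (v : EuclideanSpace ℂ (Option Out)) : ‖act (cellUnitary p) v‖ = ‖v‖ := by
  have h2 := norm_cellVec_sq hp
  rw [act_cellUnitary]
  have : ‖v - inner ℂ (cellVec p) v • cellVec p‖ ^ 2 = ‖v‖ ^ 2 := by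
    rw [@norm_sub_sq ℂ, inner_smul_right, norm_smul, mul_pow, h2, ← inner_conj_symm v,
      RCLike.mul_conj]
    norm_cast
    ring
  exact (sq_eq_sq₀ (norm_nonneg _) (norm_nonneg _)).mp this

/-- Both unitaries are `1 - |f⟩⟨f|` with vectors `f`, `g` of squared norm `2`, and `|f⟩⟨f| - |g⟩⟨g|`
splits into two terms that each contain `f - g`, whose squared norm is the Hellinger quantity. -/
theorem norm_act_cellUnitary_sub {p p' : Out → ℝ} (hp : IsDist p) (hp' : IsDist p')
    (v : EuclideanSpace ℂ (Option Out)) :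
    ‖act (cellUnitary p - cellUnitary p') v‖ ^ 2 ≤ 9 * hell p p' * ‖v‖ ^ 2 := by
  have h1 := norm_cellVec_sq hp
  have h2 := norm_cellVec_sq hp'
  rw [← norm_cellVec_sub_sq, sub_act, act_cellUnitary, act_cellUnitary]
  set f := cellVec p
  set g := cellVec p'
  have e : v - inner ℂ f v • f - (v - inner ℂ g v • g) =
      -(inner ℂ (f - g) v • f + inner ℂ g v • (f - g)) := by
    rw [inner_sub_left, sub_smul, smul_sub]; abel
  have hb : ‖v - inner ℂ f v • f - (v - inner ℂ g v • g)‖ ≤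
      ‖f - g‖ * ‖v‖ * (‖f‖ + ‖g‖) := by
    rw [e, norm_neg]
    refine (norm_add_le _ _).trans ?_
    rw [norm_smul, norm_smul]
    have := norm_inner_le_norm (𝕜 := ℂ) (f - g) v
    have := norm_inner_le_norm (𝕜 := ℂ) g v
    nlinarith [norm_nonneg f, norm_nonneg g, norm_nonneg (f - g), norm_nonneg v]
  calc _ ≤ (‖f - g‖ * ‖v‖ * (‖f‖ + ‖g‖)) ^ 2 := by gcongr
    _ = ‖f - g‖ ^ 2 * ‖v‖ ^ 2 * (‖f‖ + ‖g‖) ^ 2 := by ring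
    -- The last factor is at most `8`; the weaker `9` has an integer square root.
    _ ≤ ‖f - g‖ ^ 2 * ‖v‖ ^ 2 * 9 := by
        gcongr
        nlinarith [sq_nonneg (‖f‖ - ‖g‖)]
    _ = _ := by ring

/-- A query to an empty cell writes `|𝒟⟩` into it; the sampler below relies on this. -/
theorem cellUnitary_some_none (p : Out → ℝ) (o : Out) :
    cellUnitary p (some o) none = (√(p o) : ℂ) := by
  simp [cellUnitary, Matrix.vecMulVec_apply, distKet]

end Cell

/-! ### Query operators and query weights -/

section Query

variable {ι Out : Type} [Fintype ι] [DecidableEq ι] [Fintype Out] [DecidableEq Out]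

theorem act_queryOp_none (p : ι → Out → ℝ) (w : ℕ)
    (ψ : EuclideanSpace ℂ (Option ι × (ι → Option Out) × Fin w)) (r) :
    act (queryOp (compressionUnitary p) w) ψ (none, r) = ψ (none, r) := by
  rw [act_apply, Finset.sum_eq_single (none, r)]
  · simp [queryOp]
  · rintro ⟨_ | x, db, j⟩ - hb
    · simp only [queryOp, Matrix.of_apply]
      by_cases h1 : r.2 = j
      · by_cases h2 : r.1 = db
        · exact absurd (by ext <;> simp [← h1, ← h2]) hb
        · simp [h2]
      · simp [h1]
    · simp [queryOp]
  · simp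

theorem act_queryOp_some (p : ι → Out → ℝ) (w : ℕ)
    (ψ : EuclideanSpace ℂ (Option ι × (ι → Option Out) × Fin w)) (x : ι) (db) (j) :
    act (queryOp (compressionUnitary p) w) ψ (some x, db, j) =
      ∑ c, cellUnitary (p x) (db x) c * ψ (some x, Function.update db x c, j) := by
  rw [act_apply]
  symm
  refine Finset.sum_of_injOn (fun c => (some x, Function.update db x c, j)) ?_ (by simp) ?_ ?_
  · intro c _ c' _ h
    simpa using congrFun (Prod.ext_iff.1 (Prod.ext_iff.1 h).2).1 x
  · rintro ⟨_ | y, db', j'⟩ - hb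
    · simp [queryOp]
    · simp only [queryOp, compressionUnitary, Matrix.of_apply]
      split_ifs with h1 h2
      · refine absurd ⟨db' x, by simp, ?_⟩ hb
        obtain ⟨rfl, h3⟩ := h2
        simp only [Prod.mk.injEq, true_and]
        refine ⟨?_, h1⟩
        ext1 y
        by_cases hy : y = x
        · subst hy; simp
        · simp [hy, h3 y hy]
      all_goals simp
  · intro c _
    simp only [queryOp, compressionUnitary, Matrix.of_apply]
    simp +contextual [Function.update_of_ne]

/-- Bound on a cell operator, lifted to the database register. -/
theorem sum_cell_le (M : Matrix (Option Out) (Option Out) ℂ) (B : ℝ)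
    (hM : ∀ v, ‖act M v‖ ^ 2 ≤ B * ‖v‖ ^ 2) (x : ι) (φ : (ι → Option Out) → ℂ) :
    ∑ db, ‖∑ c, M (db x) c * φ (Function.update db x c)‖ ^ 2 ≤ B * ∑ db, ‖φ db‖ ^ 2 := by
  classical
  have key : ∀ F : (ι → Option Out) → ℝ, ∑ db, F db =
      ∑ r, ∑ c, F ((Equiv.funSplitAt x (Option Out)).symm (c, r)) := fun F => by
    rw [← Equiv.sum_comp (Equiv.funSplitAt x (Option Out)).symm, Fintype.sum_prod_type_right]
  have hup : ∀ c c' r, Function.update ((Equiv.funSplitAt x (Option Out)).symm (c, r)) x c' =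
      (Equiv.funSplitAt x (Option Out)).symm (c', r) := fun c c' r => by
    ext1 y
    by_cases hy : y = x
    · subst hy; simp [Equiv.funSplitAt, Equiv.piSplitAt]
    · simp [Equiv.funSplitAt, Equiv.piSplitAt, hy]
  have hx : ∀ c r, (Equiv.funSplitAt x (Option Out)).symm (c, r) x = c := fun c r => by
    simp [Equiv.funSplitAt, Equiv.piSplitAt]
  rw [key, key, Finset.mul_sum]
  refine Finset.sum_le_sum fun r _ => ?_
  have := hM (WithLp.toLp 2 fun c => φ ((Equiv.funSplitAt x (Option Out)).symm (c, r)))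
  rw [EuclideanSpace.norm_sq_eq, EuclideanSpace.norm_sq_eq] at this
  simpa only [act_apply, hup, hx] using this

/-- The weight of the query `x`. -/
noncomputable def qmass {w : ℕ} (ψ : EuclideanSpace ℂ (Option ι × (ι → Option Out) × Fin w))
    (x : ι) : ℝ :=
  ∑ j, ∑ db, ‖ψ (some x, db, j)‖ ^ 2

theorem qmass_nonneg {w : ℕ} (ψ : EuclideanSpace ℂ (Option ι × (ι → Option Out) × Fin w))
    (x : ι) : 0 ≤ qmass ψ x :=
  Finset.sum_nonneg fun _ _ => Finset.sum_nonneg fun _ _ => by positivity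

theorem norm_sq_eq_qmass {w : ℕ}
    (ψ : EuclideanSpace ℂ (Option ι × (ι → Option Out) × Fin w)) :
    ‖ψ‖ ^ 2 = (∑ j, ∑ db, ‖ψ (none, db, j)‖ ^ 2) + ∑ x, qmass ψ x := by
  simp only [EuclideanSpace.norm_sq_eq, Fintype.sum_prod_type, Fintype.sum_option, qmass]
  congr 1
  · exact Finset.sum_comm
  · exact Finset.sum_congr rfl fun _ _ => Finset.sum_comm

theorem sum_qmass_le {w : ℕ}
    (ψ : EuclideanSpace ℂ (Option ι × (ι → Option Out) × Fin w)) :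
    ∑ x, qmass ψ x ≤ ‖ψ‖ ^ 2 := by
  rw [norm_sq_eq_qmass]
  have : 0 ≤ ∑ j, ∑ db, ‖ψ (none, db, j)‖ ^ 2 :=
    Finset.sum_nonneg fun _ _ => Finset.sum_nonneg fun _ _ => by positivity
  linarith

theorem norm_act_queryOp_le {p : ι → Out → ℝ} (hp : ∀ x, IsDist (p x)) {w : ℕ}
    (ψ : EuclideanSpace ℂ (Option ι × (ι → Option Out) × Fin w)) :
    ‖act (queryOp (compressionUnitary p) w) ψ‖ ≤ ‖ψ‖ := by
  refine le_of_sq_le_sq ?_ (norm_nonneg _)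
  rw [norm_sq_eq_qmass, norm_sq_eq_qmass ψ]
  simp only [act_queryOp_none]
  gcongr with x _
  unfold qmass
  refine Finset.sum_le_sum fun j _ => ?_
  simp only [act_queryOp_some]
  simpa using sum_cell_le (cellUnitary (p x)) 1
    (fun v => by rw [norm_act_cellUnitary (hp x), one_mul]) x (fun db => ψ (some x, db, j))

/-- The operators are block diagonal in the query `x`, and the block of `x` touches only the cell of
`x`. So the squared errors add up over the queries, each weighted by the query weight. -/
theorem norm_act_queryOp_sub_le {p p' : ι → Out → ℝ} (hp : ∀ x, IsDist (p x))
    (hp' : ∀ x, IsDist (p' x)) {w : ℕ}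
    (ψ : EuclideanSpace ℂ (Option ι × (ι → Option Out) × Fin w)) :
    ‖act (queryOp (compressionUnitary p) w) ψ - act (queryOp (compressionUnitary p') w) ψ‖ ≤
      3 * √(∑ x, hell (p x) (p' x) * qmass ψ x) := by
  have h0 : 0 ≤ ∑ x, hell (p x) (p' x) * qmass ψ x :=
    Finset.sum_nonneg fun x _ => mul_nonneg (hell_nonneg _ _) (qmass_nonneg _ _)
  refine le_of_sq_le_sq ?_ (by positivity)
  rw [mul_pow, Real.sq_sqrt h0, norm_sq_eq_qmass]
  simp only [PiLp.sub_apply, act_queryOp_none, sub_self, norm_zero]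
  simp only [ne_eq, OfNat.ofNat_ne_zero, not_false_eq_true, zero_pow, Finset.sum_const_zero,
    zero_add, Finset.mul_sum]
  refine Finset.sum_le_sum fun x _ => ?_
  unfold qmass
  rw [← mul_assoc, Finset.mul_sum]
  refine Finset.sum_le_sum fun j _ => ?_
  simp only [PiLp.sub_apply, act_queryOp_some, ← Finset.sum_sub_distrib, ← sub_mul]
  have := sum_cell_le (cellUnitary (p x) - cellUnitary (p' x)) (9 * hell (p x) (p' x))
    (norm_act_cellUnitary_sub (hp x) (hp' x)) x (fun db => ψ (some x, db, j))
  simp only [Matrix.sub_apply] at this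
  rw [show (3 : ℝ) ^ 2 = 9 by norm_num]
  exact this

end Query

/-! Evolution of an algorithm with access to the compression unitary of a family of distributions -/

section Evolve

variable {Z : Type u} [MeasurableSpace Z] {ℓ q lam : ℕ}

/-- The state after `k` queries to the compression unitary of the family `p`. -/
noncomputable def evolveFrom {w : ℕ} (p : QueryIdx ℓ q → CellOut q lam → ℝ)
    (ψ : EuclideanSpace ℂ (AlgBasis ℓ q lam w))
    (V : ℕ → Matrix (AlgBasis ℓ q lam w) (AlgBasis ℓ q lam w) ℂ) :
    ℕ → EuclideanSpace ℂ (AlgBasis ℓ q lam w)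
  | 0 => ψ
  | k + 1 => act (V k) (act (queryOp (compressionUnitary p) w) (evolveFrom p ψ V k))

/-- The state of `A` after `k` queries to the compression unitary of the family `p`. -/
noncomputable def QueryAlg.evolve (A : QueryAlg Z ℓ q lam)
    (p : QueryIdx ℓ q → CellOut q lam → ℝ) (z : Z) :
    ℕ → EuclideanSpace ℂ (AlgBasis ℓ q lam A.w) :=
  evolveFrom p (A.init z) fun s => A.step s z

theorem QueryAlg.evolve_succ (A : QueryAlg Z ℓ q lam)
    (p : QueryIdx ℓ q → CellOut q lam → ℝ) (z : Z) (k : ℕ) :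
    A.evolve p z (k + 1) =
      act (A.step k z) (act (queryOp (compressionUnitary p) A.w) (A.evolve p z k)) := rfl

/-- The family of distributions that defines `W^S` on queries of length at most `q`. -/
noncomputable def breakFamily (ℓ q : ℕ) {lam : ℕ} (S : OracleSet lam) (ix : QueryIdx ℓ q)
    (o : CellOut q lam) : ℝ :=
  breakDist S ix.1.val ix.2.val (o.map fun r => (r.1.val, r.2))

/-- The intermediate worlds are families of distributions and not sets of oracles, so the analysis
is carried out for `evolve` and transferred back through this identity. -/
theorem QueryAlg.state_eq_evolve (A : QueryAlg Z ℓ q lam) (S : OracleSet lam) (z : Z) (k : ℕ) :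
    A.state S z k = A.evolve (breakFamily ℓ q S) z k := by
  induction k with
  | zero => rfl
  | succ k ih =>
    rw [QueryAlg.state, QueryAlg.evolve_succ, ih, toEuclideanCLM_eq_act, toEuclideanCLM_eq_act]
    rfl

theorem QueryAlg.norm_evolve_le (A : QueryAlg Z ℓ q lam) {p : QueryIdx ℓ q → CellOut q lam → ℝ}
    (hp : ∀ ix, IsDist (p ix)) (z : Z) (k : ℕ) : ‖A.evolve p z k‖ ≤ 1 := by
  induction k with
  | zero => exact (A.norm_init z).le
  | succ k ih =>
    rw [QueryAlg.evolve_succ, norm_act_of_mem_unitaryGroup (A.step_unitary k z)]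
    exact (norm_act_queryOp_le hp _).trans ih

/-- Hybrid argument. -/
theorem QueryAlg.norm_evolve_sub_le (A : QueryAlg Z ℓ q lam)
    {p p' : QueryIdx ℓ q → CellOut q lam → ℝ}
    (hp : ∀ ix, IsDist (p ix)) (hp' : ∀ ix, IsDist (p' ix)) (z : Z) (k : ℕ) :
    ‖A.evolve p z k - A.evolve p' z k‖ ≤
      ∑ s ∈ Finset.range k, 3 * √(∑ ix, hell (p ix) (p' ix) * qmass (A.evolve p z s) ix) := by
  induction k with
  | zero => simp [QueryAlg.evolve, evolveFrom]
  | succ k ih =>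
    rw [QueryAlg.evolve_succ, QueryAlg.evolve_succ, ← act_sub,
      norm_act_of_mem_unitaryGroup (A.step_unitary k z), Finset.sum_range_succ]
    have h1 := norm_act_queryOp_sub_le hp hp' (A.evolve p z k)
    have h2 := norm_act_queryOp_le hp' (A.evolve p z k - A.evolve p' z k)
    rw [act_sub] at h2
    have h3 := norm_sub_le_norm_sub_add_norm_sub
      (act (queryOp (compressionUnitary p) A.w) (A.evolve p z k))
      (act (queryOp (compressionUnitary p') A.w) (A.evolve p z k))
      (act (queryOp (compressionUnitary p') A.w) (A.evolve p' z k))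
    linarith

/-- Query weights of nearby states on a set of queries. -/
theorem sqrt_sum_qmass_le {w : ℕ} (K : QueryIdx ℓ q → Prop) [DecidablePred K]
    (ψ φ : EuclideanSpace ℂ (AlgBasis ℓ q lam w)) :
    √(∑ ix, if K ix then qmass ψ ix else 0) ≤
      √(∑ ix, if K ix then qmass φ ix else 0) + ‖ψ - φ‖ := by
  classical
  -- The square root of the weight on `K` is the norm of the projection onto the queries in `K`,
  -- hence `1`-Lipschitz.
  let P : EuclideanSpace ℂ (AlgBasis ℓ q lam w) → EuclideanSpace ℂ (AlgBasis ℓ q lam w) :=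
    fun ψ => WithLp.toLp 2 fun a => match a.1 with
      | none => 0
      | some ix => if K ix then ψ a else 0
  have hP : ∀ ψ, √(∑ ix, if K ix then qmass ψ ix else 0) = ‖P ψ‖ := fun ψ => by
    rw [← Real.sqrt_sq (norm_nonneg (P ψ)), norm_sq_eq_qmass]
    congr 1
    simp only [P, norm_zero]
    simp only [ne_eq, OfNat.ofNat_ne_zero, not_false_eq_true, zero_pow, Finset.sum_const_zero,
      zero_add]
    refine Finset.sum_congr rfl fun ix _ => ?_
    by_cases h : K ix <;> simp [qmass, h]
  have hs : P ψ - P φ = P (ψ - φ) := by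
    ext ⟨_ | ix, r⟩
    · simp [P]
    · by_cases h : K ix <;> simp [P, h]
  have hle : ‖P (ψ - φ)‖ ≤ ‖ψ - φ‖ := by
    refine le_of_sq_le_sq ?_ (norm_nonneg _)
    rw [EuclideanSpace.norm_sq_eq, EuclideanSpace.norm_sq_eq]
    refine Finset.sum_le_sum ?_
    rintro ⟨_ | ix, r⟩ -
    · simp [P]
    · by_cases h : K ix <;> simp [P, h]
  rw [hP, hP]
  have := norm_sub_norm_le (P ψ) (P φ)
  rw [hs] at this
  linarith

end Evolve

/-! Sampling the answer to a modified query -/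

section Sampler

variable {ι Out : Type} [Fintype ι] [DecidableEq ι] [Fintype Out] [DecidableEq Out]

/-- The states of a second query register and a second database register. -/
abbrev Mem (ι Out : Type) := Option ι × (ι → Option Out)

variable {w N : ℕ} (e : Fin N ≃ Fin w × Mem ι Out)

/-- The workspace consists of a smaller workspace and an additional memory. -/
def splitMem : (Option ι × (ι → Option Out) × Fin N) ≃
    (Option ι × (ι → Option Out) × Fin w) × Mem ι Out where
  toFun a := ((a.1, a.2.1, (e a.2.2).1), (e a.2.2).2)
  invFun a := (a.1.1, a.1.2.1, e.symm (a.1.2.2, a.2))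
  left_inv a := by simp
  right_inv a := by simp

/-- A state together with an empty memory. -/
noncomputable def liftState (ψ : EuclideanSpace ℂ (Option ι × (ι → Option Out) × Fin w)) :
    EuclideanSpace ℂ (Option ι × (ι → Option Out) × Fin N) :=
  WithLp.toLp 2 fun a =>
    if (splitMem e a).2 = (none, fun _ => none) then ψ (splitMem e a).1 else 0

/-- An operator that does not act on the memory. -/
noncomputable def liftMat
    (M : Matrix (Option ι × (ι → Option Out) × Fin w) (Option ι × (ι → Option Out) × Fin w) ℂ) :
    Matrix (Option ι × (ι → Option Out) × Fin N) (Option ι × (ι → Option Out) × Fin N) ℂ :=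
  Matrix.of fun a b =>
    if (splitMem e a).2 = (splitMem e b).2 then M (splitMem e a).1 (splitMem e b).1 else 0

theorem liftMat_mem_unitaryGroup
    {M : Matrix (Option ι × (ι → Option Out) × Fin w) (Option ι × (ι → Option Out) × Fin w) ℂ}
    (hM : M ∈ Matrix.unitaryGroup _ ℂ) : liftMat e M ∈ Matrix.unitaryGroup _ ℂ := by
  rw [Matrix.mem_unitaryGroup_iff] at hM ⊢
  ext a b
  have hM' := congrFun (congrFun hM (splitMem e a).1) (splitMem e b).1
  rw [Matrix.mul_apply] at hM' ⊢
  rw [← Equiv.sum_comp (splitMem e).symm, Fintype.sum_prod_type_right,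
    Finset.sum_eq_single (splitMem e a).2]
  · by_cases h : (splitMem e a).2 = (splitMem e b).2
    · have h' : (splitMem e a).1 = (splitMem e b).1 ↔ a = b :=
        ⟨fun h1 => (splitMem e).injective (Prod.ext h1 h), fun h1 => h1 ▸ rfl⟩
      simpa [liftMat, Matrix.star_apply, h, Matrix.one_apply, h'] using hM'
    · have h' : a ≠ b := fun h1 => h (h1 ▸ rfl)
      simp [liftMat, Matrix.star_apply, h', Ne.symm h]
  · intro m _ hm
    simp [liftMat, Ne.symm hm]
  · simp

theorem act_liftMat
    (M : Matrix (Option ι × (ι → Option Out) × Fin w) (Option ι × (ι → Option Out) × Fin w) ℂ)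
    (ψ) : act (liftMat e M) (liftState e ψ) = liftState e (act M ψ) := by
  ext a
  rw [act_apply, ← Equiv.sum_comp (splitMem e).symm, Fintype.sum_prod_type_right,
    Finset.sum_eq_single (splitMem e a).2]
  · by_cases h : (splitMem e a).2 = (none, fun _ => none)
    · simp [liftMat, liftState, h, act_apply]
    · simp [liftMat, liftState, h]
  · intro m _ hm
    simp [liftMat, Ne.symm hm]
  · simp

theorem act_queryOp_liftState (p : ι → Out → ℝ) (ψ) :
    act (queryOp (compressionUnitary p) N) (liftState e ψ) =
      liftState e (act (queryOp (compressionUnitary p) w) ψ) := by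
  ext ⟨_ | x, db, j⟩
  · rw [act_queryOp_none]
    simp only [liftState, splitMem, Equiv.coe_fn_mk, act_queryOp_none]
    congr
  · rw [act_queryOp_some]
    by_cases h : (e j).2 = (none, fun _ => none)
    · simp [liftState, splitMem, h, act_queryOp_some]
    · simp [liftState, splitMem, h]

theorem norm_liftState (ψ : EuclideanSpace ℂ (Option ι × (ι → Option Out) × Fin w)) :
    ‖liftState e ψ‖ = ‖ψ‖ := by
  refine (sq_eq_sq₀ (norm_nonneg _) (norm_nonneg _)).mp ?_
  rw [EuclideanSpace.norm_sq_eq, EuclideanSpace.norm_sq_eq,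
    ← Equiv.sum_comp (splitMem e).symm, Fintype.sum_prod_type_right,
    Finset.sum_eq_single (none, fun _ => none)]
  · simp [liftState]
  · intro m _ hm
    simp [liftState, hm]
  · simp

/-- Exchange the query and database registers with the memory. -/
def swapMem : Equiv.Perm (Option ι × (ι → Option Out) × Fin N) :=
  (splitMem e).trans
    (({ toFun := fun a => ((a.2.1, a.2.2, a.1.2.2), (a.1.1, a.1.2.1))
        invFun := fun a => ((a.2.1, a.2.2, a.1.2.2), (a.1.1, a.1.2.1))
        left_inv := fun _ => rfl
        right_inv := fun _ => rfl } :
      Equiv.Perm ((Option ι × (ι → Option Out) × Fin w) × Mem ι Out)).trans (splitMem e).symm)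

/-- Exchange the query `f x` with the absence of a query, where `x` is the query in the memory. -/
def askMem (f : ι → ι) : Equiv.Perm (Option ι × (ι → Option Out) × Fin N) where
  toFun a := (Equiv.swap none ((e a.2.2).2.1.map f) a.1, a.2)
  invFun a := (Equiv.swap none ((e a.2.2).2.1.map f) a.1, a.2)
  left_inv a := by simp
  right_inv a := by simp

theorem askMem_symm (f : ι → ι) : (askMem e f).symm = askMem e f := rfl

/-- The state with the modified query, before it is made. -/
theorem act_prepare (f : ι → ι) (ψ : EuclideanSpace ℂ (Option ι × (ι → Option Out) × Fin w))
    (qr : Option ι) (db db₂ : ι → Option Out) (j : Fin w) (x : Option ι) :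
    act (permMat ((swapMem e).trans (askMem e f))) (liftState e ψ)
      (qr, db, e.symm (j, (x, db₂))) =
      if qr = x.map f ∧ db = (fun _ => none) then ψ (x, db₂, j) else 0 := by
  rw [act_permMat]
  have : Equiv.swap none (x.map f) qr = none ↔ qr = x.map f := by
    rw [Equiv.swap_apply_eq_iff, Equiv.swap_apply_left]
  simp [liftState, swapMem, askMem, splitMem, this]

/-- The final state after one modified query: amplitudes of the records. -/
theorem act_sample (p : ι → Out → ℝ) (f : ι → ι)
    (ψ : EuclideanSpace ℂ (Option ι × (ι → Option Out) × Fin w))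
    (db₂ : ι → Option Out) (j : Fin w) (x : ι) (o : Out) :
    act (permMat (askMem e f)) (act (queryOp (compressionUnitary p) N)
        (act (permMat ((swapMem e).trans (askMem e f))) (liftState e ψ)))
      (none, Function.update (fun _ => none) (f x) (some o), e.symm (j, (some x, db₂))) =
      (√(p (f x) o) : ℂ) * ψ (some x, db₂, j) := by
  have h : (askMem e f).symm
      (none, Function.update (fun _ => none) (f x) (some o), e.symm (j, (some x, db₂))) =
      (some (f x), Function.update (fun _ => none) (f x) (some o),
        e.symm (j, (some x, db₂))) := by
    simp [askMem]
  rw [act_permMat, h, act_queryOp_some, Finset.sum_eq_single none]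
  · rw [act_prepare]
    simp [cellUnitary_some_none]
  · intro c _ hc
    rw [act_prepare, if_neg, mul_zero]
    rintro ⟨-, h⟩
    exact hc (by simpa using congrFun h (f x))
  · simp

/-- The modified query is in the query register exactly as long as the memory holds its source, and
the second `askMem` exchanges it with `none`. The register is therefore idle afterwards. -/
theorem act_sample_of_ne_none (p : ι → Out → ℝ) (f : ι → ι)
    (ψ : EuclideanSpace ℂ (Option ι × (ι → Option Out) × Fin w)) (y : ι) (r) :
    act (permMat (askMem e f)) (act (queryOp (compressionUnitary p) N)
        (act (permMat ((swapMem e).trans (askMem e f))) (liftState e ψ))) (some y, r) = 0 := by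
  obtain ⟨db, i⟩ := r
  obtain ⟨⟨j, x, db₂⟩, rfl⟩ := e.symm.surjective i
  rw [act_permMat, askMem_symm]
  have hne : ∀ qr, qr ≠ x.map f → ∀ db,
      act (queryOp (compressionUnitary p) N)
        (act (permMat ((swapMem e).trans (askMem e f))) (liftState e ψ))
        (qr, db, e.symm (j, (x, db₂))) = 0 := by
    rintro (_ | qr) hqr db
    · rw [act_queryOp_none, act_prepare, if_neg (by tauto)]
    · rw [act_queryOp_some, Finset.sum_eq_zero]
      intro c _
      rw [act_prepare, if_neg (by tauto), mul_zero]
  apply hne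
  simp only [Equiv.apply_symm_apply]
  rw [Ne, Equiv.swap_apply_eq_iff, Equiv.swap_apply_right]
  simp

theorem act_queryOp_of_none (p : ι → Out → ℝ)
    (ψ : EuclideanSpace ℂ (Option ι × (ι → Option Out) × Fin N))
    (h : ∀ y r, ψ (some y, r) = 0) : act (queryOp (compressionUnitary p) N) ψ = ψ := by
  ext ⟨_ | x, db, j⟩
  · rw [act_queryOp_none]
  · rw [act_queryOp_some, h, Finset.sum_eq_zero]
    intro c _
    rw [h, mul_zero]

end Sampler

/-! ### The sampler as a query algorithm -/

section SamplerAlg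

variable {Z : Type u} [MeasurableSpace Z] {ℓ q lam : ℕ}

theorem measurable_const_mul_matrix {β : Type} [Fintype β] [DecidableEq β] (V : Matrix β β ℂ)
    {M : Z → Matrix β β ℂ} (hM : ∀ a b, Measurable fun z => M z a b) (a b : β) :
    Measurable fun z => (V * M z) a b := by
  simp only [Matrix.mul_apply]
  exact Finset.measurable_sum _ fun c _ => (hM c b).const_mul _

/-- The unitary that the sampler applies before its query number `s`. -/
noncomputable def samplerMat {N w : ℕ} (e : Fin N ≃ Fin w × Mem (QueryIdx ℓ q) (CellOut q lam))
    (f : QueryIdx ℓ q → QueryIdx ℓ q) (t s : ℕ) :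
    Matrix (AlgBasis ℓ q lam N) (AlgBasis ℓ q lam N) ℂ :=
  if s = t then permMat ((swapMem e).trans (askMem e f))
  else if s = t + 1 then permMat (askMem e f) else 1

theorem samplerMat_mem_unitaryGroup {N w : ℕ}
    (e : Fin N ≃ Fin w × Mem (QueryIdx ℓ q) (CellOut q lam))
    (f : QueryIdx ℓ q → QueryIdx ℓ q) (t s : ℕ) :
    samplerMat e f t s ∈ Matrix.unitaryGroup _ ℂ := by
  unfold samplerMat
  split_ifs
  · exact permMat_mem_unitaryGroup _
  · exact permMat_mem_unitaryGroup _
  · exact one_mem _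

/-- The initial state of the sampler. -/
noncomputable def samplerInit {N w : ℕ} (e : Fin N ≃ Fin w × Mem (QueryIdx ℓ q) (CellOut q lam))
    (f : QueryIdx ℓ q → QueryIdx ℓ q) (t : ℕ) (ψ : EuclideanSpace ℂ (AlgBasis ℓ q lam w)) :
    EuclideanSpace ℂ (AlgBasis ℓ q lam N) :=
  act (samplerMat e f t 0) (liftState e ψ)

/-- The operator that the sampler applies after its query number `s`. -/
noncomputable def samplerStep {N w : ℕ} (e : Fin N ≃ Fin w × Mem (QueryIdx ℓ q) (CellOut q lam))
    (f : QueryIdx ℓ q → QueryIdx ℓ q) (t : ℕ)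
    (V : ℕ → Matrix (AlgBasis ℓ q lam w) (AlgBasis ℓ q lam w) ℂ) (s : ℕ) :
    Matrix (AlgBasis ℓ q lam N) (AlgBasis ℓ q lam N) ℂ :=
  samplerMat e f t (s + 1) * (if s < t then liftMat e (V s) else 1)

/-- Run `A` for `t` queries, then put aside its query and database registers and make, with a fresh
database, the query `f x`, where `x` is the next query of `A`. -/
noncomputable def QueryAlg.sampler (A : QueryAlg Z ℓ q lam) (t : ℕ)
    (f : QueryIdx ℓ q → QueryIdx ℓ q) {N : ℕ}
    (e : Fin N ≃ Fin A.w × Mem (QueryIdx ℓ q) (CellOut q lam)) : QueryAlg Z ℓ q lam where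
  w := N
  init z := samplerInit e f t (A.init z)
  step s z := samplerStep e f t (fun s => A.step s z) s
  norm_init z := by
    rw [samplerInit, norm_act_of_mem_unitaryGroup (samplerMat_mem_unitaryGroup e f t 0),
      norm_liftState, A.norm_init]
  step_unitary s z := by
    refine mul_mem (samplerMat_mem_unitaryGroup e f t _) ?_
    split_ifs
    · exact liftMat_mem_unitaryGroup e (A.step_unitary s z)
    · exact one_mem _
  measurable_init a := by
    simp only [samplerInit, act_apply]
    refine Finset.measurable_sum _ fun b _ => Measurable.const_mul ?_ _
    simp only [liftState]
    split_ifs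
    · exact A.measurable_init _
    · exact measurable_const
  measurable_step s a b := by
    refine measurable_const_mul_matrix _ (fun a b => ?_) a b
    split_ifs
    · simp only [liftMat, Matrix.of_apply]
      split_ifs
      · exact A.measurable_step _ _ _
      · exact measurable_const
    · exact measurable_const

section

variable {N w : ℕ} (e : Fin N ≃ Fin w × Mem (QueryIdx ℓ q) (CellOut q lam))
  (f : QueryIdx ℓ q → QueryIdx ℓ q) (t : ℕ) (p : QueryIdx ℓ q → CellOut q lam → ℝ)
  (ψ : EuclideanSpace ℂ (AlgBasis ℓ q lam w))
  (V : ℕ → Matrix (AlgBasis ℓ q lam w) (AlgBasis ℓ q lam w) ℂ)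

theorem sampler_evolve_of_le (s : ℕ) (hs : s ≤ t) :
    evolveFrom p (samplerInit e f t ψ) (samplerStep e f t V) s =
      act (samplerMat e f t s) (liftState e (evolveFrom p ψ V s)) := by
  induction s with
  | zero => rfl
  | succ s ih =>
    have h : samplerMat (lam := lam) e f t s = 1 := by
      simp [samplerMat, show s ≠ t by omega, show s ≠ t + 1 by omega]
    rw [evolveFrom, ih (by omega), h, act_one]
    simp only [samplerStep, show s < t by omega, if_true]
    rw [act_queryOp_liftState, act_mul, act_liftMat]
    rfl

/-- The final state is taken after all `q` queries. Those after the modified one find no query in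
the register and act trivially, so the record survives to the end. -/
theorem sampler_evolve_of_gt (s : ℕ) (hs : t < s) :
    evolveFrom p (samplerInit e f t ψ) (samplerStep e f t V) s =
      act (permMat (askMem e f)) (act (queryOp (compressionUnitary p) N)
        (act (permMat ((swapMem e).trans (askMem e f)))
          (liftState e (evolveFrom p ψ V t)))) := by
  induction s, hs using Nat.le_induction with
  | base =>
    rw [evolveFrom, sampler_evolve_of_le e f t p ψ V t le_rfl]
    simp [samplerStep, samplerMat]
  | succ s hs ih =>
    rw [evolveFrom, ih]
    have h1 : samplerMat (lam := lam) e f t (s + 1) = 1 := by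
      simp [samplerMat, show s + 1 ≠ t by omega, show s ≠ t by omega]
    simp only [samplerStep, show ¬ s < t by omega, if_false, h1, mul_one, act_one]
    exact act_queryOp_of_none p _ (act_sample_of_ne_none e p f _)

/-- The string that the sampler outputs: a function of the record of the modified query. -/
def samplerOut (g : CellOut q lam → BStr q) (a : AlgBasis ℓ q lam N) : BStr q :=
  match (e a.2.2).2.1 with
  | none => ⟨[], by simp⟩
  | some x => match a.2.1 (f x) with
    | none => ⟨[], by simp⟩
    | some o => g o

open Classical in
-- The old query, the old database and the old workspace are kept, so different branches end in
-- different basis states and do not interfere. The probability of a branch is its old weight times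
-- the probability of the record; all remaining basis states contribute nonnegatively.
theorem sum_le_of_sample (hp : ∀ ix o, 0 ≤ p ix o) (g : CellOut q lam → BStr q)
    (T : Set BitStr) :
    ∑ ix, qmass ψ ix * (∑ o, if (g o).val ∈ T then p (f ix) o else 0) ≤
      ∑ a, if (samplerOut e f g a).val ∈ T then
        ‖act (permMat (askMem e f)) (act (queryOp (compressionUnitary p) N)
          (act (permMat ((swapMem e).trans (askMem e f))) (liftState e ψ))) a‖ ^ 2 else 0 := by
  let J : (QueryIdx ℓ q × CellOut q lam × Fin w × (QueryIdx ℓ q → Option (CellOut q lam))) →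
      AlgBasis ℓ q lam N := fun r =>
    (none, Function.update (fun _ => none) (f r.1) (some r.2.1),
      e.symm (r.2.2.1, (some r.1, r.2.2.2)))
  have hJ : Function.Injective J := by
    rintro ⟨x, o, j, d⟩ ⟨x', o', j', d'⟩ h
    have h1 := congrArg (fun a : AlgBasis ℓ q lam N => e a.2.2) h
    have h2 := congrArg (fun a : AlgBasis ℓ q lam N => a.2.1) h
    simp only [J, Equiv.apply_symm_apply, Prod.mk.injEq, Option.some.injEq] at h1 h2
    obtain ⟨rfl, rfl, rfl⟩ := h1
    have := congrFun h2 (f x)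
    simp only [Function.update_self, Option.some.injEq] at this
    rw [this]
  refine le_trans (le_of_eq ?_) (Finset.sum_le_univ_sum_of_nonneg
    (s := Finset.univ.map ⟨J, hJ⟩) (fun a => by positivity))
  rw [Finset.sum_map]
  refine Eq.trans ?_ (Fintype.sum_prod_type _).symm
  refine Finset.sum_congr rfl fun x _ => ?_
  rw [Fintype.sum_prod_type, Finset.mul_sum]
  refine Finset.sum_congr rfl fun o _ => ?_
  have hout : ∀ r, samplerOut e f g (J (x, o, r)) = g o := fun r => by simp [samplerOut, J]
  simp only [Function.Embedding.coeFn_mk, hout]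
  split_ifs
  · rw [Fintype.sum_prod_type, qmass, Finset.sum_mul]
    refine Finset.sum_congr rfl fun j _ => ?_
    rw [Finset.sum_mul]
    refine Finset.sum_congr rfl fun d _ => ?_
    simp only [J]
    rw [act_sample e p f ψ d j x o, norm_mul, mul_pow, Complex.norm_real, Real.norm_eq_abs,
      sq_abs, Real.sq_sqrt (hp _ _), mul_comm]
  · simp

end

open Classical in
/-- The record of the modified query is distributed as the answer to the modified query. -/
theorem QueryAlg.exists_sampler (A : QueryAlg Z ℓ q lam) (t : ℕ) (ht : t < q)
    (f : QueryIdx ℓ q → QueryIdx ℓ q) (g : CellOut q lam → BStr q) :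
    ∃ (B : QueryAlg Z ℓ q lam) (out : AlgBasis ℓ q lam B.w → BStr q),
      ∀ (S : OracleSet lam) (z : Z) (T : Set BitStr), (∀ ix o, 0 ≤ breakFamily ℓ q S ix o) →
        ∑ ix, qmass (A.evolve (breakFamily ℓ q S) z t) ix *
          (∑ o, if (g o).val ∈ T then breakFamily ℓ q S (f ix) o else 0) ≤
        B.hitProb S z out T := by
  let e := (Fintype.equivFin (Fin A.w × Mem (QueryIdx ℓ q) (CellOut q lam))).symm
  refine ⟨A.sampler t f e, samplerOut e f g, fun S z T hS => ?_⟩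
  unfold QueryAlg.hitProb QueryAlg.final
  rw [QueryAlg.state_eq_evolve]
  have h := sum_le_of_sample e f _ (A.evolve (breakFamily ℓ q S) z t) hS g T
  rw [QueryAlg.evolve, ← sampler_evolve_of_gt e f t _ _ _ q ht] at h
  exact h

end SamplerAlg

/-! Gates and circuits -/

section Gates

variable {n : ℕ}

theorem xorWires_of_notMem {ys : List (Fin n)} {w : BitStr} {b : Fin n → Bool} {k : Fin n}
    (hk : k ∉ ys) : xorWires ys w b k = b k := by
  induction ys generalizing w b with
  | nil => cases w <;> rfl
  | cons y ys ih =>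
    rw [List.mem_cons, not_or] at hk
    cases w with
    | nil => rfl
    | cons c w => rw [xorWires, ih hk.2, Function.update_of_ne hk.1]

theorem xorWires_update (ys : List (Fin n)) (w : BitStr) (b : Fin n → Bool) (k : Fin n)
    (c : Bool) : xorWires ys w (Function.update b k (xor (b k) c)) =
      Function.update (xorWires ys w b) k (xor (xorWires ys w b k) c) := by
  induction ys generalizing w b with
  | nil => cases w <;> rfl
  | cons y ys ih =>
    cases w with
    | nil => rfl
    | cons d w =>
      rw [xorWires, xorWires, ← ih]
      congr 1
      by_cases h : y = k
      · subst h
        simp only [Function.update_self, Function.update_idem]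
        congr 1
        cases b y <;> cases c <;> cases d <;> rfl
      · rw [Function.update_of_ne h, Function.update_comm h,
          Function.update_of_ne (Ne.symm h)]

theorem xorWires_xorWires (ys : List (Fin n)) (w : BitStr) (b : Fin n → Bool) :
    xorWires ys w (xorWires ys w b) = b := by
  induction ys generalizing w b with
  | nil => cases w <;> rfl
  | cons y ys ih =>
    cases w with
    | nil => rfl
    | cons d w =>
      rw [xorWires, xorWires, ← xorWires_update, ih]
      simp

theorem readWires_xorWires {xs ys : List (Fin n)} (h : List.Disjoint xs ys) (w : BitStr)
    (b : Fin n → Bool) : readWires xs (xorWires ys w b) = readWires xs b :=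
  List.map_congr_left fun _ hk => xorWires_of_notMem (h hk)

/-- CNOT and oracle gates permute the computational basis by an involution. -/
theorem norm_act_involutive {β : Type} [Fintype β] {f : β → β}
    (hf : Function.Involutive f) {M : Matrix β β ℂ} (h1 : ∀ b, M (f b) b = 1)
    (h0 : ∀ b' b, b' ≠ f b → M b' b = 0) (v : EuclideanSpace ℂ β) : ‖act M v‖ = ‖v‖ := by
  classical
  have : M = permMat hf.toPerm := by
    ext a b
    by_cases h : a = f b
    · simp [permMat, h, h1]
    · simp [permMat, h0 a b h, Ne.symm h]
  rw [this, norm_act_of_mem_unitaryGroup (permMat_mem_unitaryGroup _)]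

/-- On each pair of basis states that differ only in wire `k` this is the parallelogram law. -/
theorem norm_act_hadamard (O : Oracle) (k : Fin n) (v : EuclideanSpace ℂ (Fin n → Bool)) :
    ‖act ((Gate.hadamard k).mat O) v‖ = ‖v‖ := by
  have key : ∀ F : (Fin n → Bool) → ℝ, ∑ b, F b =
      ∑ r, ∑ c, F ((Equiv.funSplitAt k Bool).symm (c, r)) := fun F => by
    rw [← Equiv.sum_comp (Equiv.funSplitAt k Bool).symm, Fintype.sum_prod_type_right]
  have hx : ∀ c r, (Equiv.funSplitAt k Bool).symm (c, r) k = c := fun c r => by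
    simp [Equiv.funSplitAt, Equiv.piSplitAt]
  have hy : ∀ c r, ∀ j (h : j ≠ k), (Equiv.funSplitAt k Bool).symm (c, r) j = r ⟨j, h⟩ :=
    fun c r j h => by simp [Equiv.funSplitAt, Equiv.piSplitAt, h]
  have hact : ∀ c' r, act ((Gate.hadamard k).mat O) v ((Equiv.funSplitAt k Bool).symm (c', r)) =
      ∑ c, (if c' = true ∧ c = true then -1 else 1) / (Real.sqrt 2 : ℂ) *
        v ((Equiv.funSplitAt k Bool).symm (c, r)) := fun c' r => by
    rw [act_apply, ← Equiv.sum_comp (Equiv.funSplitAt k Bool).symm, Fintype.sum_prod_type_right,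
      Finset.sum_eq_single r]
    · refine Finset.sum_congr rfl fun c _ => ?_
      rw [Gate.mat, Matrix.of_apply, if_pos, hx, hx]
      intro j hj
      rw [hy _ _ _ hj, hy _ _ _ hj]
    · intro r' _ hr
      refine Finset.sum_eq_zero fun c _ => ?_
      rw [Gate.mat, Matrix.of_apply, if_neg, zero_mul]
      intro h
      refine hr (funext fun j => ?_)
      have := h j.1 j.2
      rw [hy _ _ _ j.2, hy _ _ _ j.2] at this
      exact this.symm
    · simp
  refine (sq_eq_sq₀ (norm_nonneg _) (norm_nonneg _)).mp ?_
  rw [EuclideanSpace.norm_sq_eq, EuclideanSpace.norm_sq_eq, key, key]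
  refine Finset.sum_congr rfl fun r _ => ?_
  simp only [Fintype.sum_bool, hact, and_true, Bool.false_eq_true, and_false,
    if_true, if_false]
  set x := v ((Equiv.funSplitAt k Bool).symm (true, r))
  set y := v ((Equiv.funSplitAt k Bool).symm (false, r))
  have h2 : ‖(Real.sqrt 2 : ℂ)‖ ^ 2 = 2 := by
    rw [Complex.norm_real, Real.norm_eq_abs, sq_abs, Real.sq_sqrt (by norm_num)]
  have e1 : -1 / (Real.sqrt 2 : ℂ) * x + 1 / (Real.sqrt 2 : ℂ) * y =
      (y - x) / (Real.sqrt 2 : ℂ) := by ring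
  have e2 : 1 / (Real.sqrt 2 : ℂ) * x + 1 / (Real.sqrt 2 : ℂ) * y =
      (y + x) / (Real.sqrt 2 : ℂ) := by ring
  rw [e1, e2, norm_div, norm_div, div_pow, div_pow, h2]
  have := parallelogram_law_with_norm ℝ y x
  nlinarith

theorem norm_act_gate (O : Oracle) (g : Gate n) (v : EuclideanSpace ℂ (Fin n → Bool)) :
    ‖act (g.mat O) v‖ = ‖v‖ := by
  cases g with
  | hadamard k => exact norm_act_hadamard O k v
  | tGate k =>
    have h : ∀ b, act ((Gate.tGate k).mat O) v b =
        (if b k = true then Complex.exp (Complex.I * Real.pi / 4) else 1) * v b := fun b => by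
      rw [act_apply, Finset.sum_eq_single b]
      · simp [Gate.mat]
      · intro c _ hc
        simp [Gate.mat, Ne.symm hc]
      · simp
    have he : ‖Complex.exp (Complex.I * Real.pi / 4)‖ = 1 := by
      rw [Complex.norm_exp]
      simp
    refine (sq_eq_sq₀ (norm_nonneg _) (norm_nonneg _)).mp ?_
    rw [EuclideanSpace.norm_sq_eq, EuclideanSpace.norm_sq_eq]
    refine Finset.sum_congr rfl fun b _ => ?_
    rw [h]
    split_ifs <;> simp [he]
  | cnot c t h =>
    refine norm_act_involutive (f := fun b => Function.update b t (xor (b t) (b c))) ?_ ?_ ?_ v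
    · intro b
      simp only [Function.update_self, Function.update_of_ne h, Function.update_idem]
      simp
    · intro b
      exact if_pos rfl
    · intro b' b hb
      exact if_neg hb
  | query xs ys h =>
    refine norm_act_involutive (f := fun b => xorWires ys (O (readWires xs b)) b) ?_ ?_ ?_ v
    · intro b
      simp only [readWires_xorWires h, xorWires_xorWires]
    · intro b
      exact if_pos rfl
    · intro b' b hb
      exact if_neg hb

/-- Run a list of gates. -/
noncomputable def runGates (O : Oracle) (gs : List (Gate n))
    (ψ : EuclideanSpace ℂ (Fin n → Bool)) : EuclideanSpace ℂ (Fin n → Bool) :=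
  gs.foldl (fun φ g => act (g.mat O) φ) ψ

theorem runGates_concat (O : Oracle) (gs : List (Gate n)) (g : Gate n)
    (ψ : EuclideanSpace ℂ (Fin n → Bool)) :
    runGates O (gs ++ [g]) ψ = act (g.mat O) (runGates O gs ψ) := by
  simp [runGates]

theorem norm_runGates (O : Oracle) (gs : List (Gate n)) (ψ : EuclideanSpace ℂ (Fin n → Bool)) :
    ‖runGates O gs ψ‖ = ‖ψ‖ := by
  induction gs using List.reverseRecOn with
  | nil => rfl
  | append_singleton gs g ih => rw [runGates_concat, norm_act_gate, ih]

theorem runGates_zero (O : Oracle) (gs : List (Gate n)) : runGates O gs 0 = 0 := by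
  rw [← norm_eq_zero, norm_runGates, norm_zero]

open Classical in
/-- The weight of the oracle queries in `T` that a gate makes. -/
noncomputable def gateHit (T : Set BitStr) (φ : EuclideanSpace ℂ (Fin n → Bool)) :
    Gate n → ℝ
  | .query xs _ _ => ∑ b, if readWires xs b ∈ T then ‖φ b‖ ^ 2 else 0
  | _ => 0

/-- The two gates agree on the part of the state whose query lies outside the difference set. On the
rest both are isometries, which gives the factor `2`. -/
theorem norm_act_gate_sub_le (O O' : Oracle) (g : Gate n)
    (φ : EuclideanSpace ℂ (Fin n → Bool)) :
    ‖act (g.mat O) φ - act (g.mat O') φ‖ ≤ 2 * √(gateHit {x | O x ≠ O' x} φ g) := by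
  classical
  cases g with
  | query xs ys h =>
    let P : EuclideanSpace ℂ (Fin n → Bool) :=
      WithLp.toLp 2 fun b => if O (readWires xs b) ≠ O' (readWires xs b) then φ b else 0
    have hP : √(gateHit {x | O x ≠ O' x} φ (.query xs ys h)) = ‖P‖ := by
      rw [← Real.sqrt_sq (norm_nonneg P), EuclideanSpace.norm_sq_eq]
      congr 1
      refine Finset.sum_congr rfl fun b _ => ?_
      by_cases hb : O (readWires xs b) = O' (readWires xs b) <;> simp [P, hb]
    have e : act ((Gate.query xs ys h).mat O) (φ - P) =
        act ((Gate.query xs ys h).mat O') (φ - P) := by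
      ext b'
      rw [act_apply, act_apply]
      refine Finset.sum_congr rfl fun b _ => ?_
      by_cases hb : O (readWires xs b) = O' (readWires xs b)
      · simp [Gate.mat, hb]
      · simp [P, hb]
    rw [act_sub, act_sub] at e
    have e' : act ((Gate.query xs ys h).mat O) φ - act ((Gate.query xs ys h).mat O') φ =
        act ((Gate.query xs ys h).mat O) P - act ((Gate.query xs ys h).mat O') P := by
      rw [sub_eq_iff_eq_add] at e ⊢
      rw [e]; abel
    rw [e', hP]
    refine (norm_sub_le _ _).trans ?_
    rw [norm_act_gate, norm_act_gate]
    linarith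
  | _ => simp [Gate.mat]

/-- Hybrid argument over the gates. All weights are measured along the run with `O`; the run with
`O'` enters only through isometries. -/
theorem norm_runGates_sub_le (O O' : Oracle) (gs : List (Gate n)) (c : ℝ)
    (φ φ' : EuclideanSpace ℂ (Fin n → Bool))
    (h : ∀ k g, gs[k]? = some g →
      √(gateHit {x | O x ≠ O' x} (runGates O (gs.take k) φ) g) ≤ c) :
    ‖runGates O gs φ - runGates O' gs φ'‖ ≤ ‖φ - φ'‖ + gs.length * (2 * c) := by
  induction gs using List.reverseRecOn with
  | nil => simp [runGates]
  | append_singleton gs g ih =>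
    have h1 := ih fun k g' hk => by
      obtain ⟨hk', -⟩ := List.getElem?_eq_some_iff.1 hk
      have := h k g' (by rwa [List.getElem?_append_left hk'])
      rwa [List.take_append_of_le_length hk'.le] at this
    have h2 := h gs.length g (by simp)
    rw [List.take_left] at h2
    rw [runGates_concat, runGates_concat]
    have h3 := norm_sub_le_norm_sub_add_norm_sub (act (g.mat O) (runGates O gs φ))
      (act (g.mat O') (runGates O gs φ)) (act (g.mat O') (runGates O' gs φ'))
    rw [← act_sub (g.mat O'), norm_act_gate] at h3
    have h4 := norm_act_gate_sub_le O O' g (runGates O gs φ)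
    simp only [List.length_append, List.length_singleton, Nat.cast_add, Nat.cast_one]
    nlinarith

/-! Measurements -/

theorem projOnto_sub (xs : List (Fin n)) (s : BitStr) (φ ψ : EuclideanSpace ℂ (Fin n → Bool)) :
    projOnto xs s (φ - ψ) = projOnto xs s φ - projOnto xs s ψ := by
  ext b
  by_cases h : readWires xs b = s <;> simp [projOnto, h]

theorem norm_projOnto_sq (xs : List (Fin n)) (s : BitStr)
    (φ : EuclideanSpace ℂ (Fin n → Bool)) :
    ‖projOnto xs s φ‖ ^ 2 = ∑ b, if readWires xs b = s then ‖φ b‖ ^ 2 else 0 := by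
  rw [EuclideanSpace.norm_sq_eq]
  refine Finset.sum_congr rfl fun b _ => ?_
  by_cases h : readWires xs b = s <;> simp [projOnto, h]

open Classical in
-- An outcome has one bit for each wire of the register, so strings of length at most `q` exhaust
-- the outcomes.
theorem sum_norm_projOnto_sq_mem {q : ℕ} {xs : List (Fin n)} (hxs : xs.length ≤ q)
    (T : Set BitStr) (φ : EuclideanSpace ℂ (Fin n → Bool)) :
    ∑ s : BStr q, (if s.val ∈ T then ‖projOnto xs s.val φ‖ ^ 2 else 0) =
      ∑ b, if readWires xs b ∈ T then ‖φ b‖ ^ 2 else 0 := by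
  simp only [norm_projOnto_sq]
  have : ∀ s : BStr q, (if s.val ∈ T then ∑ b, (if readWires xs b = s.val then ‖φ b‖ ^ 2 else 0)
      else 0) = ∑ b, if readWires xs b = s.val then
        (if readWires xs b ∈ T then ‖φ b‖ ^ 2 else 0) else 0 := fun s => by
    by_cases hs : s.val ∈ T
    · rw [if_pos hs]
      refine Finset.sum_congr rfl fun b _ => ?_
      by_cases h : readWires xs b = s.val <;> simp [h, hs]
    · rw [if_neg hs]
      symm
      refine Finset.sum_eq_zero fun b _ => ?_
      by_cases h : readWires xs b = s.val <;> simp [h, hs]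
  simp only [this]
  rw [Finset.sum_comm]
  refine Finset.sum_congr rfl fun b _ => ?_
  rw [Finset.sum_eq_single (⟨readWires xs b, by simpa [readWires] using hxs⟩ : BStr q)]
  · simp
  · intro s _ hs
    rw [if_neg]
    intro h
    exact hs (Subtype.ext h.symm)
  · simp

theorem sum_norm_projOnto_sq {q : ℕ} {xs : List (Fin n)} (hxs : xs.length ≤ q)
    (φ : EuclideanSpace ℂ (Fin n → Bool)) :
    ∑ s : BStr q, ‖projOnto xs s.val φ‖ ^ 2 = ‖φ‖ ^ 2 := by
  have := sum_norm_projOnto_sq_mem hxs Set.univ φ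
  simpa [EuclideanSpace.norm_sq_eq] using this

/-- Normalize a vector. -/
noncomputable def normalized (φ : EuclideanSpace ℂ (Fin n → Bool)) :
    EuclideanSpace ℂ (Fin n → Bool) := ((‖φ‖⁻¹ : ℝ) : ℂ) • φ

theorem norm_normalized {φ : EuclideanSpace ℂ (Fin n → Bool)} (h : φ ≠ 0) :
    ‖normalized φ‖ = 1 := by
  rw [normalized, norm_smul, Complex.norm_real, norm_inv, norm_norm,
    inv_mul_cancel₀ (norm_ne_zero_iff.2 h)]

/-- Multiplying the difference of the unit vectors by `‖a‖` gives `a - b` plus `‖b‖ - ‖a‖` times a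
unit vector. The factor `‖a‖` is the price of normalization: it will become the amplitude of the
outcome. The convention that the zero vector normalizes to itself is covered too. -/
theorem norm_mul_norm_normalized_sub_le (a b : EuclideanSpace ℂ (Fin n → Bool)) :
    ‖a‖ * ‖normalized a - normalized b‖ ≤ 2 * ‖a - b‖ := by
  by_cases ha : a = 0
  · simp [ha]
  by_cases hb : b = 0
  · subst hb
    have : normalized (0 : EuclideanSpace ℂ (Fin n → Bool)) = 0 := by simp [normalized]
    rw [this, sub_zero, norm_normalized ha, sub_zero]
    linarith [norm_nonneg a]
  have ha' := norm_ne_zero_iff.2 ha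
  have e : ((‖a‖ : ℝ) : ℂ) • (normalized a - normalized b) =
      (a - b) + ((‖b‖ - ‖a‖ : ℝ) : ℂ) • normalized b := by
    have h1 : ((‖a‖ : ℝ) : ℂ) • normalized a = a := by
      rw [normalized, smul_smul, ← Complex.ofReal_mul, mul_inv_cancel₀ ha']
      simp
    have h2 : ((‖b‖ : ℝ) : ℂ) • normalized b = b := by
      rw [normalized, smul_smul, ← Complex.ofReal_mul, mul_inv_cancel₀ (norm_ne_zero_iff.2 hb)]
      simp
    rw [smul_sub, h1, Complex.ofReal_sub, sub_smul, h2]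
    abel
  have h3 : ‖a‖ * ‖normalized a - normalized b‖ =
      ‖((‖a‖ : ℝ) : ℂ) • (normalized a - normalized b)‖ := by
    rw [norm_smul, Complex.norm_real, norm_norm]
  rw [h3, e]
  refine (norm_add_le _ _).trans ?_
  rw [norm_smul, norm_normalized hb, mul_one, Complex.norm_real, Real.norm_eq_abs]
  have := abs_norm_sub_norm_le b a
  rw [norm_sub_rev] at this
  linarith

open Classical in
/-- Measurement outcomes whose post-measurement states are far apart are unlikely. -/
theorem sum_norm_projOnto_sq_far_le {q : ℕ} {xs : List (Fin n)} (hxs : xs.length ≤ q)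
    (a b : EuclideanSpace ℂ (Fin n → Bool)) {η : ℝ} (hη : 0 < η) :
    ∑ s : BStr q, (if η < ‖normalized (projOnto xs s.val a) - normalized (projOnto xs s.val b)‖
      then ‖projOnto xs s.val a‖ ^ 2 else 0) ≤ 4 * ‖a - b‖ ^ 2 / η ^ 2 := by
  rw [le_div_iff₀ (by positivity), Finset.sum_mul, ← sum_norm_projOnto_sq hxs (a - b),
    Finset.mul_sum]
  refine Finset.sum_le_sum fun s _ => ?_
  rw [projOnto_sub]
  set a' := projOnto xs s.val a
  set b' := projOnto xs s.val b
  have h := norm_mul_norm_normalized_sub_le a' b'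
  split_ifs with hs
  · calc ‖a'‖ ^ 2 * η ^ 2 ≤ ‖a'‖ ^ 2 * ‖normalized a' - normalized b'‖ ^ 2 := by gcongr
      _ = (‖a'‖ * ‖normalized a' - normalized b'‖) ^ 2 := by ring
      _ ≤ (2 * ‖a' - b'‖) ^ 2 := by gcongr
      _ = _ := by ring
  · rw [zero_mul]; positivity

theorem postState_nil (O : Oracle) :
    postState O ([] : Transcript n) = EuclideanSpace.single (fun _ => false) 1 := rfl

theorem postState_concat (O : Oracle) (v : Transcript n) (C : Circuit n) (s : BitStr) :
    postState O (v ++ [(C, s)]) =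
      normalized (projOnto C.out s (runGates O C.gates (postState O v))) := by
  simp only [postState, List.foldl_append, List.foldl_cons, List.foldl_nil]
  rfl

theorem norm_postState (O : Oracle) (v : Transcript n) (h : postState O v ≠ 0) :
    ‖postState O v‖ = 1 := by
  induction v using List.reverseRecOn with
  | nil => simp [postState_nil]
  | append_singleton v p ih =>
    obtain ⟨C, s⟩ := p
    rw [postState_concat] at h ⊢
    refine norm_normalized fun h0 => h ?_
    rw [h0]
    simp [normalized]

end Gates

/-! Parsing and lengths -/

theorem parseBreakInput_eq_some {x : BitStr} {a : BreakInput} :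
    parseBreakInput x = some a ↔ a.encode = x := by
  classical
  unfold parseBreakInput
  split_ifs with h
  · rw [Option.some.injEq]
    refine ⟨fun e => e ▸ h.choose_spec, fun e => BreakInput.encode_injective ?_⟩
    rw [e, h.choose_spec]
  · simp only [false_iff]
    exact fun e => h ⟨a, e⟩

theorem length_encList {α : Type} (f : α → BitStr) (l : List α) :
    (encList f l).length = (l.map fun a => (f a).length + 1).sum + 1 := by
  induction l with
  | nil => rfl
  | cons a l ih => simp [encList, ih]; ring

theorem length_le_length_encList {α : Type} (f : α → BitStr) (l : List α) :
    l.length ≤ (encList f l).length := by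
  induction l with
  | nil => simp
  | cons a l ih => simp [encList]; omega

theorem length_out_le {q : ℕ} {a : BreakInput} (h : a.encode.length ≤ q) :
    a.C.out.length ≤ q := by
  have := length_le_length_encList (fun k : Fin a.n => encNat k) a.C.out
  simp only [BreakInput.encode, encCircuit, List.length_append] at h
  omega

theorem length_gates_le {q : ℕ} {a : BreakInput} (h : a.encode.length ≤ q) :
    a.C.gates.length ≤ q := by
  have := length_le_length_encList encGate a.C.gates
  simp only [BreakInput.encode, encCircuit, List.length_append] at h
  omega

/-- Stop the circuit before its `k`-th gate, if this gate is a query, and output its query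
register. -/
def BreakInput.trunc (a : BreakInput) (k : ℕ) : BreakInput :=
  match a.C.gates[k]? with
  | some (.query xs _ _) => ⟨a.n, a.v, a.σ, ⟨a.C.gates.take k, xs⟩⟩
  | _ => a

theorem BreakInput.trunc_of_query {a : BreakInput} {k : ℕ} {xs ys : List (Fin a.n)}
    {h : List.Disjoint xs ys} (hk : a.C.gates[k]? = some (.query xs ys h)) :
    a.trunc k = ⟨a.n, a.v, a.σ, ⟨a.C.gates.take k, xs⟩⟩ := by
  simp [BreakInput.trunc, hk]

/-- The dropped query gate already carries an encoding of `xs`, so moving `xs` to the output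
register costs nothing. Thus the sampler respects the length bound `q` of the original algorithm. -/
theorem BreakInput.length_encode_trunc_le (a : BreakInput) (k : ℕ) :
    (a.trunc k).encode.length ≤ a.encode.length := by
  unfold BreakInput.trunc
  split
  · next xs ys h hk =>
    obtain ⟨hlt, hk⟩ := List.getElem?_eq_some_iff.1 hk
    have e : a.C.gates = a.C.gates.take k ++ a.C.gates[k] :: a.C.gates.drop (k + 1) := by
      simp
    have e2 := congrArg (fun l => (encList encGate l).length) e
    have hq : (encGate (.query xs ys h)).length =
        (encList (fun k : Fin a.n => encNat k) xs).length +
          (encList (fun k : Fin a.n => encNat k) ys).length + 2 := by simp [encGate]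
    simp only [length_encList, hk, List.map_append, List.map_cons, List.sum_append,
      List.sum_cons, hq] at e2
    simp only [BreakInput.encode, encCircuit, List.length_append, length_encList]
    omega
  · exact le_rfl

/-- Modify the circuit in a query. -/
noncomputable def truncStr {q : ℕ} (k : ℕ) (x : BStr q) : BStr q :=
  if h : (((parseBreakInput x.val).map fun a => (a.trunc k).encode).getD x.val).length ≤ q then
    ⟨_, h⟩ else x

theorem truncStr_val {q k : ℕ} {x : BStr q} {a : BreakInput}
    (h : parseBreakInput x.val = some a) : (truncStr k x).val = (a.trunc k).encode := by
  have h1 : (a.trunc k).encode.length ≤ q :=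
    (a.length_encode_trunc_le k).trans (by rw [parseBreakInput_eq_some.1 h]; exact x.2)
  simp [truncStr, h, h1]

/-! The distributions of the breaking oracle -/

section Family

variable {ℓ q lam n : ℕ}

/-- The set of oracles `(H, Check, Q)`. -/
def oracleOf (h : BitStr → Option (Fin lam → Bool)) (Q : Oracle) : OracleSet lam :=
  ⟨h, checkOf h, Q⟩

open Classical in
/-- The distribution of a measurement outcome `s` together with the string `G s`. -/
noncomputable def measDist (q : ℕ) (G : BitStr → Option (Fin lam → Bool)) (xs : List (Fin n))
    (φ : EuclideanSpace ℂ (Fin n → Bool)) (o : CellOut q lam) : ℝ :=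
  match o with
  | none => 0
  | some (s, h) => if h = G s.val then ‖projOnto xs s.val φ‖ ^ 2 else 0

theorem sum_cellOut (F : CellOut q lam → ℝ) :
    ∑ o, F o = F none + ∑ s, ∑ h, F (some (s, h)) := by
  rw [Fintype.sum_option, Fintype.sum_prod_type]

theorem isDist_measDist (G : BitStr → Option (Fin lam → Bool)) {xs : List (Fin n)}
    (hxs : xs.length ≤ q) {φ : EuclideanSpace ℂ (Fin n → Bool)} (hφ : ‖φ‖ = 1) :
    IsDist (measDist q G xs φ) := by
  constructor
  · rintro (_ | ⟨s, h⟩)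
    · exact le_rfl
    · simp only [measDist]; positivity
  · rw [sum_cellOut]
    simp [measDist, sum_norm_projOnto_sq hxs, hφ]

/-- The square roots of the probabilities are the norms of the projected states, and the reverse
triangle inequality applies outcome by outcome. -/
theorem hell_measDist_le (G : BitStr → Option (Fin lam → Bool)) {xs : List (Fin n)}
    (hxs : xs.length ≤ q) (φ ψ : EuclideanSpace ℂ (Fin n → Bool)) :
    hell (measDist q G xs φ) (measDist q G xs ψ) ≤ ‖φ - ψ‖ ^ 2 := by
  rw [hell, sum_cellOut, ← sum_norm_projOnto_sq hxs]
  simp only [measDist, sub_self, ne_eq, OfNat.ofNat_ne_zero, not_false_eq_true, zero_pow, zero_add]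
  refine Finset.sum_le_sum fun s _ => ?_
  rw [Finset.sum_eq_single (G s.val)]
  · simp only [if_true, Real.sqrt_sq (norm_nonneg _), projOnto_sub]
    rw [← sq_abs]
    exact pow_le_pow_left₀ (abs_nonneg _) (abs_norm_sub_norm_le _ _) 2
  · intro h _ hh
    simp [hh]
  · simp

open Classical in
-- Only outcomes on which the attached strings differ matter. For each of them the whole mass moves
-- to another record, which counts once at the old and once at the new place.
theorem hell_measDist_puncture_le (G G' : BitStr → Option (Fin lam → Bool)) (xs : List (Fin n))
    (φ : EuclideanSpace ℂ (Fin n → Bool)) :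
    hell (measDist q G xs φ) (measDist q G' xs φ) ≤
      2 * ∑ s : BStr q, if G s.val ≠ G' s.val then ‖projOnto xs s.val φ‖ ^ 2 else 0 := by
  rw [hell, sum_cellOut, Finset.mul_sum]
  simp only [measDist, sub_self, ne_eq, OfNat.ofNat_ne_zero, not_false_eq_true, zero_pow, zero_add]
  refine Finset.sum_le_sum fun s _ => ?_
  set r := ‖projOnto xs s.val φ‖
  have hr : √(r ^ 2) = r := Real.sqrt_sq (norm_nonneg _)
  by_cases hG : G s.val = G' s.val
  · simp [hG]
  · rw [if_pos hG]
    calc _ ≤ ∑ h, ((if h = G s.val then r ^ 2 else 0) + if h = G' s.val then r ^ 2 else 0) := by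
          refine Finset.sum_le_sum fun h _ => ?_
          by_cases h1 : h = G s.val
          · have h2 : h ≠ G' s.val := fun h2 => hG (h1 ▸ h2)
            simp [h1, hG, hr]
          · by_cases h2 : h = G' s.val
            · simp [h2, Ne.symm hG, hr]
            · simp [h1, h2]
      _ = 2 * r ^ 2 := by
          rw [Finset.sum_add_distrib]
          simp
          ring

/-- The query `a` is answered in round `i + 1`. -/
def Valid (S : OracleSet lam) (i : ℕ) (a : BreakInput) : Prop :=
  a.v.length = i ∧ (i = 0 ∨ S.check (encPoint a.n a.v i) a.σ = true) ∧ postState S.O a.v ≠ 0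

theorem breakFamily_of_none {S : OracleSet lam} {ix : QueryIdx ℓ q}
    (h : parseBreakInput ix.2.val = none) :
    breakFamily ℓ q S ix = Pi.single none 1 := by
  funext o
  rcases o with _ | ⟨s, o⟩ <;> simp [breakFamily, breakDist, h]

theorem breakFamily_of_not_valid {S : OracleSet lam} {ix : QueryIdx ℓ q} {a : BreakInput}
    (h : parseBreakInput ix.2.val = some a) (hv : ¬ Valid S ix.1 a) :
    breakFamily ℓ q S ix = Pi.single none 1 := by
  funext o
  unfold Valid at hv
  rcases o with _ | ⟨s, o⟩ <;> simp only [breakFamily, breakDist, h, if_neg hv] <;> simp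

theorem breakFamily_of_valid {S : OracleSet lam} {ix : QueryIdx ℓ q} {a : BreakInput}
    (h : parseBreakInput ix.2.val = some a) (hv : Valid S ix.1 a) :
    breakFamily ℓ q S ix =
      measDist q (fun s => S.H (encPoint a.n (a.v ++ [(a.C, s)]) (ix.1 + 1))) a.C.out
        (runGates S.O a.C.gates (postState S.O a.v)) := by
  funext o
  unfold Valid at hv
  rcases o with _ | ⟨s, o⟩ <;> simp only [breakFamily, breakDist, h, if_pos hv] <;> rfl

theorem isDist_breakFamily (S : OracleSet lam) (ix : QueryIdx ℓ q) :
    IsDist (breakFamily ℓ q S ix) := by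
  rcases h : parseBreakInput ix.2.val with _ | a
  · rw [breakFamily_of_none h]
    exact isDist_single _
  · by_cases hv : Valid S ix.1 a
    · rw [breakFamily_of_valid h hv]
      refine isDist_measDist _ (length_out_le ?_) ?_
      · rw [parseBreakInput_eq_some.1 h]; exact ix.2.2
      · rw [norm_runGates, norm_postState _ _ hv.2.2]
    · rw [breakFamily_of_not_valid h hv]
      exact isDist_single _

/-! Revealing circuits -/

/-- The weight of the queries in `T` of the `k`-th gate of the circuit. -/
noncomputable def hitWeight (T : Set BitStr) (O : Oracle) (a : BreakInput) (k : ℕ) : ℝ :=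
  match a.C.gates[k]? with
  | some g => gateHit T (runGates O (a.C.gates.take k) (postState O a.v)) g
  | none => 0

/-- Consequently a revealing circuit with a positive threshold has a defined initial state for `O`,
and this need not be required separately. -/
theorem hitWeight_of_postState_eq_zero (T : Set BitStr) {O : Oracle} {a : BreakInput}
    (h : postState O a.v = 0) (k : ℕ) : hitWeight T O a k = 0 := by
  unfold hitWeight
  split
  · next g _ =>
    rw [h, runGates_zero]
    cases g <;> simp [gateHit]
  · rfl

/-- The string of a record. -/
def recordStr (o : CellOut q lam) : BStr q :=
  match o with
  | none => ⟨[], by simp⟩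
  | some (s, _) => s

open Classical in
/-- The modified query measures the query weight. -/
theorem hitWeight_le_sum (T : Set BitStr) {S : OracleSet lam} {ix : QueryIdx ℓ q}
    {a : BreakInput} (h : parseBreakInput ix.2.val = some a) (hv : Valid S ix.1 a) (k : ℕ) :
    hitWeight T S.O a k ≤ ∑ o, if (recordStr o).val ∈ T then
      breakFamily ℓ q S (ix.1, truncStr k ix.2) o else 0 := by
  have h0 : 0 ≤ ∑ o, if (recordStr o).val ∈ T then
      breakFamily ℓ q S (ix.1, truncStr k ix.2) o else 0 :=
    Finset.sum_nonneg fun o _ => by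
      have := (isDist_breakFamily S (ix.1, truncStr k ix.2)).1 o
      split_ifs <;> simp [this]
  rcases hg : a.C.gates[k]? with _ | g
  · rw [hitWeight]
    simpa only [hg] using h0
  · cases g with
    | query xs ys hd =>
      have ht := BreakInput.trunc_of_query hg
      have h1 : parseBreakInput (truncStr k ix.2).val = some (a.trunc k) :=
        parseBreakInput_eq_some.2 (truncStr_val h).symm
      have hlen : (a.trunc k).encode.length ≤ q := by
        rw [← truncStr_val h]; exact (truncStr k ix.2).2
      rw [ht] at h1 hlen
      have hlen' := length_out_le hlen
      -- Validity concerns only `v` and `σ`, which truncation does not change: the shortened circuit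
      -- is accepted with the same check value.
      have hv' : Valid S ix.1 ⟨a.n, a.v, a.σ, ⟨a.C.gates.take k, xs⟩⟩ := hv
      rw [breakFamily_of_valid (ix := (ix.1, truncStr k ix.2)) h1 hv', sum_cellOut]
      rw [hitWeight]
      simp only [hg, gateHit]
      rw [← sum_norm_projOnto_sq_mem hlen']
      have e : ∀ s : BStr q, (if s.val ∈ T then ‖projOnto xs s.val (runGates S.O
          (a.C.gates.take k) (postState S.O a.v))‖ ^ 2 else 0) =
          ∑ x : Option (Fin lam → Bool), if (recordStr (some (s, x))).val ∈ T then
            measDist q (fun s => S.H (encPoint a.n (a.v ++ [(⟨a.C.gates.take k, xs⟩, s)])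
              (ix.1 + 1))) xs (runGates S.O (a.C.gates.take k) (postState S.O a.v))
              (some (s, x)) else 0 := fun s => by
        by_cases hs : s.val ∈ T
        · simp [recordStr, hs, measDist]
        · simp [recordStr, hs]
      simp only [e]
      simp [measDist]
    | _ =>
      rw [hitWeight]
      simpa only [hg, gateHit] using h0

/-- Some query of the circuit has weight at least `δ` on `T`. -/
def Revealing (q : ℕ) (δ : ℝ) (T : Set BitStr) (O : Oracle) (a : BreakInput) : Prop :=
  ∃ k < q, δ ≤ hitWeight T O a k

/-- A circuit encoded in at most `q` bits has at most `q` gates, so the range `k < q` in `Revealing`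
covers every gate. -/
theorem norm_runGates_sub_le_of_not_revealing {δ : ℝ} {O O' : Oracle}
    {a : BreakInput} (hlen : a.encode.length ≤ q)
    (h : ¬ Revealing q δ {x | O x ≠ O' x} O a) :
    ‖runGates O a.C.gates (postState O a.v) - runGates O' a.C.gates (postState O' a.v)‖ ≤
      ‖postState O a.v - postState O' a.v‖ + q * (2 * √δ) := by
  have hg := length_gates_le hlen
  refine (norm_runGates_sub_le O O' a.C.gates (√δ) _ _ fun k g hk => ?_).trans ?_
  · refine Real.sqrt_le_sqrt ?_
    by_contra hc
    obtain ⟨hk', -⟩ := List.getElem?_eq_some_iff.1 hk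
    refine h ⟨k, by omega, ?_⟩
    rw [hitWeight]
    simp only [hk]
    exact (not_le.1 hc).le
  · gcongr

/-! Punctured random oracles -/

/-- The transcript points at which the post-measurement states for `O` and `O'` are far apart. -/
def Far (η : ℕ → ℝ) (O O' : Oracle) (y : BitStr) : Prop :=
  ∃ (n : ℕ) (v : Transcript n), y = encPoint n v v.length ∧
    η v.length < ‖postState O v - postState O' v‖

theorem far_encPoint {η : ℕ → ℝ} {O O' : Oracle} {n : ℕ} {v : Transcript n} {i : ℕ}
    (hi : v.length = i) :
    Far η O O' (encPoint n v i) ↔ η i < ‖postState O v - postState O' v‖ := by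
  subst hi
  constructor
  · rintro ⟨n', v', e, h⟩
    obtain ⟨rfl, h1, -⟩ := encPoint_injective e
    rw [heq_iff_eq] at h1
    rwa [h1]
  · exact fun h => ⟨n, v, rfl, h⟩

/-- The worlds for `O` and for `O'` are therefore punctured at the same points. -/
theorem far_comm {η : ℕ → ℝ} {O O' : Oracle} : Far η O O' = Far η O' O := by
  funext y
  simp only [Far, norm_sub_rev (postState O _)]

open Classical in
/-- The function `H`, with the value `⊥` on `B`. -/
noncomputable def puncture (B : BitStr → Prop) (H : BitStr → (Fin lam → Bool)) (y : BitStr) :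
    Option (Fin lam → Bool) :=
  if B y then none else some (H y)

theorem not_of_checkOf_puncture {B : BitStr → Prop} {H : BitStr → (Fin lam → Bool)}
    {y σ : BitStr} (h : checkOf (puncture B H) y σ = true) : ¬ B y := by
  intro hB
  simp [checkOf, puncture, hB] at h

theorem checkOf_puncture {B : BitStr → Prop} (H : BitStr → (Fin lam → Bool))
    {y : BitStr} (h : ¬ B y) (σ : BitStr) :
    checkOf (puncture B H) y σ = checkOf (fun x => some (H x)) y σ := by
  simp [checkOf, puncture, h]

open Classical in
/-- Puncturing the random oracle at far points is noticed only by those who know the value of the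
oracle at such a point. -/
theorem hell_puncture_le {η : ℕ → ℝ} (hη0 : 0 ≤ η 0) {Q Q' : Oracle}
    (H : BitStr → (Fin lam → Bool)) {ix : QueryIdx ℓ q} {a : BreakInput}
    (h : parseBreakInput ix.2.val = some a) (hη : 0 < η (ix.1 + 1)) {c : ℝ}
    (hc : a.v.length = ix.1 → ‖postState Q a.v - postState Q' a.v‖ ≤ η ix.1 →
      ‖runGates Q a.C.gates (postState Q a.v) - runGates Q' a.C.gates (postState Q' a.v)‖ ≤ c) :
    hell (breakFamily ℓ q (oracleOf (fun x => some (H x)) Q) ix)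
        (breakFamily ℓ q (oracleOf (puncture (Far η Q Q') H) Q) ix) ≤
      2 * (4 * c ^ 2 / η (ix.1 + 1) ^ 2) +
        if Far η Q Q' (encPoint a.n a.v ix.1) ∧
          checkOf (fun x => some (H x)) (encPoint a.n a.v ix.1) a.σ = true then 2 else 0 := by
  have h0 : 0 ≤ 2 * (4 * c ^ 2 / η (ix.1 + 1) ^ 2) := by positivity
  have h2 : (0 : ℝ) ≤ if Far η Q Q' (encPoint a.n a.v ix.1) ∧
      checkOf (fun x => some (H x)) (encPoint a.n a.v ix.1) a.σ = true then 2 else 0 := by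
    positivity
  by_cases hlen : a.v.length = ix.1
  swap
  · rw [breakFamily_of_not_valid h (fun hv => hlen hv.1),
      breakFamily_of_not_valid h (fun hv => hlen hv.1), hell_self]
    linarith
  by_cases hB : Far η Q Q' (encPoint a.n a.v ix.1)
  -- The empty transcript is never far, as both runs start in the same state. So a far transcript
  -- has to pass the check, which the first round does not have.
  · have hi : (ix.1 : ℕ) ≠ 0 := fun hi => by
      rw [far_encPoint hlen, hi] at hB
      have hv : a.v = [] := List.length_eq_zero_iff.1 (hlen.trans hi)
      rw [hv, postState_nil, postState_nil, sub_self, norm_zero] at hB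
      linarith
    have h1 : ¬ Valid (oracleOf (puncture (Far η Q Q') H) Q) ix.1 a := fun hv =>
      not_of_checkOf_puncture (hv.2.1.resolve_left hi) hB
    by_cases hch : checkOf (fun x => some (H x)) (encPoint a.n a.v ix.1) a.σ = true
    · rw [if_pos ⟨hB, hch⟩]
      have := hell_le_two (isDist_breakFamily (oracleOf (fun x => some (H x)) Q) ix)
        (isDist_breakFamily (oracleOf (puncture (Far η Q Q') H) Q) ix)
      linarith
    · have h3 : ¬ Valid (oracleOf (fun x => some (H x)) Q) ix.1 a := fun hv =>
        hch (hv.2.1.resolve_left hi)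
      rw [breakFamily_of_not_valid h h1, breakFamily_of_not_valid h h3, hell_self]
      linarith
  · have hiff : Valid (oracleOf (puncture (Far η Q Q') H) Q) ix.1 a ↔
        Valid (oracleOf (fun x => some (H x)) Q) ix.1 a := by
      unfold Valid
      simp only [oracleOf, checkOf_puncture H hB]
    by_cases hv : Valid (oracleOf (fun x => some (H x)) Q) ix.1 a
    · rw [breakFamily_of_valid h hv, breakFamily_of_valid h (hiff.2 hv)]
      have hle := hc hlen (by rwa [far_encPoint hlen, not_lt] at hB)
      have hxs : a.C.out.length ≤ q :=
        length_out_le (by rw [parseBreakInput_eq_some.1 h]; exact ix.2.2)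
      refine (hell_measDist_puncture_le _ _ _ _).trans ?_
      have := sum_norm_projOnto_sq_far_le hxs (runGates Q a.C.gates (postState Q a.v))
        (runGates Q' a.C.gates (postState Q' a.v)) hη
      have hcc : 4 * ‖runGates Q a.C.gates (postState Q a.v) -
          runGates Q' a.C.gates (postState Q' a.v)‖ ^ 2 / η (ix.1 + 1) ^ 2 ≤
          4 * c ^ 2 / η (ix.1 + 1) ^ 2 := by gcongr
      -- The postselected state of the extended transcript is the normalized projection for outcome
      -- `s`. The answer is thus punctured exactly when the post-measurement states are far apart.
      have hsum : ∑ s : BStr q, (if (oracleOf (fun x => some (H x)) Q).H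
          (encPoint a.n (a.v ++ [(a.C, s.val)]) (ix.1 + 1)) ≠
          (oracleOf (puncture (Far η Q Q') H) Q).H
          (encPoint a.n (a.v ++ [(a.C, s.val)]) (ix.1 + 1)) then
          ‖projOnto a.C.out s.val (runGates Q a.C.gates (postState Q a.v))‖ ^ 2 else 0) =
          ∑ s : BStr q, (if η (ix.1 + 1) <
            ‖normalized (projOnto a.C.out s.val (runGates Q a.C.gates (postState Q a.v))) -
            normalized (projOnto a.C.out s.val (runGates Q' a.C.gates (postState Q' a.v)))‖
            then ‖projOnto a.C.out s.val (runGates Q a.C.gates (postState Q a.v))‖ ^ 2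
            else 0) := by
        refine Finset.sum_congr rfl fun s _ => ?_
        have hF : (oracleOf (fun x => some (H x)) Q).H
            (encPoint a.n (a.v ++ [(a.C, s.val)]) (ix.1 + 1)) ≠
            (oracleOf (puncture (Far η Q Q') H) Q).H
            (encPoint a.n (a.v ++ [(a.C, s.val)]) (ix.1 + 1)) ↔ η (ix.1 + 1) <
            ‖normalized (projOnto a.C.out s.val (runGates Q a.C.gates (postState Q a.v))) -
            normalized (projOnto a.C.out s.val (runGates Q' a.C.gates (postState Q' a.v)))‖ := by
          rw [← postState_concat, ← postState_concat, ← far_encPoint (by simp [hlen])]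
          simp [oracleOf, puncture]
        by_cases hF' : η (ix.1 + 1) <
            ‖normalized (projOnto a.C.out s.val (runGates Q a.C.gates (postState Q a.v))) -
            normalized (projOnto a.C.out s.val (runGates Q' a.C.gates (postState Q' a.v)))‖
        · rw [if_pos hF', if_pos (hF.2 hF')]
        · rw [if_neg hF', if_neg (fun h' => hF' (hF.1 h'))]
      have hO : (oracleOf (fun x => some (H x)) Q).O = Q := rfl
      rw [hO, hsum]
      linarith
    · rw [breakFamily_of_not_valid h hv, breakFamily_of_not_valid h (fun h' => hv (hiff.1 h')),
        hell_self]
      linarith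

/-- With a punctured random oracle, exchanging `O` and `O'` is not noticed. -/
theorem hell_swap_le {η : ℕ → ℝ} {Q Q' : Oracle} (H : BitStr → (Fin lam → Bool))
    (hη0 : 0 ≤ η 0) {ix : QueryIdx ℓ q} {a : BreakInput}
    (h : parseBreakInput ix.2.val = some a) {c : ℝ}
    (hc : a.v.length = ix.1 → ‖postState Q a.v - postState Q' a.v‖ ≤ η ix.1 →
      ‖runGates Q a.C.gates (postState Q a.v) - runGates Q' a.C.gates (postState Q' a.v)‖ ≤ c) :
    hell (breakFamily ℓ q (oracleOf (puncture (Far η Q Q') H) Q) ix)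
        (breakFamily ℓ q (oracleOf (puncture (Far η Q Q') H) Q') ix) ≤ 2 * c ^ 2 := by
  by_cases hK : a.v.length = ix.1 ∧ ((ix.1 : ℕ) = 0 ∨
      checkOf (puncture (Far η Q Q') H) (encPoint a.n a.v ix.1) a.σ = true)
  swap
  · have h3 : ¬ Valid (oracleOf (puncture (Far η Q Q') H) Q) ix.1 a :=
      fun hv => hK ⟨hv.1, hv.2.1⟩
    have h4 : ¬ Valid (oracleOf (puncture (Far η Q Q') H) Q') ix.1 a :=
      fun hv => hK ⟨hv.1, hv.2.1⟩
    rw [breakFamily_of_not_valid h h3, breakFamily_of_not_valid h h4, hell_self]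
    positivity
  obtain ⟨hlen, hch⟩ := hK
  have hclose : ‖postState Q a.v - postState Q' a.v‖ ≤ η ix.1 := by
    rcases hch with hi | hch
    · have hv : a.v = [] := List.length_eq_zero_iff.1 (hlen.trans hi)
      rw [hv, postState_nil, postState_nil, sub_self, norm_zero, hi]
      exact hη0
    · rw [← not_lt, ← far_encPoint hlen]
      exact not_of_checkOf_puncture hch
  have hle := hc hlen hclose
  have hsq : ‖runGates Q a.C.gates (postState Q a.v) -
      runGates Q' a.C.gates (postState Q' a.v)‖ ^ 2 ≤ c ^ 2 := by gcongr
  have h2 := hell_le_two (isDist_breakFamily (oracleOf (puncture (Far η Q Q') H) Q) ix)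
    (isDist_breakFamily (oracleOf (puncture (Far η Q Q') H) Q') ix)
  -- If exactly one state is undefined, it is represented by zero and the other is a unit vector.
  -- Then `1 ≤ c ^ 2`, and the trivial bound `2` on the distance suffices.
  by_cases hQ : postState Q a.v = 0 <;> by_cases hQ' : postState Q' a.v = 0
  · have h3 : ¬ Valid (oracleOf (puncture (Far η Q Q') H) Q) ix.1 a := fun hv => hv.2.2 hQ
    have h4 : ¬ Valid (oracleOf (puncture (Far η Q Q') H) Q') ix.1 a := fun hv => hv.2.2 hQ'
    rw [breakFamily_of_not_valid h h3, breakFamily_of_not_valid h h4, hell_self]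
    positivity
  · rw [hQ, runGates_zero, zero_sub, norm_neg, norm_runGates, norm_postState _ _ hQ'] at hsq
    linarith
  · rw [hQ', runGates_zero, sub_zero, norm_runGates, norm_postState _ _ hQ] at hsq
    linarith
  · have hxs : a.C.out.length ≤ q :=
      length_out_le (by rw [parseBreakInput_eq_some.1 h]; exact ix.2.2)
    rw [breakFamily_of_valid (S := oracleOf (puncture (Far η Q Q') H) Q) h ⟨hlen, hch, hQ⟩,
      breakFamily_of_valid (S := oracleOf (puncture (Far η Q Q') H) Q') h ⟨hlen, hch, hQ'⟩]
    have := hell_measDist_le (q := q) (fun s => (oracleOf (puncture (Far η Q Q') H) Q).H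
      (encPoint a.n (a.v ++ [(a.C, s)]) (ix.1 + 1))) hxs
      (runGates Q a.C.gates (postState Q a.v)) (runGates Q' a.C.gates (postState Q' a.v))
    refine this.trans ?_
    nlinarith [sq_nonneg c]

open Classical in
/-- Answer the queries that satisfy `R` with `⊥`. -/
noncomputable def maskFamily (R : BreakInput → Prop) (p : QueryIdx ℓ q → CellOut q lam → ℝ)
    (ix : QueryIdx ℓ q) : CellOut q lam → ℝ :=
  if ∃ a, parseBreakInput ix.2.val = some a ∧ R a then Pi.single none 1 else p ix

theorem isDist_maskFamily (R : BreakInput → Prop) {p : QueryIdx ℓ q → CellOut q lam → ℝ}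
    (hp : ∀ ix, IsDist (p ix)) (ix : QueryIdx ℓ q) : IsDist (maskFamily R p ix) := by
  unfold maskFamily
  split_ifs
  · exact isDist_single _
  · exact hp ix

end Family

/-! Measurability -/

section Measurability

variable {Ω : Type*} [MeasurableSpace Ω]

/-- Vectors that depend measurably on the sample. -/
def MeasVec {β : Type} (φ : Ω → EuclideanSpace ℂ β) : Prop := ∀ b, Measurable fun ω => φ ω b

section Vec

variable {β : Type} [Fintype β] {φ ψ : Ω → EuclideanSpace ℂ β}

theorem MeasVec.act {M : Ω → Matrix β β ℂ} (hM : ∀ a b, Measurable fun ω => M ω a b)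
    (hφ : MeasVec φ) : MeasVec fun ω => act (M ω) (φ ω) := fun a => by
  simp only [act_apply]
  exact Finset.measurable_sum _ fun b _ => (hM a b).mul (hφ b)

theorem MeasVec.sub (hφ : MeasVec φ) (hψ : MeasVec ψ) : MeasVec fun ω => φ ω - ψ ω :=
  fun b => (hφ b).sub (hψ b)

theorem MeasVec.norm (hφ : MeasVec φ) : Measurable fun ω => ‖φ ω‖ := by
  simp only [EuclideanSpace.norm_eq]
  exact (Finset.measurable_sum _ fun b _ => (hφ b).norm.pow_const 2).sqrt

theorem MeasVec.const (v : EuclideanSpace ℂ β) : MeasVec fun _ : Ω => v :=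
  fun _ => measurable_const

end Vec

section Circuits

variable {n : ℕ} {Q : Ω → Oracle}

theorem measurable_gate_mat (hQ : ∀ x, Measurable fun ω => Q ω x) (g : Gate n) (a b) :
    Measurable fun ω => g.mat (Q ω) a b := by
  cases g with
  | query xs ys h =>
    exact (measurable_from_top (f := fun w : BitStr =>
      if a = xorWires ys w b then (1 : ℂ) else 0)).comp (hQ (readWires xs b))
  | _ => exact measurable_const

theorem MeasVec.runGates (hQ : ∀ x, Measurable fun ω => Q ω x) (gs : List (Gate n))
    {φ : Ω → EuclideanSpace ℂ (Fin n → Bool)} (hφ : MeasVec φ) :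
    MeasVec fun ω => runGates (Q ω) gs (φ ω) := by
  induction gs using List.reverseRecOn with
  | nil => exact hφ
  | append_singleton gs g ih =>
    simp only [runGates_concat]
    exact ih.act fun a b => measurable_gate_mat hQ g a b

theorem MeasVec.projOnto (xs : List (Fin n)) (s : BitStr)
    {φ : Ω → EuclideanSpace ℂ (Fin n → Bool)} (hφ : MeasVec φ) :
    MeasVec fun ω => projOnto xs s (φ ω) := fun b => by
  by_cases h : readWires xs b = s
  · simpa [_root_.projOnto, h] using hφ b
  · simp [_root_.projOnto, h]

theorem MeasVec.normalized {φ : Ω → EuclideanSpace ℂ (Fin n → Bool)} (hφ : MeasVec φ) :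
    MeasVec fun ω => normalized (φ ω) := fun b => by
  simp only [_root_.normalized, PiLp.smul_apply, smul_eq_mul]
  exact (Complex.measurable_ofReal.comp hφ.norm.inv).mul (hφ b)

theorem measVec_postState (hQ : ∀ x, Measurable fun ω => Q ω x) (v : Transcript n) :
    MeasVec fun ω => postState (Q ω) v := by
  induction v using List.reverseRecOn with
  | nil => exact MeasVec.const _
  | append_singleton v p ih =>
    obtain ⟨C, s⟩ := p
    simp only [postState_concat]
    exact ((ih.runGates hQ C.gates).projOnto C.out s).normalized

theorem measurable_hitWeight (hQ : ∀ x, Measurable fun ω => Q ω x) {T : Ω → Set BitStr}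
    (hT : ∀ x, MeasurableSet {ω | x ∈ T ω}) (a : BreakInput) (k : ℕ) :
    Measurable fun ω => hitWeight (T ω) (Q ω) a k := by
  unfold hitWeight
  rcases a.C.gates[k]? with _ | g
  · exact measurable_const
  · have h := (measVec_postState hQ a.v).runGates hQ (a.C.gates.take k)
    cases g with
    | query xs ys hd =>
      simp only [gateHit]
      exact Finset.measurable_sum _ fun b _ =>
        Measurable.ite (hT _) ((h b).norm.pow_const 2) measurable_const
    | _ => exact measurable_const

theorem measurableSet_revealing (hQ : ∀ x, Measurable fun ω => Q ω x) {T : Ω → Set BitStr}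
    (hT : ∀ x, MeasurableSet {ω | x ∈ T ω}) (q : ℕ) (δ : ℝ) (a : BreakInput) :
    MeasurableSet {ω | Revealing q δ (T ω) (Q ω) a} := by
  have : {ω | Revealing q δ (T ω) (Q ω) a} =
      ⋃ k ∈ Set.Iio q, {ω | δ ≤ hitWeight (T ω) (Q ω) a k} := by
    ext ω; simp [Revealing]
  rw [this]
  exact MeasurableSet.biUnion (Set.to_countable _) fun k _ =>
    measurableSet_le measurable_const (measurable_hitWeight hQ hT a k)

theorem measurableSet_far {Q' : Ω → Oracle} (hQ : ∀ x, Measurable fun ω => Q ω x)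
    (hQ' : ∀ x, Measurable fun ω => Q' ω x) (η : ℕ → ℝ) (y : BitStr) :
    MeasurableSet {ω | Far η (Q ω) (Q' ω) y} := by
  by_cases h : ∃ (n : ℕ) (v : Transcript n), y = encPoint n v v.length
  · obtain ⟨n, v, rfl⟩ := h
    simp only [far_encPoint (rfl : v.length = v.length)]
    exact measurableSet_lt measurable_const
      ((measVec_postState hQ v).sub (measVec_postState hQ' v)).norm
  · convert MeasurableSet.empty
    rw [Set.eq_empty_iff_forall_notMem]
    rintro ω ⟨n, v, e, -⟩
    exact h ⟨n, v, e⟩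

end Circuits

section Families

variable {ℓ q lam : ℕ} {h : Ω → BitStr → Option (Fin lam → Bool)}

theorem measurableSet_puncture {B : Ω → BitStr → Prop} {H : Ω → BitStr → (Fin lam → Bool)}
    (hB : ∀ y, MeasurableSet {ω | B ω y}) (hH : ∀ y, Measurable fun ω => H ω y) (y : BitStr)
    (c : Option (Fin lam → Bool)) : MeasurableSet {ω | puncture (B ω) (H ω) y = c} := by
  have h1 : ∀ c, MeasurableSet {ω | H ω y = c} := fun c => hH y (measurableSet_singleton c)
  cases c with
  | none =>
    convert hB y using 3 with ω
    simp [puncture]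
  | some c =>
    convert (hB y).compl.inter (h1 c) using 1
    ext ω
    by_cases hω : B ω y <;> simp [puncture, hω]

theorem measurableSet_checkOf (hh : ∀ y c, MeasurableSet {ω | h ω y = c}) (y σ : BitStr) :
    MeasurableSet {ω | checkOf (h ω) y σ = true} := by
  have : {ω | checkOf (h ω) y σ = true} =
      ⋃ c ∈ {c : Fin lam → Bool | List.ofFn c = σ}, {ω | h ω y = some c} := by
    ext ω
    rcases hω : h ω y with _ | c <;> simp [checkOf, hω]
  rw [this]
  exact MeasurableSet.biUnion (Set.to_countable _) fun c _ => hh y _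

theorem measurable_breakFamily {Q : Ω → Oracle} (hQ : ∀ x, Measurable fun ω => Q ω x)
    (hh : ∀ y c, MeasurableSet {ω | h ω y = c}) (ix : QueryIdx ℓ q) (o : CellOut q lam) :
    Measurable fun ω => breakFamily ℓ q (oracleOf (h ω) (Q ω)) ix o := by
  classical
  rcases hp : parseBreakInput ix.2.val with _ | a
  · simp only [breakFamily_of_none hp]
    exact measurable_const
  · have hψ := measVec_postState hQ a.v
    have hV : MeasurableSet {ω | Valid (oracleOf (h ω) (Q ω)) ix.1 a} := by
      have h0 : MeasurableSet {ω | postState (Q ω) a.v ≠ 0} := by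
        have : {ω | postState (Q ω) a.v ≠ 0} = {ω | ‖postState (Q ω) a.v‖ = 0}ᶜ := by
          ext ω; simp
        rw [this]
        exact (hψ.norm (measurableSet_singleton 0)).compl
      have h1 : MeasurableSet {ω | (ix.1 : ℕ) = 0 ∨
          checkOf (h ω) (encPoint a.n a.v ix.1) a.σ = true} :=
        (MeasurableSet.const _).union (measurableSet_checkOf hh _ _)
      exact (MeasurableSet.const _).inter (h1.inter h0)
    have e : (fun ω => breakFamily ℓ q (oracleOf (h ω) (Q ω)) ix o) = fun ω =>
        if Valid (oracleOf (h ω) (Q ω)) ix.1 a then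
          measDist q (fun s => h ω (encPoint a.n (a.v ++ [(a.C, s)]) (ix.1 + 1))) a.C.out
            (runGates (Q ω) a.C.gates (postState (Q ω) a.v)) o
        else (Pi.single none 1 : CellOut q lam → ℝ) o := by
      funext ω
      split_ifs with hv
      · rw [breakFamily_of_valid hp hv]
        rfl
      · rw [breakFamily_of_not_valid hp hv]
    rw [e]
    refine Measurable.ite hV ?_ measurable_const
    rcases o with _ | ⟨s, c⟩
    · exact measurable_const
    · simp only [measDist]
      refine Measurable.ite ?_ (((hψ.runGates hQ _).projOnto _ _).norm.pow_const 2)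
        measurable_const
      simp only [eq_comm (a := c)]
      exact hh _ _

theorem measurable_maskFamily {R : Ω → BreakInput → Prop}
    (hR : ∀ a, MeasurableSet {ω | R ω a}) {p : Ω → QueryIdx ℓ q → CellOut q lam → ℝ}
    (hp : ∀ ix o, Measurable fun ω => p ω ix o) (ix : QueryIdx ℓ q) (o : CellOut q lam) :
    Measurable fun ω => maskFamily (R ω) (p ω) ix o := by
  classical
  unfold maskFamily
  rcases h : parseBreakInput ix.2.val with _ | a
  · simpa using hp ix o
  · simp only [Option.some.injEq, exists_eq_left', apply_ite (fun f : CellOut q lam → ℝ => f o)]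
    convert Measurable.ite (hR a) (measurable_const (a := (Pi.single none 1 :
      CellOut q lam → ℝ) o)) (hp ix o) using 2

theorem measurable_queryOp {ι Out : Type} [Fintype ι] [DecidableEq ι] [Fintype Out]
    [DecidableEq Out] {p : Ω → ι → Out → ℝ} (hp : ∀ x o, Measurable fun ω => p ω x o) (w : ℕ)
    (a b) : Measurable fun ω => queryOp (compressionUnitary (p ω)) w a b := by
  have hd : ∀ x c, Measurable fun ω => distKet (p ω x) c := fun x c => by
    cases c with
    | none => exact measurable_const
    | some o => exact Complex.measurable_ofReal.comp (hp x o).sqrt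
  have hds : ∀ x c, Measurable fun ω => star (distKet (p ω x) c) := fun x c =>
    Complex.continuous_conj.measurable.comp (hd x c)
  have hc : ∀ x c c', Measurable fun ω => cellUnitary (p ω x) c c' := fun x c c' => by
    simp only [cellUnitary, Matrix.add_apply, Matrix.sub_apply, Matrix.vecMulVec_apply,
      Pi.star_apply]
    exact (((hd x c).mul_const _).add ((hds x c').const_mul _)).add
      (measurable_const.sub ((hd x c).mul (hds x c')))
  obtain ⟨x, db, j⟩ := a
  obtain ⟨y, db', j'⟩ := b
  simp only [queryOp, compressionUnitary, Matrix.of_apply]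
  by_cases hj : j = j'
  · simp only [hj, if_true]
    cases x <;> cases y
    · exact measurable_const
    · exact measurable_const
    · exact measurable_const
    · dsimp only
      split_ifs
      · exact hc _ _ _
      · exact measurable_const
  · simp only [hj, if_false]
    exact measurable_const

variable {Z : Type u} [MeasurableSpace Z]

theorem QueryAlg.measVec_evolve (A : QueryAlg Z ℓ q lam)
    {p : Ω → QueryIdx ℓ q → CellOut q lam → ℝ} (hp : ∀ ix o, Measurable fun ω => p ω ix o)
    {z : Ω → Z} (hz : Measurable z) (k : ℕ) : MeasVec fun ω => A.evolve (p ω) (z ω) k := by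
  induction k with
  | zero => exact fun a => (A.measurable_init a).comp hz
  | succ k ih =>
    simp only [QueryAlg.evolve_succ]
    exact (ih.act fun a b => measurable_queryOp hp A.w a b).act
      fun a b => (A.measurable_step k a b).comp hz

theorem measurable_qmass {w : ℕ} {ψ : Ω → EuclideanSpace ℂ (AlgBasis ℓ q lam w)}
    (hψ : MeasVec ψ) (ix : QueryIdx ℓ q) : Measurable fun ω => qmass (ψ ω) ix :=
  Finset.measurable_sum _ fun _ _ => Finset.measurable_sum _ fun _ _ =>
    (hψ _).norm.pow_const 2

open Classical in
/-- The weight of the queries in `K`. -/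
noncomputable def massOn {w : ℕ} (K : QueryIdx ℓ q → Prop)
    (ψ : EuclideanSpace ℂ (AlgBasis ℓ q lam w)) : ℝ :=
  ∑ ix, if K ix then qmass ψ ix else 0

theorem massOn_nonneg {w : ℕ} (K : QueryIdx ℓ q → Prop)
    (ψ : EuclideanSpace ℂ (AlgBasis ℓ q lam w)) : 0 ≤ massOn K ψ :=
  Finset.sum_nonneg fun ix _ => by
    have := qmass_nonneg ψ ix
    split_ifs <;> simp [this]

theorem massOn_le {w : ℕ} (K : QueryIdx ℓ q → Prop)
    (ψ : EuclideanSpace ℂ (AlgBasis ℓ q lam w)) : massOn K ψ ≤ ‖ψ‖ ^ 2 := by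
  refine le_trans (Finset.sum_le_sum fun ix _ => ?_) (sum_qmass_le ψ)
  have := qmass_nonneg ψ ix
  split_ifs <;> simp [this]

theorem measurable_massOn {w : ℕ} {K : Ω → QueryIdx ℓ q → Prop}
    (hK : ∀ ix, MeasurableSet {ω | K ω ix}) {ψ : Ω → EuclideanSpace ℂ (AlgBasis ℓ q lam w)}
    (hψ : MeasVec ψ) : Measurable fun ω => massOn (K ω) (ψ ω) :=
  Finset.measurable_sum _ fun ix _ =>
    Measurable.ite (hK ix) (measurable_qmass hψ ix) measurable_const

end Families

end Measurability

/-! Integrals -/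

section Integrals

variable {Ω : Type*} [MeasurableSpace Ω] {ν : Measure Ω} [IsProbabilityMeasure ν]

theorem integrable_of_abs_le {f : Ω → ℝ} (hf : Measurable f) {c : ℝ} (hc : ∀ ω, |f ω| ≤ c) :
    Integrable f ν :=
  Integrable.of_bound hf.aestronglyMeasurable c (Filter.Eventually.of_forall hc)

theorem integral_le_of_le {f : Ω → ℝ} (hf : Integrable f ν) {c : ℝ} (hc : ∀ ω, f ω ≤ c) :
    ∫ ω, f ω ∂ν ≤ c := by
  have := integral_mono hf (integrable_const c) hc
  simpa using this

/-- Concavity of the square root, in the form of its tangent at `c ^ 2`: `√r ≤ r / (2 * c) + c / 2`.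
-/
theorem integral_sqrt_le {f : Ω → ℝ} (hf : Measurable f) {b : ℝ} (h0 : ∀ ω, 0 ≤ f ω)
    (hb : ∀ ω, f ω ≤ b) {c : ℝ} (hc : 0 < c) (h : ∫ ω, f ω ∂ν ≤ c ^ 2) :
    ∫ ω, √(f ω) ∂ν ≤ c := by
  have hi : Integrable f ν := integrable_of_abs_le hf fun ω => by
    rw [abs_of_nonneg (h0 ω)]; exact hb ω
  have hs : Integrable (fun ω => √(f ω)) ν := integrable_of_abs_le (c := √b) hf.sqrt fun ω => by
    rw [abs_of_nonneg (Real.sqrt_nonneg _)]; exact Real.sqrt_le_sqrt (hb ω)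
  have hle : ∀ ω, √(f ω) ≤ (1 / (2 * c)) * f ω + c / 2 := fun ω => by
    have h1 : ∀ r : ℝ, r ≤ (1 / (2 * c)) * r ^ 2 + c / 2 := fun r => by
      have e : (1 / (2 * c)) * r ^ 2 + c / 2 - r = (r - c) ^ 2 / (2 * c) := by
        field_simp; ring
      have : 0 ≤ (r - c) ^ 2 / (2 * c) := by positivity
      linarith
    have h2 := h1 (√(f ω))
    rwa [Real.sq_sqrt (h0 ω)] at h2
  have hint := integral_mono hs ((hi.const_mul _).add (integrable_const (c / 2))) hle
  simp only [Pi.add_apply] at hint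
  rw [integral_add (hi.const_mul _) (integrable_const _), integral_const_mul] at hint
  simp only [integral_const, probReal_univ, smul_eq_mul, one_mul] at hint
  have h2 : 1 / (2 * c) * ∫ ω, f ω ∂ν ≤ 1 / (2 * c) * c ^ 2 := by gcongr
  have h3 : 1 / (2 * c) * c ^ 2 = c / 2 := by field_simp
  linarith

variable {ℓ q lam : ℕ} {Z : Type u} [MeasurableSpace Z]

theorem QueryAlg.norm_evolve_sub_le_two (A : QueryAlg Z ℓ q lam)
    {p p' : QueryIdx ℓ q → CellOut q lam → ℝ}
    (hp : ∀ ix, IsDist (p ix)) (hp' : ∀ ix, IsDist (p' ix)) (z : Z) (k : ℕ) :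
    ‖A.evolve p z k - A.evolve p' z k‖ ≤ 2 := by
  have := norm_sub_le (A.evolve p z k) (A.evolve p' z k)
  have := A.norm_evolve_le hp z k
  have := A.norm_evolve_le hp' z k
  linarith

theorem QueryAlg.integrable_norm_evolve_sub (A : QueryAlg Z ℓ q lam)
    {p p' : Ω → QueryIdx ℓ q → CellOut q lam → ℝ}
    (hp : ∀ ω ix, IsDist (p ω ix)) (hp' : ∀ ω ix, IsDist (p' ω ix))
    (mp : ∀ ix o, Measurable fun ω => p ω ix o) (mp' : ∀ ix o, Measurable fun ω => p' ω ix o)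
    {z : Ω → Z} (hz : Measurable z) (k : ℕ) :
    Integrable (fun ω => ‖A.evolve (p ω) (z ω) k - A.evolve (p' ω) (z ω) k‖) ν :=
  integrable_of_abs_le ((A.measVec_evolve mp hz k).sub (A.measVec_evolve mp' hz k)).norm
    fun ω => by
      rw [abs_norm]
      exact A.norm_evolve_sub_le_two (hp ω) (hp' ω) (z ω) k

/-- Hybrid argument, averaged over the sample. -/
theorem QueryAlg.integral_norm_evolve_sub_le (A : QueryAlg Z ℓ q lam)
    {p p' : Ω → QueryIdx ℓ q → CellOut q lam → ℝ}
    (hp : ∀ ω ix, IsDist (p ω ix)) (hp' : ∀ ω ix, IsDist (p' ω ix))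
    (mp : ∀ ix o, Measurable fun ω => p ω ix o) (mp' : ∀ ix o, Measurable fun ω => p' ω ix o)
    {z : Ω → Z} (hz : Measurable z) {F : ℕ → Ω → ℝ} (hF : ∀ s < q, Integrable (F s) ν)
    (hle : ∀ s < q, ∀ ω,
      3 * √(∑ ix, hell (p ω ix) (p' ω ix) * qmass (A.evolve (p ω) (z ω) s) ix) ≤ F s ω)
    {c : ℝ} (hc0 : 0 ≤ c) (hc : ∀ s < q, ∫ ω, F s ω ∂ν ≤ c) {k : ℕ} (hk : k ≤ q) :
    ∫ ω, ‖A.evolve (p ω) (z ω) k - A.evolve (p' ω) (z ω) k‖ ∂ν ≤ q * c := by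
  have hF' : ∀ s ∈ Finset.range k, Integrable (F s) ν := fun s hs =>
    hF s ((Finset.mem_range.1 hs).trans_le hk)
  calc _ ≤ ∫ ω, ∑ s ∈ Finset.range k, F s ω ∂ν := by
        refine integral_mono (A.integrable_norm_evolve_sub hp hp' mp mp' hz k)
          (integrable_finsetSum _ hF') fun ω => ?_
        refine (A.norm_evolve_sub_le (hp ω) (hp' ω) (z ω) k).trans ?_
        exact Finset.sum_le_sum fun s hs => hle s ((Finset.mem_range.1 hs).trans_le hk) ω
    _ = ∑ s ∈ Finset.range k, ∫ ω, F s ω ∂ν := integral_finsetSum _ hF'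
    _ ≤ ∑ s ∈ Finset.range k, c :=
        Finset.sum_le_sum fun s hs => hc s ((Finset.mem_range.1 hs).trans_le hk)
    _ ≤ q * c := by
        rw [Finset.sum_const, Finset.card_range, nsmul_eq_mul]
        gcongr

end Integrals

/-! The random oracle -/

section RandomOracle

variable {lam : ℕ} {Z : Type u} [MeasurableSpace Z] (μ : Measure (Oracle × Oracle × Z))
  [IsProbabilityMeasure μ]

instance instIsProbabilityMeasureRandomOracle : IsProbabilityMeasure (randomOracle lam) := by
  unfold randomOracle
  infer_instance

/-- Permute the values of the random oracle at the point `y`. -/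
def permuteAt (y : BitStr) (τ : Equiv.Perm (Fin lam → Bool)) (H : BitStr → (Fin lam → Bool))
    (x : BitStr) : Fin lam → Bool := if x = y then τ (H x) else H x

theorem measurePreserving_permuteAt (y : BitStr) (τ : Equiv.Perm (Fin lam → Bool)) :
    MeasurePreserving (permuteAt y τ) (randomOracle lam) (randomOracle lam) := by
  have hm : Measurable (permuteAt y τ : (BitStr → (Fin lam → Bool)) → _) := by
    refine measurable_pi_lambda _ fun x => ?_
    unfold permuteAt
    split_ifs
    · exact (measurable_of_countable τ).comp (measurable_pi_apply x)
    · exact measurable_pi_apply x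
  refine ⟨hm, ?_⟩
  have key : ((PMF.uniformOfFintype (Fin lam → Bool)).toMeasure).map τ =
      (PMF.uniformOfFintype (Fin lam → Bool)).toMeasure := by
    rw [PMF.toMeasure_map _ _ (measurable_of_countable τ)]
    congr 1
    ext c
    rw [PMF.map_apply, tsum_eq_single (τ.symm c)]
    · simp
    · intro d hd
      rw [if_neg]
      intro h
      exact hd (by simp [h])
  unfold randomOracle
  have := Measure.infinitePi_map_pi (μ := fun _ : BitStr =>
    (PMF.uniformOfFintype (Fin lam → Bool)).toMeasure)
    (f := fun x => if x = y then (τ : (Fin lam → Bool) → (Fin lam → Bool)) else id)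
    (fun x => by split_ifs <;> exact measurable_of_countable _)
  have e : (permuteAt y τ : (BitStr → (Fin lam → Bool)) → _) = fun H x =>
      (if x = y then (τ : (Fin lam → Bool) → (Fin lam → Bool)) else id) (H x) := by
    funext H x
    unfold permuteAt
    split_ifs <;> rfl
  rw [e, this]
  congr 1
  funext x
  split_ifs
  · exact key
  · exact Measure.map_id

/-- The value of the random oracle at a point is independent of functions that do not depend on
this value. -/
theorem integral_ite_oracle_eq_le (y : BitStr) (c : Fin lam → Bool) {F : Sample Z lam → ℝ}
    (hF : Integrable F (μ.prod (randomOracle lam)))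
    (hinv : ∀ ω τ, F (ω.1, permuteAt y τ ω.2) = F ω) :
    ∫ ω, (if ω.2 y = c then F ω else 0) ∂(μ.prod (randomOracle lam)) =
      (2 ^ lam)⁻¹ * ∫ ω, F ω ∂(μ.prod (randomOracle lam)) := by
  set ν := μ.prod (randomOracle lam)
  have hm : Measurable fun ω : Sample Z lam => ω.2 y :=
    (measurable_pi_apply y).comp measurable_snd
  have hset : ∀ c : Fin lam → Bool, MeasurableSet {ω : Sample Z lam | ω.2 y = c} := fun c =>
    hm (measurableSet_singleton c)
  have hI : ∀ c, Integrable (fun ω : Sample Z lam => if ω.2 y = c then F ω else 0) ν := fun c => by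
    have := hF.indicator (hset c)
    refine this.congr (Filter.Eventually.of_forall fun ω => ?_)
    simp [Set.indicator]
  -- Exchanging the values `c` and `d` at `y` preserves the law and fixes `F`, so all `2 ^ lam`
  -- values of the oracle at `y` contribute equally.
  have heq : ∀ d, ∫ ω, (if ω.2 y = d then F ω else 0) ∂ν =
      ∫ ω, (if ω.2 y = c then F ω else 0) ∂ν := fun d => by
    have hmp : MeasurePreserving (Prod.map id (permuteAt y (Equiv.swap c d))) ν ν :=
      (MeasurePreserving.id μ).prod (measurePreserving_permuteAt y (Equiv.swap c d))
    rw [← hmp.map_eq, integral_map hmp.measurable.aemeasurable, hmp.map_eq]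
    · refine integral_congr_ae (Filter.Eventually.of_forall fun ω => ?_)
      have h1 : F (Prod.map id (permuteAt y (Equiv.swap c d)) ω) = F ω := hinv ω _
      have h2 : (Prod.map id (permuteAt y (Equiv.swap c d)) ω).2 y = d ↔ ω.2 y = c := by
        simp only [Prod.map_snd, permuteAt, if_true]
        rw [Equiv.swap_apply_eq_iff, Equiv.swap_apply_right]
      simp only [h1, h2]
    · rw [hmp.map_eq]
      exact (hI d).aestronglyMeasurable
  have hsum : ∫ ω, F ω ∂ν = ∑ d, ∫ ω, (if ω.2 y = d then F ω else 0) ∂ν := by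
    rw [← integral_finsetSum _ fun d _ => hI d]
    simp
  rw [hsum]
  simp only [heq]
  simp

/-! Acceptance probabilities -/

section Accept

variable {β : Type} [Fintype β] [DecidableEq β]

theorem inner_act_conjTranspose_mul_self (B : Matrix β β ℂ) (v : EuclideanSpace ℂ β) :
    (inner ℂ v (act (B.conjTranspose * B) v)).re = ‖act B v‖ ^ 2 := by
  have : inner ℂ v (act (B.conjTranspose * B) v) = inner ℂ (act B v) (act B v) := by
    simp only [EuclideanSpace.inner_eq_star_dotProduct, act, Matrix.star_mulVec]
    rw [← Matrix.mulVec_mulVec, dotProduct_comm, Matrix.dotProduct_mulVec, dotProduct_comm]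
  rw [this, inner_self_eq_norm_sq_to_K]
  norm_cast

open scoped MatrixOrder in
-- Writing `M = B⋆ B` turns acceptance probabilities into squared norms of `B v`, and `M ≤ 1` makes
-- `B` a contraction.
theorem IsEffect.exists_factor {M : Matrix β β ℂ} (hM : IsEffect M) :
    ∃ B : Matrix β β ℂ, (∀ v, (inner ℂ v (act M v)).re = ‖act B v‖ ^ 2) ∧
      ∀ v, ‖act B v‖ ≤ ‖v‖ := by
  obtain ⟨B, hB⟩ := CStarAlgebra.nonneg_iff_eq_star_mul_self.mp hM.1.nonneg
  rw [Matrix.star_eq_conjTranspose] at hB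
  have h1 : ∀ v, (inner ℂ v (act M v)).re = ‖act B v‖ ^ 2 := fun v => by
    rw [hB, inner_act_conjTranspose_mul_self]
  refine ⟨B, h1, fun v => ?_⟩
  have h2 := hM.2.re_dotProduct_nonneg v.ofLp
  have h3 : RCLike.re (star v.ofLp ⬝ᵥ (1 - M).mulVec v.ofLp) =
      (inner ℂ v (act (1 - M) v)).re := by
    rw [EuclideanSpace.inner_eq_star_dotProduct, dotProduct_comm]
    rfl
  rw [h3, sub_act, act_one, inner_sub_right, Complex.sub_re, h1, inner_self_eq_norm_sq_to_K] at h2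
  refine le_of_sq_le_sq ?_ (norm_nonneg v)
  have h4 : (((‖v‖ : ℝ) : ℂ) ^ 2).re = ‖v‖ ^ 2 := by norm_cast
  have h5 : (0 : ℝ) ≤ (((‖v‖ : ℝ) : ℂ) ^ 2).re - ‖act B v‖ ^ 2 := h2
  rw [h4] at h5
  linarith

theorem IsEffect.nonneg {M : Matrix β β ℂ} (hM : IsEffect M) (v : EuclideanSpace ℂ β) :
    0 ≤ (inner ℂ v (act M v)).re := by
  obtain ⟨B, h1, -⟩ := hM.exists_factor
  rw [h1]
  positivity

theorem IsEffect.le_one {M : Matrix β β ℂ} (hM : IsEffect M) {v : EuclideanSpace ℂ β}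
    (hv : ‖v‖ ≤ 1) : (inner ℂ v (act M v)).re ≤ 1 := by
  obtain ⟨B, h1, h2⟩ := hM.exists_factor
  rw [h1]
  exact pow_le_one₀ (norm_nonneg _) ((h2 v).trans hv)

/-- A difference of squares of two numbers in `[0, 1]`, with the factor `2` from their sum. -/
theorem IsEffect.abs_sub_le {M : Matrix β β ℂ} (hM : IsEffect M) {v w : EuclideanSpace ℂ β}
    (hv : ‖v‖ ≤ 1) (hw : ‖w‖ ≤ 1) :
    |(inner ℂ v (act M v)).re - (inner ℂ w (act M w)).re| ≤ 2 * ‖v - w‖ := by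
  obtain ⟨B, h1, h2⟩ := hM.exists_factor
  rw [h1, h1, sq_sub_sq, abs_mul, abs_of_nonneg (by positivity)]
  have h3 := abs_norm_sub_norm_le (act B v) (act B w)
  rw [← act_sub] at h3
  have h4 := h2 (v - w)
  have h5 := (h2 v).trans hv
  have h6 := (h2 w).trans hw
  have h7 := norm_nonneg (act B v)
  have h8 := norm_nonneg (act B w)
  exact mul_le_mul (by linarith) (h3.trans h4) (abs_nonneg _) (by norm_num)

end Accept

/-! ### The real, masked and punctured worlds and their distances for one query -/

section Worlds

variable {Z : Type u} {ℓ q lam : ℕ}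

/-- The first oracle of the sample. -/
def oracle₁ (ω : Sample Z lam) : Oracle := ω.1.1

/-- The second oracle of the sample. -/
def oracle₂ (ω : Sample Z lam) : Oracle := ω.1.2.1

/-- The random oracle of the sample. -/
def randH (ω : Sample Z lam) (x : BitStr) : Option (Fin lam → Bool) := some (ω.2 x)

/-- The circuits that reveal a difference of the oracles. -/
def Reveals (q : ℕ) (δ : ℝ) (ω : Sample Z lam) (a : BreakInput) : Prop :=
  Revealing q δ {x | oracle₁ ω x ≠ oracle₂ ω x} (oracle₁ ω) a

/-- Transcript points at which the post-measurement states are far apart. -/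
def FarAt (η : ℕ → ℝ) (ω : Sample Z lam) : BitStr → Prop := Far η (oracle₁ ω) (oracle₂ ω)

/-- The real distributions, for the oracle `Q`. -/
noncomputable def realFamily (ℓ q : ℕ) (Q : Sample Z lam → Oracle) (ω : Sample Z lam) :
    QueryIdx ℓ q → CellOut q lam → ℝ := breakFamily ℓ q (oracleOf (randH ω) (Q ω))

/-- Queries with revealing circuits are rejected. -/
noncomputable def maskedFamily (ℓ q : ℕ) (δ : ℝ) (Q : Sample Z lam → Oracle)
    (ω : Sample Z lam) : QueryIdx ℓ q → CellOut q lam → ℝ :=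
  maskFamily (Reveals q δ ω) (realFamily ℓ q Q ω)

/-- Moreover, the random oracle is punctured at far points. -/
noncomputable def puncturedFamily (ℓ q : ℕ) (δ : ℝ) (η : ℕ → ℝ) (Q : Sample Z lam → Oracle)
    (ω : Sample Z lam) : QueryIdx ℓ q → CellOut q lam → ℝ :=
  maskFamily (Reveals q δ ω) (breakFamily ℓ q (oracleOf (puncture (FarAt η ω) ω.2) (Q ω)))

/-- Accepted queries with a revealing circuit. -/
def RevealQuery (δ : ℝ) (ω : Sample Z lam) (ix : QueryIdx ℓ q) : Prop :=
  ∃ a, parseBreakInput ix.2.val = some a ∧ Reveals q δ ω a ∧ a.v.length = ix.1 ∧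
    ((ix.1 : ℕ) = 0 ∨ checkOf (randH ω) (encPoint a.n a.v ix.1) a.σ = true)

/-- Queries that show knowledge of the random oracle at a far point. -/
def FarQuery (η : ℕ → ℝ) (ω : Sample Z lam) (ix : QueryIdx ℓ q) : Prop :=
  ∃ a, parseBreakInput ix.2.val = some a ∧ FarAt η ω (encPoint a.n a.v ix.1) ∧
    checkOf (randH ω) (encPoint a.n a.v ix.1) a.σ = true

theorem isDist_realFamily (Q : Sample Z lam → Oracle) (ω : Sample Z lam) (ix) :
    IsDist (realFamily ℓ q Q ω ix) := isDist_breakFamily _ ix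

theorem isDist_maskedFamily (δ : ℝ) (Q : Sample Z lam → Oracle) (ω : Sample Z lam) (ix) :
    IsDist (maskedFamily ℓ q δ Q ω ix) :=
  isDist_maskFamily _ (isDist_realFamily Q ω) ix

theorem isDist_puncturedFamily (δ : ℝ) (η : ℕ → ℝ) (Q : Sample Z lam → Oracle)
    (ω : Sample Z lam) (ix) : IsDist (puncturedFamily ℓ q δ η Q ω ix) :=
  isDist_maskFamily _ (fun ix => isDist_breakFamily _ ix) ix

theorem hell_comm {Out : Type} [Fintype Out] (p p' : Out → ℝ) : hell p p' = hell p' p :=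
  Finset.sum_congr rfl fun _ _ => by ring

open Classical in
-- Masking a query that is rejected anyway changes nothing. The set `RevealQuery` does not mention
-- `Q`, and whether the state for `Q` is defined is left out of it; the same set therefore serves
-- for `O` and `O'`, which the last link of the chain needs.
theorem hell_real_masked_le (δ : ℝ) (Q : Sample Z lam → Oracle) (ω : Sample Z lam)
    (ix : QueryIdx ℓ q) :
    hell (realFamily ℓ q Q ω ix) (maskedFamily ℓ q δ Q ω ix) ≤
      if RevealQuery δ ω ix then 2 else 0 := by
  by_cases h : RevealQuery δ ω ix
  · rw [if_pos h]
    exact hell_le_two (isDist_realFamily Q ω ix) (isDist_maskedFamily δ Q ω ix)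
  · rw [if_neg h]
    refine le_of_eq ?_
    unfold maskedFamily maskFamily
    split_ifs with hm
    · obtain ⟨a, ha, hR⟩ := hm
      have hv : ¬ Valid (oracleOf (randH ω) (Q ω)) ix.1 a := fun hv =>
        h ⟨a, ha, hR, hv.1, hv.2.1⟩
      rw [realFamily, breakFamily_of_not_valid ha hv, hell_self]
    · exact hell_self _

open Classical in
theorem sum_hell_mul_qmass_le {w : ℕ} {p p' : QueryIdx ℓ q → CellOut q lam → ℝ}
    {K : QueryIdx ℓ q → Prop} {c : ℝ} (hc : 0 ≤ c)
    (h : ∀ ix, hell (p ix) (p' ix) ≤ c + if K ix then 2 else 0)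
    {ψ : EuclideanSpace ℂ (AlgBasis ℓ q lam w)} (hψ : ‖ψ‖ ≤ 1) :
    ∑ ix, hell (p ix) (p' ix) * qmass ψ ix ≤ c + 2 * massOn K ψ := by
  have h1 : ∑ ix, qmass ψ ix ≤ 1 := (sum_qmass_le ψ).trans (pow_le_one₀ (norm_nonneg _) hψ)
  calc _ ≤ ∑ ix, (c * qmass ψ ix + 2 * if K ix then qmass ψ ix else 0) := by
        refine Finset.sum_le_sum fun ix _ => ?_
        refine (mul_le_mul_of_nonneg_right (h ix) (qmass_nonneg ψ ix)).trans (le_of_eq ?_)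
        split_ifs <;> ring
    _ = c * ∑ ix, qmass ψ ix + 2 * massOn K ψ := by
        rw [Finset.sum_add_distrib, Finset.mul_sum, massOn, Finset.mul_sum]
    _ ≤ c + 2 * massOn K ψ := by nlinarith

/-- Subadditivity of the square root, with `3 * √8 ≤ 9` and `3 * √2 ≤ 5`. These are the sources of
the constants `9` and `5` below. -/
theorem three_sqrt_le {e m : ℝ} (he : 0 ≤ e) (hm : 0 ≤ m) :
    3 * √(8 * e ^ 2 + 2 * m) ≤ 9 * e + 5 * √m := by
  have hs := Real.sqrt_nonneg m
  have h : √(8 * e ^ 2 + 2 * m) ≤ 3 * e + 5 / 3 * √m := by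
    rw [Real.sqrt_le_left (by positivity)]
    nlinarith [Real.sq_sqrt hm, mul_nonneg he hs]
  linarith

/-- The distance that a query to the masked family causes. -/
theorem real_masked_step {w : ℕ} (δ : ℝ) (Q : Sample Z lam → Oracle) (ω : Sample Z lam)
    {ψ : EuclideanSpace ℂ (AlgBasis ℓ q lam w)} (hψ : ‖ψ‖ ≤ 1) :
    3 * √(∑ ix, hell (realFamily ℓ q Q ω ix) (maskedFamily ℓ q δ Q ω ix) * qmass ψ ix) ≤
      5 * √(massOn (RevealQuery δ ω) ψ) := by
  classical
  have h := sum_hell_mul_qmass_le (K := RevealQuery δ ω) le_rfl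
    (fun ix => by rw [zero_add]; exact hell_real_masked_le δ Q ω ix) hψ
  have h2 := three_sqrt_le le_rfl (massOn_nonneg (RevealQuery δ ω) ψ)
  have h3 := Real.sqrt_le_sqrt h
  simp only [ne_eq, OfNat.ofNat_ne_zero, not_false_eq_true, zero_pow, mul_zero, zero_add] at h2 h3
  linarith

/-- The allowed distance of the post-measurement states after `t` rounds. -/
noncomputable def farBound (ℓ q : ℕ) (ε : ℝ) (t : ℕ) : ℝ := 2 * t * q * ε ^ (ℓ - t)

theorem farBound_zero (ℓ q : ℕ) (ε : ℝ) : farBound ℓ q ε 0 = 0 := by simp [farBound]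

/-- This recursion dictates `farBound`. A round adds at most `2 * q * ε ^ ℓ` to the distance, and
the next threshold has to exceed the sum by a factor `1 / ε`, so that crossing it at a measurement
is unlikely. Each round costs one power of `ε`; starting from `δ = ε ^ (2 * ℓ)`, exactly `ℓ` rounds
can be afforded. -/
theorem farBound_add_le {ε : ℝ} (h0 : 0 ≤ ε) (h1 : ε ≤ 1) {i : ℕ} (hi : i < ℓ) :
    farBound ℓ q ε i + q * (2 * √(ε ^ (2 * ℓ))) ≤ ε * farBound ℓ q ε (i + 1) := by
  have hs : √(ε ^ (2 * ℓ)) = ε ^ ℓ := by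
    rw [mul_comm, pow_mul, Real.sqrt_sq (by positivity)]
  have hp : ε * ε ^ (ℓ - (i + 1)) = ε ^ (ℓ - i) := by
    rw [← pow_succ']; congr 1; omega
  have hle : ε ^ ℓ ≤ ε ^ (ℓ - i) := pow_le_pow_of_le_one h0 h1 (Nat.sub_le _ _)
  have hR : ε * farBound ℓ q ε (i + 1) = 2 * (i + 1) * q * ε ^ (ℓ - i) := by
    rw [farBound, ← hp]; push_cast; ring
  rw [hs, hR, farBound]
  have : (q : ℝ) * ε ^ ℓ ≤ q * ε ^ (ℓ - i) := by gcongr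
  linarith

theorem mul_farBound_le {ε : ℝ} (h0 : 0 ≤ ε) (h1 : ε ≤ 1) {i : ℕ} (hi : i < ℓ) :
    ε * farBound ℓ q ε (i + 1) ≤ 2 * ℓ * q * ε := by
  have h2 : ε ^ (ℓ - (i + 1)) ≤ 1 := pow_le_one₀ h0 h1
  have h3 : ((i + 1 : ℕ) : ℝ) ≤ ℓ := by exact_mod_cast hi
  rw [farBound]
  calc ε * (2 * ((i + 1 : ℕ) : ℝ) * q * ε ^ (ℓ - (i + 1))) ≤ ε * (2 * (ℓ : ℝ) * q * 1) := by gcongr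
    _ = _ := by ring

variable {ε : ℝ}

/-- States stay close under non-revealing circuits. -/
theorem norm_runGates_sub_le_of_not_reveals (h0 : 0 ≤ ε) (h1 : ε ≤ 1) {ω : Sample Z lam}
    {ix : QueryIdx ℓ q} {a : BreakInput} (h : parseBreakInput ix.2.val = some a)
    (hR : ¬ Reveals q (ε ^ (2 * ℓ)) ω a)
    (hd : ‖postState (oracle₁ ω) a.v - postState (oracle₂ ω) a.v‖ ≤ farBound ℓ q ε ix.1) :
    ‖runGates (oracle₁ ω) a.C.gates (postState (oracle₁ ω) a.v) -
      runGates (oracle₂ ω) a.C.gates (postState (oracle₂ ω) a.v)‖ ≤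
      ε * farBound ℓ q ε (ix.1 + 1) := by
  have hlen : a.encode.length ≤ q := by rw [parseBreakInput_eq_some.1 h]; exact ix.2.2
  have := norm_runGates_sub_le_of_not_revealing hlen hR
  have := farBound_add_le (q := q) h0 h1 ix.1.2
  linarith

open Classical in
-- The distance after the circuit is at most `ε` times the next threshold, so the ratio in
-- `hell_puncture_le` is `ε` and the punctured answers contribute `2 * 4 * ε ^ 2`. What remains are
-- queries that present the true oracle value at a far point.
theorem hell_punctured_masked_le (hq : 0 < q) (h0 : 0 < ε) (h1 : ε ≤ 1)
    {Q : Sample Z lam → Oracle} (hQ : Q = oracle₁ ∨ Q = oracle₂) (ω : Sample Z lam)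
    (ix : QueryIdx ℓ q) :
    hell (maskedFamily ℓ q (ε ^ (2 * ℓ)) Q ω ix)
        (puncturedFamily ℓ q (ε ^ (2 * ℓ)) (farBound ℓ q ε) Q ω ix) ≤
      8 * ε ^ 2 + if FarQuery (farBound ℓ q ε) ω ix then 2 else 0 := by
  have hpos : 0 < farBound ℓ q ε (ix.1 + 1) := by
    unfold farBound; positivity
  have hz : 0 ≤ farBound ℓ q ε 0 := (farBound_zero ℓ q ε).ge
  have hnn : (0 : ℝ) ≤ 8 * ε ^ 2 + if FarQuery (farBound ℓ q ε) ω ix then 2 else 0 := by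
    positivity
  unfold maskedFamily puncturedFamily maskFamily
  by_cases hm : ∃ a, parseBreakInput ix.2.val = some a ∧ Reveals q (ε ^ (2 * ℓ)) ω a
  · rw [if_pos hm, if_pos hm, hell_self]; exact hnn
  · rw [if_neg hm, if_neg hm]
    unfold realFamily
    rcases h : parseBreakInput ix.2.val with _ | a
    · rw [breakFamily_of_none h, breakFamily_of_none h, hell_self]; exact hnn
    · have hR : ¬ Reveals q (ε ^ (2 * ℓ)) ω a := fun hR => hm ⟨a, h, hR⟩
      have hfin : ∀ x : ℝ, x ≤ 2 * (4 * (ε * farBound ℓ q ε (ix.1 + 1)) ^ 2 /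
          farBound ℓ q ε (ix.1 + 1) ^ 2) +
          (if FarAt (farBound ℓ q ε) ω (encPoint a.n a.v ix.1) ∧
            checkOf (randH ω) (encPoint a.n a.v ix.1) a.σ = true then 2 else 0) →
          x ≤ 8 * ε ^ 2 + if FarQuery (farBound ℓ q ε) ω ix then 2 else 0 := fun x hx => by
        refine hx.trans (add_le_add (le_of_eq ?_) ?_)
        · field_simp; ring
        · split_ifs with hF hF'
          · exact le_rfl
          · exact absurd ⟨a, h, hF⟩ hF'
          · norm_num
          · exact le_rfl
      apply hfin
      rcases hQ with rfl | rfl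
      · exact hell_puncture_le hz ω.2 h hpos
          fun _ hd => norm_runGates_sub_le_of_not_reveals h0.le h1 h hR hd
      -- Revealing circuits are defined through `O` alone, but the distance bound that follows from
      -- not revealing is symmetric, so it serves also for measurements in the world of `O'`.
      · have hcomm : FarAt (farBound ℓ q ε) ω =
            Far (farBound ℓ q ε) (oracle₂ ω) (oracle₁ ω) := far_comm
        rw [hcomm]
        refine hell_puncture_le hz ω.2 h hpos fun _ hd => ?_
        rw [norm_sub_rev] at hd ⊢
        exact norm_runGates_sub_le_of_not_reveals h0.le h1 h hR hd

/-- The punctured family comes first because the hybrid argument weighs queries along the states of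
its first family, and only punctured states are independent of the oracle values at far points. -/
theorem masked_punctured_step (hq : 0 < q) (h0 : 0 < ε) (h1 : ε ≤ 1)
    {Q : Sample Z lam → Oracle} (hQ : Q = oracle₁ ∨ Q = oracle₂) (ω : Sample Z lam) {w : ℕ}
    {ψ : EuclideanSpace ℂ (AlgBasis ℓ q lam w)} (hψ : ‖ψ‖ ≤ 1) :
    3 * √(∑ ix, hell (puncturedFamily ℓ q (ε ^ (2 * ℓ)) (farBound ℓ q ε) Q ω ix)
        (maskedFamily ℓ q (ε ^ (2 * ℓ)) Q ω ix) * qmass ψ ix) ≤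
      9 * ε + 5 * √(massOn (FarQuery (farBound ℓ q ε) ω) ψ) := by
  classical
  have h := sum_hell_mul_qmass_le (K := FarQuery (farBound ℓ q ε) ω) (c := 8 * ε ^ 2)
    (by positivity) (fun ix => by
      rw [hell_comm]; exact hell_punctured_masked_le hq h0 h1 hQ ω ix) hψ
  have h2 := three_sqrt_le h0.le (massOn_nonneg (FarQuery (farBound ℓ q ε) ω) ψ)
  have h3 := Real.sqrt_le_sqrt h
  linarith

theorem punctured_swap_step (h0 : 0 < ε) (h1 : ε ≤ 1) (ω : Sample Z lam) {w : ℕ}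
    {ψ : EuclideanSpace ℂ (AlgBasis ℓ q lam w)} (hψ : ‖ψ‖ ≤ 1) :
    3 * √(∑ ix, hell
        (puncturedFamily ℓ q (ε ^ (2 * ℓ)) (farBound ℓ q ε) oracle₁ ω ix)
        (puncturedFamily ℓ q (ε ^ (2 * ℓ)) (farBound ℓ q ε) oracle₂ ω ix) * qmass ψ ix) ≤
      9 * (ℓ * q * ε) := by
  classical
  have hz : 0 ≤ farBound ℓ q ε 0 := (farBound_zero ℓ q ε).ge
  have hell_le : ∀ ix, hell
      (puncturedFamily ℓ q (ε ^ (2 * ℓ)) (farBound ℓ q ε) oracle₁ ω ix)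
      (puncturedFamily ℓ q (ε ^ (2 * ℓ)) (farBound ℓ q ε) oracle₂ ω ix) ≤
      8 * (ℓ * q * ε) ^ 2 := fun ix => by
    have hnn : (0 : ℝ) ≤ 8 * (ℓ * q * ε) ^ 2 := by positivity
    unfold puncturedFamily maskFamily
    split_ifs with hm
    · rw [hell_self]; exact hnn
    · rcases h : parseBreakInput ix.2.val with _ | a
      · rw [breakFamily_of_none h, breakFamily_of_none h, hell_self]; exact hnn
      · have hR : ¬ Reveals q (ε ^ (2 * ℓ)) ω a := fun hR => hm ⟨a, h, hR⟩
        -- The value of `c` bounds `ε * farBound ℓ q ε (i + 1)` uniformly over all rounds.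
        refine (hell_swap_le ω.2 hz h (c := 2 * ℓ * q * ε) fun _ hd => ?_).trans
          (le_of_eq (by ring))
        exact (norm_runGates_sub_le_of_not_reveals h0.le h1 h hR hd).trans
          (mul_farBound_le h0.le h1 ix.1.2)
  have h := sum_hell_mul_qmass_le (K := fun _ => False) (c := 8 * (ℓ * q * ε) ^ 2)
    (by positivity) (fun ix => by simpa using hell_le ix) hψ
  have hm : massOn (fun _ => False) ψ = 0 := by simp [massOn]
  rw [hm] at h
  have h2 := three_sqrt_le (e := ℓ * q * ε) (by positivity) le_rfl
  have h3 := Real.sqrt_le_sqrt h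
  rw [Real.sqrt_zero] at h2
  linarith

end Worlds

/-! The worlds depend measurably on the sample -/

section Worlds

variable {Z : Type u} [MeasurableSpace Z] {ℓ q lam : ℕ}

theorem measurable_oracle₁ (x : BitStr) : Measurable fun ω : Sample Z lam => oracle₁ ω x :=
  (measurable_pi_apply x).comp (measurable_fst.comp measurable_fst)

theorem measurable_oracle₂ (x : BitStr) : Measurable fun ω : Sample Z lam => oracle₂ ω x :=
  (measurable_pi_apply x).comp (measurable_fst.comp (measurable_snd.comp measurable_fst))

theorem measurable_z : Measurable fun ω : Sample Z lam => Sample.z ω :=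
  measurable_snd.comp (measurable_snd.comp measurable_fst)

theorem measurable_H (x : BitStr) : Measurable fun ω : Sample Z lam => ω.2 x :=
  (measurable_pi_apply x).comp measurable_snd

theorem measurableSet_randH (y : BitStr) (c : Option (Fin lam → Bool)) :
    MeasurableSet {ω : Sample Z lam | randH ω y = c} := by
  cases c with
  | none => simp [randH]
  | some c =>
    simp only [randH, Option.some.injEq]
    exact measurable_H y (measurableSet_singleton c)

theorem measurableSet_differ (x : BitStr) :
    MeasurableSet {ω : Sample Z lam | x ∈ {x | oracle₁ ω x ≠ oracle₂ ω x}} := by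
  have := measurableSet_eq_fun (measurable_oracle₁ (Z := Z) (lam := lam) x) (measurable_oracle₂ x)
  exact this.compl

theorem measurableSet_reveals (δ : ℝ) (a : BreakInput) :
    MeasurableSet {ω : Sample Z lam | Reveals q δ ω a} :=
  measurableSet_revealing measurable_oracle₁ measurableSet_differ q δ a

theorem measurableSet_farAt (η : ℕ → ℝ) (y : BitStr) :
    MeasurableSet {ω : Sample Z lam | FarAt η ω y} :=
  measurableSet_far measurable_oracle₁ measurable_oracle₂ η y

variable {Q : Sample Z lam → Oracle}

theorem measurable_realFamily (hQ : ∀ x, Measurable fun ω => Q ω x) (ix : QueryIdx ℓ q)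
    (o : CellOut q lam) : Measurable fun ω => realFamily ℓ q Q ω ix o :=
  measurable_breakFamily hQ measurableSet_randH ix o

theorem measurable_maskedFamily (hQ : ∀ x, Measurable fun ω => Q ω x) (δ : ℝ)
    (ix : QueryIdx ℓ q) (o : CellOut q lam) :
    Measurable fun ω => maskedFamily ℓ q δ Q ω ix o :=
  measurable_maskFamily (measurableSet_reveals δ) (measurable_realFamily hQ) ix o

theorem measurable_puncturedFamily (hQ : ∀ x, Measurable fun ω => Q ω x) (δ : ℝ) (η : ℕ → ℝ)
    (ix : QueryIdx ℓ q) (o : CellOut q lam) :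
    Measurable fun ω => puncturedFamily ℓ q δ η Q ω ix o :=
  measurable_maskFamily (measurableSet_reveals δ) (measurable_breakFamily hQ
    (measurableSet_puncture (measurableSet_farAt η) measurable_H)) ix o

theorem measurableSet_revealQuery (δ : ℝ) (ix : QueryIdx ℓ q) :
    MeasurableSet {ω : Sample Z lam | RevealQuery δ ω ix} := by
  unfold RevealQuery
  rcases parseBreakInput ix.2.val with _ | a
  · simp
  · simp only [Option.some.injEq, exists_eq_left']
    exact (measurableSet_reveals δ a).inter ((MeasurableSet.const _).inter
      ((MeasurableSet.const _).union (measurableSet_checkOf measurableSet_randH _ _)))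

theorem measurableSet_farQuery (η : ℕ → ℝ) (ix : QueryIdx ℓ q) :
    MeasurableSet {ω : Sample Z lam | FarQuery η ω ix} := by
  unfold FarQuery
  rcases parseBreakInput ix.2.val with _ | a
  · simp
  · simp only [Option.some.injEq, exists_eq_left']
    exact (measurableSet_farAt η _).inter (measurableSet_checkOf measurableSet_randH _ _)

variable (μ : Measure (Oracle × Oracle × Z)) [IsProbabilityMeasure μ] (A : QueryAlg Z ℓ q lam)

/-- In the punctured worlds, the random oracle at far points can only be guessed. -/
theorem integral_massOn_farQuery_le (hQ : ∀ x, Measurable fun ω => Q ω x)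
    (hQinv : ∀ ω H, Q (ω.1, H) = Q ω) (δ : ℝ) (η : ℕ → ℝ) (s : ℕ) :
    ∫ ω, massOn (FarQuery η ω) (A.evolve (puncturedFamily ℓ q δ η Q ω) (Sample.z ω) s)
      ∂(μ.prod (randomOracle lam)) ≤ (2 ^ lam)⁻¹ := by
  classical
  set ν := μ.prod (randomOracle lam)
  let ψ : Sample Z lam → EuclideanSpace ℂ (AlgBasis ℓ q lam A.w) := fun ω =>
    A.evolve (puncturedFamily ℓ q δ η Q ω) (Sample.z ω) s
  have hψm : MeasVec ψ := A.measVec_evolve (measurable_puncturedFamily hQ δ η) measurable_z s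
  have hψ1 : ∀ ω, ‖ψ ω‖ ≤ 1 := fun ω => A.norm_evolve_le (isDist_puncturedFamily δ η Q ω) _ s
  have hsum : ∀ ω, ∑ ix, qmass (ψ ω) ix ≤ 1 := fun ω =>
    (sum_qmass_le (ψ ω)).trans (pow_le_one₀ (norm_nonneg _) (hψ1 ω))
  have hq1 : ∀ ω ix, qmass (ψ ω) ix ≤ 1 := fun ω ix =>
    (Finset.single_le_sum (fun ix _ => qmass_nonneg (ψ ω) ix) (Finset.mem_univ ix)).trans (hsum ω)
  have hqI : ∀ ix, Integrable (fun ω => qmass (ψ ω) ix) ν := fun ix =>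
    integrable_of_abs_le (measurable_qmass hψm ix) fun ω => by
      rw [abs_of_nonneg (qmass_nonneg _ _)]; exact hq1 ω ix
  have hI : ∀ ix, Integrable (fun ω => if FarQuery η ω ix then qmass (ψ ω) ix else 0) ν :=
    fun ix => integrable_of_abs_le (c := 1)
      (Measurable.ite (measurableSet_farQuery η ix) (measurable_qmass hψm ix) measurable_const)
      fun ω => by
        split_ifs
        · rw [abs_of_nonneg (qmass_nonneg _ _)]; exact hq1 ω ix
        · simp
  have hix : ∀ ix, ∫ ω, (if FarQuery η ω ix then qmass (ψ ω) ix else 0) ∂ν ≤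
      (2 ^ lam)⁻¹ * ∫ ω, qmass (ψ ω) ix ∂ν := fun ix => by
    have hR0 : 0 ≤ (2 ^ lam : ℝ)⁻¹ * ∫ ω, qmass (ψ ω) ix ∂ν :=
      mul_nonneg (by positivity) (integral_nonneg fun ω => qmass_nonneg _ _)
    rcases h : parseBreakInput ix.2.val with _ | a
    · have : ∀ ω : Sample Z lam, ¬ FarQuery η ω ix := fun ω ⟨a, ha, _⟩ => by simp [h] at ha
      simpa [this] using hR0
    set y := encPoint a.n a.v ix.1
    -- A string `σ` of length other than `lam` never passes a check; otherwise `σ` is one fixed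
    -- guess `c`, determined by the query.
    by_cases hc : ∃ c : Fin lam → Bool, List.ofFn c = a.σ
    swap
    · have : ∀ ω : Sample Z lam, ¬ FarQuery η ω ix := by
        rintro ω ⟨b, hb, -, hb2⟩
        obtain rfl : a = b := by rwa [h, Option.some.injEq] at hb
        exact hc ⟨ω.2 _, by simpa [checkOf, randH] using hb2⟩
      simpa [this] using hR0
    obtain ⟨c, hc⟩ := hc
    have hiff : ∀ ω : Sample Z lam, FarQuery η ω ix ↔ FarAt η ω y ∧ ω.2 y = c := fun ω => by
      unfold FarQuery
      simp only [h, Option.some.injEq, exists_eq_left', checkOf, randH, ← hc, decide_eq_true_eq,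
        List.ofFn_inj]
      rfl
    -- Restricting to samples with `y` far is what makes `F` independent of the value at `y`.
    -- Farness depends only on the two oracles, and when `y` is far the puncture erases that value
    -- from the whole family, hence from the state.
    let F : Sample Z lam → ℝ := fun ω => if FarAt η ω y then qmass (ψ ω) ix else 0
    have hF : Integrable F ν := integrable_of_abs_le (c := 1)
      (Measurable.ite (measurableSet_farAt η y) (measurable_qmass hψm ix) measurable_const)
      fun ω => by
        simp only [F]
        split_ifs
        · rw [abs_of_nonneg (qmass_nonneg _ _)]; exact hq1 ω ix
        · simp
    have hinv : ∀ ω τ, F (ω.1, permuteAt y τ ω.2) = F ω := fun ω τ => by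
      by_cases hf : FarAt η ω y
      · have hp : puncture (FarAt η ω) (permuteAt y τ ω.2) = puncture (FarAt η ω) ω.2 := by
          funext x
          by_cases hx : x = y
          · simp [puncture, hx, hf]
          · simp [puncture, permuteAt, hx]
        have hfam : puncturedFamily ℓ q δ η Q (ω.1, permuteAt y τ ω.2) =
            puncturedFamily ℓ q δ η Q ω := by
          have e1 : FarAt η ((ω.1, permuteAt y τ ω.2) : Sample Z lam) = FarAt η ω := rfl
          have e2 : Reveals q δ ((ω.1, permuteAt y τ ω.2) : Sample Z lam) = Reveals q δ ω := rfl
          unfold puncturedFamily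
          rw [e1, e2, hQinv, hp]
        have hψe : ψ (ω.1, permuteAt y τ ω.2) = ψ ω := by
          simp only [ψ]
          rw [hfam]
          rfl
        simp only [F]
        rw [hψe]
        rfl
      · have hf' : ¬ FarAt η ((ω.1, permuteAt y τ ω.2) : Sample Z lam) y := hf
        simp only [F, if_neg hf, if_neg hf']
    have key := integral_ite_oracle_eq_le μ y c hF hinv
    have e : ∀ ω, (if FarQuery η ω ix then qmass (ψ ω) ix else 0) =
        if ω.2 y = c then F ω else 0 := fun ω => by
      by_cases h1 : FarAt η ω y <;> by_cases h2 : ω.2 y = c <;> simp [hiff, F, h1, h2]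
    simp only [e]
    rw [key]
    refine mul_le_mul_of_nonneg_left (integral_mono hF (hqI ix) fun ω => ?_) (by positivity)
    simp only [F]
    split_ifs
    · exact le_rfl
    · exact qmass_nonneg _ _
  calc _ = ∑ ix, ∫ ω, (if FarQuery η ω ix then qmass (ψ ω) ix else 0) ∂ν := by
        rw [← integral_finsetSum _ fun ix _ => hI ix]
        rfl
    _ ≤ ∑ ix, (2 ^ lam : ℝ)⁻¹ * ∫ ω, qmass (ψ ω) ix ∂ν := Finset.sum_le_sum fun ix _ => hix ix
    _ = (2 ^ lam : ℝ)⁻¹ * ∫ ω, ∑ ix, qmass (ψ ω) ix ∂ν := by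
        rw [← Finset.mul_sum, integral_finsetSum _ fun ix _ => hqI ix]
    _ ≤ (2 ^ lam : ℝ)⁻¹ * 1 := by
        gcongr
        exact integral_le_of_le (integrable_finsetSum _ fun ix _ => hqI ix) hsum
    _ = _ := mul_one _

/-- Accepted queries with a revealing circuit have small weight in the real world. -/
theorem integral_massOn_revealQuery_le {Δ : ℝ} (hΔ : ∀ (B : QueryAlg Z ℓ q lam)
      (out : AlgBasis ℓ q lam B.w → BStr q),
      ∫ ω : Sample Z lam, B.hitProb (Sample.S ω) (Sample.z ω) out (Sample.T ω)
        ∂(μ.prod (randomOracle lam)) ≤ Δ) {δ : ℝ} (hδ : 0 < δ) {s : ℕ} (hs : s < q) :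
    ∫ ω, massOn (RevealQuery δ ω) (A.evolve (realFamily ℓ q oracle₁ ω) (Sample.z ω) s)
      ∂(μ.prod (randomOracle lam)) ≤ q * Δ / δ := by
  classical
  set ν := μ.prod (randomOracle lam)
  let ψ : Sample Z lam → EuclideanSpace ℂ (AlgBasis ℓ q lam A.w) := fun ω =>
    A.evolve (realFamily ℓ q oracle₁ ω) (Sample.z ω) s
  have hψm : MeasVec ψ := A.measVec_evolve (measurable_realFamily measurable_oracle₁)
    measurable_z s
  have hψ1 : ∀ ω, ‖ψ ω‖ ≤ 1 := fun ω => A.norm_evolve_le (isDist_realFamily oracle₁ ω) _ s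
  -- The heavy gate varies with the query and the sample, so there is one sampler for each position
  -- `k < q`; summing over them gives the factor `q`.
  choose B out hB using fun k : ℕ =>
    A.exists_sampler s hs (fun ix => (ix.1, truncStr k ix.2)) recordStr
  have hBI : ∀ k, Integrable (fun ω : Sample Z lam =>
      (B k).hitProb (Sample.S ω) (Sample.z ω) (out k) (Sample.T ω)) ν := fun k => by
    have hm : MeasVec fun ω : Sample Z lam =>
        (B k).evolve (realFamily ℓ q oracle₁ ω) (Sample.z ω) q :=
      (B k).measVec_evolve (measurable_realFamily measurable_oracle₁) measurable_z q
    have e : ∀ ω : Sample Z lam, (B k).hitProb (Sample.S ω) (Sample.z ω) (out k) (Sample.T ω) =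
        ∑ a, if (out k a).val ∈ Sample.T ω then
          ‖(B k).evolve (realFamily ℓ q oracle₁ ω) (Sample.z ω) q a‖ ^ 2 else 0 := fun ω => by
      unfold QueryAlg.hitProb QueryAlg.final
      rw [QueryAlg.state_eq_evolve]
      rfl
    simp only [e]
    refine integrable_of_abs_le (c := 1) (Finset.measurable_sum _ fun a _ =>
      Measurable.ite (measurableSet_differ _) ((hm a).norm.pow_const 2) measurable_const)
      fun ω => ?_
    rw [abs_of_nonneg (Finset.sum_nonneg fun a _ => by positivity)]
    have h1 := (B k).norm_evolve_le (isDist_realFamily oracle₁ ω) (Sample.z ω) q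
    refine le_trans ?_ (pow_le_one₀ (n := 2) (norm_nonneg _) h1)
    rw [EuclideanSpace.norm_sq_eq]
    refine Finset.sum_le_sum fun a _ => ?_
    split_ifs
    · exact le_rfl
    · positivity
  have hpt : ∀ ω, δ * massOn (RevealQuery δ ω) (ψ ω) ≤ ∑ k ∈ Finset.range q,
      (B k).hitProb (Sample.S ω) (Sample.z ω) (out k) (Sample.T ω) := fun ω => by
    have hnn : ∀ ix o, 0 ≤ breakFamily ℓ q (Sample.S ω) ix o := fun ix o =>
      (isDist_breakFamily _ ix).1 o
    refine le_trans ?_ (Finset.sum_le_sum fun k _ =>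
      hB k (Sample.S ω) (Sample.z ω) (Sample.T ω) hnn)
    rw [Finset.sum_comm, massOn, Finset.mul_sum]
    refine Finset.sum_le_sum fun ix _ => ?_
    rw [← Finset.mul_sum, mul_comm δ]
    have hψe : ψ ω = A.evolve (breakFamily ℓ q (Sample.S ω)) (Sample.z ω) s := rfl
    rw [← hψe]
    have hG : ∀ k, 0 ≤ ∑ o, if (recordStr o).val ∈ Sample.T ω then
        breakFamily ℓ q (Sample.S ω) (ix.1, truncStr k ix.2) o else 0 := fun k =>
      Finset.sum_nonneg fun o _ => by
        have := hnn (ix.1, truncStr k ix.2) o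
        split_ifs <;> simp [this]
    by_cases hr : RevealQuery δ ω ix
    · rw [if_pos hr]
      refine mul_le_mul_of_nonneg_left ?_ (qmass_nonneg _ _)
      obtain ⟨a, ha, ⟨k, hk, hk2⟩, hlen, hch⟩ := hr
      have hv : Valid (Sample.S ω) ix.1 a := by
        -- An undefined state has hit weight `0`, below the positive threshold.
        refine ⟨hlen, hch, fun h0 => ?_⟩
        have h0' : postState (oracle₁ ω) a.v = 0 := h0
        rw [hitWeight_of_postState_eq_zero _ h0'] at hk2
        linarith
      refine (hk2.trans (hitWeight_le_sum (Sample.T ω) ha hv k)).trans ?_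
      exact Finset.single_le_sum (f := fun k => ∑ o, if (recordStr o).val ∈ Sample.T ω then
        breakFamily ℓ q (Sample.S ω) (ix.1, truncStr k ix.2) o else 0) (fun k _ => hG k)
        (Finset.mem_range.2 hk)
    · rw [if_neg hr, zero_mul]
      exact mul_nonneg (qmass_nonneg _ _) (Finset.sum_nonneg fun k _ => hG k)
  rw [le_div_iff₀ hδ, mul_comm, ← integral_const_mul]
  have hmass : Integrable (fun ω => massOn (RevealQuery δ ω) (ψ ω)) ν :=
    integrable_of_abs_le (c := 1) (measurable_massOn (measurableSet_revealQuery δ) hψm)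
      fun ω => by
        rw [abs_of_nonneg (massOn_nonneg _ _)]
        exact (massOn_le _ _).trans (pow_le_one₀ (norm_nonneg _) (hψ1 ω))
  calc _ ≤ ∫ ω, ∑ k ∈ Finset.range q,
        (B k).hitProb (Sample.S ω) (Sample.z ω) (out k) (Sample.T ω) ∂ν :=
        integral_mono (hmass.const_mul δ) (integrable_finsetSum _ fun k _ => hBI k) hpt
    _ = ∑ k ∈ Finset.range q, ∫ ω,
        (B k).hitProb (Sample.S ω) (Sample.z ω) (out k) (Sample.T ω) ∂ν :=
        integral_finsetSum _ fun k _ => hBI k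
    _ ≤ ∑ k ∈ Finset.range q, Δ := Finset.sum_le_sum fun k _ => hΔ (B k) (out k)
    _ = q * Δ := by simp

end Worlds

/-! The chain of worlds -/

section Chain

variable {Z : Type u} [MeasurableSpace Z] {ℓ q lam : ℕ} {Ω : Type*} [MeasurableSpace Ω]
  {ν : Measure Ω} [IsProbabilityMeasure ν]

/-- Families of distributions that depend measurably on the sample. -/
structure MeasFamily (p : Ω → QueryIdx ℓ q → CellOut q lam → ℝ) : Prop where
  isDist : ∀ ω ix, IsDist (p ω ix)
  meas : ∀ ix o, Measurable fun ω => p ω ix o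

theorem QueryAlg.integral_evolve_triangle (A : QueryAlg Z ℓ q lam)
    {p₁ p₂ p₃ : Ω → QueryIdx ℓ q → CellOut q lam → ℝ} (h₁ : MeasFamily p₁) (h₂ : MeasFamily p₂)
    (h₃ : MeasFamily p₃) {z : Ω → Z} (hz : Measurable z) (k : ℕ) :
    ∫ ω, ‖A.evolve (p₁ ω) (z ω) k - A.evolve (p₃ ω) (z ω) k‖ ∂ν ≤
      ∫ ω, ‖A.evolve (p₁ ω) (z ω) k - A.evolve (p₂ ω) (z ω) k‖ ∂ν +
      ∫ ω, ‖A.evolve (p₂ ω) (z ω) k - A.evolve (p₃ ω) (z ω) k‖ ∂ν := by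
  have i12 := A.integrable_norm_evolve_sub (ν := ν) h₁.isDist h₂.isDist h₁.meas h₂.meas hz k
  have i23 := A.integrable_norm_evolve_sub (ν := ν) h₂.isDist h₃.isDist h₂.meas h₃.meas hz k
  rw [← integral_add i12 i23]
  exact integral_mono (A.integrable_norm_evolve_sub h₁.isDist h₃.isDist h₁.meas h₃.meas hz k)
    (i12.add i23) fun ω => norm_sub_le_norm_sub_add_norm_sub _ _ _

theorem QueryAlg.integral_evolve_comm (A : QueryAlg Z ℓ q lam)
    (p₁ p₂ : Ω → QueryIdx ℓ q → CellOut q lam → ℝ) (z : Ω → Z) (k : ℕ) :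
    ∫ ω, ‖A.evolve (p₁ ω) (z ω) k - A.evolve (p₂ ω) (z ω) k‖ ∂ν =
      ∫ ω, ‖A.evolve (p₂ ω) (z ω) k - A.evolve (p₁ ω) (z ω) k‖ ∂ν := by
  simp only [norm_sub_rev]

theorem QueryAlg.integrable_sqrt_massOn (A : QueryAlg Z ℓ q lam)
    {p : Ω → QueryIdx ℓ q → CellOut q lam → ℝ} (hp : MeasFamily p)
    {K : Ω → QueryIdx ℓ q → Prop} (hK : ∀ ix, MeasurableSet {ω | K ω ix})
    {z : Ω → Z} (hz : Measurable z) (k : ℕ) :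
    Integrable (fun ω => √(massOn (K ω) (A.evolve (p ω) (z ω) k))) ν :=
  integrable_of_abs_le (c := 1) (measurable_massOn hK (A.measVec_evolve hp.meas hz k)).sqrt
    fun ω => by
      rw [abs_of_nonneg (Real.sqrt_nonneg _), Real.sqrt_le_one]
      exact (massOn_le _ _).trans
        (pow_le_one₀ (norm_nonneg _) (A.norm_evolve_le (hp.isDist ω) _ k))

theorem QueryAlg.integral_sqrt_massOn_le (A : QueryAlg Z ℓ q lam)
    {p : Ω → QueryIdx ℓ q → CellOut q lam → ℝ} (hp : MeasFamily p)
    {K : Ω → QueryIdx ℓ q → Prop} (hK : ∀ ix, MeasurableSet {ω | K ω ix})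
    {z : Ω → Z} (hz : Measurable z) (k : ℕ) {c : ℝ} (hc : 0 < c)
    (h : ∫ ω, massOn (K ω) (A.evolve (p ω) (z ω) k) ∂ν ≤ c ^ 2) :
    ∫ ω, √(massOn (K ω) (A.evolve (p ω) (z ω) k)) ∂ν ≤ c :=
  integral_sqrt_le (b := 1) (measurable_massOn hK (A.measVec_evolve hp.meas hz k))
    (fun _ => massOn_nonneg _ _) (fun ω => (massOn_le _ _).trans
        (pow_le_one₀ (norm_nonneg _) (A.norm_evolve_le (hp.isDist ω) _ k))) hc h

end Chain

/-! ### Assembly of the chain and choice of parameters -/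

section Main

variable {Z : Type u} [MeasurableSpace Z] {ℓ q lam : ℕ}

theorem measFamily_real {Q : Sample Z lam → Oracle} (hQ : ∀ x, Measurable fun ω => Q ω x) :
    MeasFamily (realFamily ℓ q Q) := ⟨isDist_realFamily Q, measurable_realFamily hQ⟩

theorem measFamily_masked {Q : Sample Z lam → Oracle} (hQ : ∀ x, Measurable fun ω => Q ω x)
    (δ : ℝ) : MeasFamily (maskedFamily ℓ q δ Q) :=
  ⟨isDist_maskedFamily δ Q, measurable_maskedFamily hQ δ⟩

theorem measFamily_punctured {Q : Sample Z lam → Oracle} (hQ : ∀ x, Measurable fun ω => Q ω x)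
    (δ : ℝ) (η : ℕ → ℝ) : MeasFamily (puncturedFamily ℓ q δ η Q) :=
  ⟨isDist_puncturedFamily δ η Q, measurable_puncturedFamily hQ δ η⟩

variable (μ : Measure (Oracle × Oracle × Z)) [IsProbabilityMeasure μ] (A : QueryAlg Z ℓ q lam)

/-- Each query costs `9 * ε` for punctured answers and `5 * ε` for guessed oracle values, the latter
because the mean guessing weight is at most `2 ^ (-lam) ≤ ε ^ 2`. -/
theorem integral_punctured_masked_le (hq : 0 < q) {ε : ℝ} (h0 : 0 < ε) (h1 : ε ≤ 1)
    (hlam : ((2 : ℝ) ^ lam)⁻¹ ≤ ε ^ 2) {Q : Sample Z lam → Oracle}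
    (hQ : Q = oracle₁ ∨ Q = oracle₂) {k : ℕ} (hk : k ≤ q) :
    ∫ ω, ‖A.evolve (puncturedFamily ℓ q (ε ^ (2 * ℓ)) (farBound ℓ q ε) Q ω) (Sample.z ω) k -
      A.evolve (maskedFamily ℓ q (ε ^ (2 * ℓ)) Q ω) (Sample.z ω) k‖
      ∂(μ.prod (randomOracle lam)) ≤ q * (14 * ε) := by
  have hQm : ∀ x, Measurable fun ω => Q ω x := by
    rcases hQ with rfl | rfl
    · exact measurable_oracle₁
    · exact measurable_oracle₂
  have hQi : ∀ ω H, Q (ω.1, H) = Q ω := by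
    rcases hQ with rfl | rfl <;> exact fun _ _ => rfl
  have hP := measFamily_punctured (ℓ := ℓ) (q := q) hQm (ε ^ (2 * ℓ)) (farBound ℓ q ε)
  have hM := measFamily_masked (ℓ := ℓ) (q := q) hQm (ε ^ (2 * ℓ))
  have hI := fun s => A.integrable_sqrt_massOn (ν := μ.prod (randomOracle lam)) hP
    (measurableSet_farQuery (farBound ℓ q ε)) measurable_z s
  refine A.integral_norm_evolve_sub_le hP.isDist hM.isDist hP.meas hM.meas measurable_z
    (F := fun s ω => 9 * ε + 5 * √(massOn (FarQuery (farBound ℓ q ε) ω)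
      (A.evolve (puncturedFamily ℓ q (ε ^ (2 * ℓ)) (farBound ℓ q ε) Q ω) (Sample.z ω) s)))
    (fun s _ => (integrable_const _).add ((hI s).const_mul 5))
    (fun s _ ω => masked_punctured_step hq h0 h1 hQ ω (A.norm_evolve_le (hP.isDist ω) _ s))
    (by positivity) (fun s _ => ?_) hk
  rw [integral_add (integrable_const _) ((hI s).const_mul 5), integral_const, integral_const_mul]
  have := A.integral_sqrt_massOn_le (ν := μ.prod (randomOracle lam)) hP
    (measurableSet_farQuery (farBound ℓ q ε)) measurable_z s h0
    ((integral_massOn_farQuery_le μ A hQm hQi _ _ s).trans hlam)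
  simp only [probReal_univ, smul_eq_mul, one_mul]
  linarith

theorem integral_punctured_swap_le {ε : ℝ} (h0 : 0 < ε) (h1 : ε ≤ 1) {k : ℕ} (hk : k ≤ q) :
    ∫ ω, ‖A.evolve (puncturedFamily ℓ q (ε ^ (2 * ℓ)) (farBound ℓ q ε) oracle₁ ω)
        (Sample.z ω) k -
      A.evolve (puncturedFamily ℓ q (ε ^ (2 * ℓ)) (farBound ℓ q ε) oracle₂ ω) (Sample.z ω) k‖
      ∂(μ.prod (randomOracle lam)) ≤ q * (9 * (ℓ * q * ε)) := by
  have hP₁ := measFamily_punctured (Z := Z) (lam := lam) (ℓ := ℓ) (q := q) measurable_oracle₁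
    (ε ^ (2 * ℓ)) (farBound ℓ q ε)
  have hP₂ := measFamily_punctured (Z := Z) (lam := lam) (ℓ := ℓ) (q := q) measurable_oracle₂
    (ε ^ (2 * ℓ)) (farBound ℓ q ε)
  exact A.integral_norm_evolve_sub_le hP₁.isDist hP₂.isDist hP₁.meas hP₂.meas measurable_z
    (F := fun _ _ => 9 * (ℓ * q * ε)) (fun s _ => integrable_const _)
    (fun s _ ω => punctured_swap_step h0 h1 ω (A.norm_evolve_le (hP₁.isDist ω) _ s))
    (by positivity) (fun s _ => by simp) hk

/-- All links up to the masked world for `O'` compare with the real world for `O`, where `Δ`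
controls the revealing queries. The last link borrows this control through the distance reached so
far, which multiplies that distance by `1 + 5 * q`. -/
theorem integral_real_sub_le {Δ : ℝ} (hΔ : ∀ (B : QueryAlg Z ℓ q lam)
      (out : AlgBasis ℓ q lam B.w → BStr q),
      ∫ ω : Sample Z lam, B.hitProb (Sample.S ω) (Sample.z ω) out (Sample.T ω)
        ∂(μ.prod (randomOracle lam)) ≤ Δ) (hq : 0 < q) {ε : ℝ} (h0 : 0 < ε) (h1 : ε ≤ 1)
    (hε : Δ ≤ ε ^ (2 * ℓ) * ε ^ 2) (hlam : ((2 : ℝ) ^ lam)⁻¹ ≤ ε ^ 2) :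
    ∫ ω, ‖A.evolve (realFamily ℓ q oracle₁ ω) (Sample.z ω) q -
      A.evolve (realFamily ℓ q oracle₂ ω) (Sample.z ω) q‖ ∂(μ.prod (randomOracle lam)) ≤
      ((28 * q + 9 * ℓ * q ^ 2 + 5 * q ^ 2) * (1 + 5 * q) + 5 * q ^ 2) * ε := by
  set ν := μ.prod (randomOracle lam) with hν
  set δ := ε ^ (2 * ℓ) with hδ
  have hδ0 : 0 < δ := by positivity
  have hq1 : (1 : ℝ) ≤ q := by exact_mod_cast hq
  have r₁ := measFamily_real (Z := Z) (lam := lam) (ℓ := ℓ) (q := q) measurable_oracle₁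
  have r₂ := measFamily_real (Z := Z) (lam := lam) (ℓ := ℓ) (q := q) measurable_oracle₂
  have m₁ := measFamily_masked (Z := Z) (lam := lam) (ℓ := ℓ) (q := q) measurable_oracle₁ δ
  have m₂ := measFamily_masked (Z := Z) (lam := lam) (ℓ := ℓ) (q := q) measurable_oracle₂ δ
  have g₁ := measFamily_punctured (Z := Z) (lam := lam) (ℓ := ℓ) (q := q) measurable_oracle₁ δ
    (farBound ℓ q ε)
  have g₂ := measFamily_punctured (Z := Z) (lam := lam) (ℓ := ℓ) (q := q) measurable_oracle₂ δ
    (farBound ℓ q ε)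
  have hI := fun s => A.integrable_sqrt_massOn (ν := ν) r₁
    (measurableSet_revealQuery δ) measurable_z s
  have hR : ∀ s < q, ∫ ω, √(massOn (RevealQuery δ ω)
      (A.evolve (realFamily ℓ q oracle₁ ω) (Sample.z ω) s)) ∂ν ≤ q * ε := fun s hs => by
    refine A.integral_sqrt_massOn_le r₁ (measurableSet_revealQuery δ) measurable_z s
      (by positivity) ((integral_massOn_revealQuery_le μ A hΔ hδ0 hs).trans ?_)
    rw [div_le_iff₀ hδ0]
    calc (q : ℝ) * Δ ≤ q * (δ * ε ^ 2) := by gcongr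
      -- Only `√q * ε` is lost here; the bound is rounded up to the square of `q * ε` to stay
      -- polynomial in `q`.
      _ ≤ (q * q) * (δ * ε ^ 2) := by
          gcongr
          nlinarith
      _ = (q * ε) ^ 2 * δ := by ring
  have d₁ : ∀ k ≤ q, ∫ ω, ‖A.evolve (realFamily ℓ q oracle₁ ω) (Sample.z ω) k -
      A.evolve (maskedFamily ℓ q δ oracle₁ ω) (Sample.z ω) k‖ ∂ν ≤ q * (5 * (q * ε)) :=
    fun k hk => A.integral_norm_evolve_sub_le r₁.isDist m₁.isDist r₁.meas m₁.meas measurable_z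
      (F := fun s ω => 5 * √(massOn (RevealQuery δ ω)
        (A.evolve (realFamily ℓ q oracle₁ ω) (Sample.z ω) s)))
      (fun s _ => (hI s).const_mul 5)
      (fun s _ ω => real_masked_step δ oracle₁ ω (A.norm_evolve_le (r₁.isDist ω) _ s))
      (by positivity) (fun s hs => by
        rw [integral_const_mul]
        have := hR s hs
        linarith) hk
  -- One summand per link from the masked world for `O'` back to the real world for `O`: puncturing,
  -- exchange of the oracles, undoing the puncture, unmasking.
  set E : ℝ := q * (14 * ε) + q * (9 * (ℓ * q * ε)) + q * (14 * ε) + q * (5 * (q * ε)) with hE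
  have hE0 : 0 ≤ E := by positivity
  have d₂ : ∀ k ≤ q, ∫ ω, ‖A.evolve (maskedFamily ℓ q δ oracle₂ ω) (Sample.z ω) k -
      A.evolve (realFamily ℓ q oracle₁ ω) (Sample.z ω) k‖ ∂ν ≤ E := fun k hk => by
    have t₁ := A.integral_evolve_triangle (ν := ν) m₂ g₂ r₁ measurable_z k
    have t₂ := A.integral_evolve_triangle (ν := ν) g₂ g₁ r₁ measurable_z k
    have t₃ := A.integral_evolve_triangle (ν := ν) g₁ m₁ r₁ measurable_z k
    have c₁ := A.integral_evolve_comm (ν := ν) (maskedFamily ℓ q δ oracle₂)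
      (puncturedFamily ℓ q δ (farBound ℓ q ε) oracle₂) Sample.z k
    have c₂ := A.integral_evolve_comm (ν := ν) (puncturedFamily ℓ q δ (farBound ℓ q ε) oracle₂)
      (puncturedFamily ℓ q δ (farBound ℓ q ε) oracle₁) Sample.z k
    have c₃ := A.integral_evolve_comm (ν := ν) (maskedFamily ℓ q δ oracle₁)
      (realFamily ℓ q oracle₁) Sample.z k
    have u₁ := integral_punctured_masked_le μ A hq h0 h1 hlam (Or.inr rfl) hk
    have u₂ := integral_punctured_masked_le μ A hq h0 h1 hlam (Or.inl rfl) hk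
    have u₃ := integral_punctured_swap_le μ A h0 h1 hk
    have u₄ := d₁ k hk
    rw [← hδ, ← hν] at u₁ u₂ u₃
    linarith
  -- Queries are weighed along the masked states for `O'`. Each weight is replaced by the one in the
  -- real world for `O`, at the cost of the distance `E` from `d₂`, which is available before every
  -- query.
  have d₃ : ∫ ω, ‖A.evolve (maskedFamily ℓ q δ oracle₂ ω) (Sample.z ω) q -
      A.evolve (realFamily ℓ q oracle₂ ω) (Sample.z ω) q‖ ∂ν ≤ q * (5 * (q * ε + E)) := by
    have hJ := fun s => A.integrable_norm_evolve_sub (ν := ν) m₂.isDist r₁.isDist m₂.meas r₁.meas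
      measurable_z s
    refine A.integral_norm_evolve_sub_le m₂.isDist r₂.isDist m₂.meas r₂.meas measurable_z
      (F := fun s ω => 5 * (√(massOn (RevealQuery δ ω)
        (A.evolve (realFamily ℓ q oracle₁ ω) (Sample.z ω) s)) +
        ‖A.evolve (maskedFamily ℓ q δ oracle₂ ω) (Sample.z ω) s -
          A.evolve (realFamily ℓ q oracle₁ ω) (Sample.z ω) s‖))
      (fun s _ => ((hI s).add (hJ s)).const_mul 5)
      (fun s _ ω => ?_) (by positivity) (fun s hs => ?_) le_rfl
    · classical
      simp only [hell_comm (maskedFamily ℓ q δ oracle₂ ω _)]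
      refine (real_masked_step δ oracle₂ ω (A.norm_evolve_le (m₂.isDist ω) _ s)).trans ?_
      have := sqrt_sum_qmass_le (RevealQuery δ ω)
        (A.evolve (maskedFamily ℓ q δ oracle₂ ω) (Sample.z ω) s)
        (A.evolve (realFamily ℓ q oracle₁ ω) (Sample.z ω) s)
      unfold massOn
      gcongr
    · rw [integral_const_mul, integral_add (hI s) (hJ s)]
      have := hR s hs
      have := d₂ s hs.le
      linarith
  have t := A.integral_evolve_triangle (ν := ν) r₁ m₂ r₂ measurable_z q
  rw [A.integral_evolve_comm (realFamily ℓ q oracle₁) (maskedFamily ℓ q δ oracle₂)] at t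
  have := d₂ q le_rfl
  calc _ ≤ E + q * (5 * (q * ε + E)) := by linarith
    _ = _ := by rw [hE]; ring

theorem QueryAlg.acceptProb_eq (S : OracleSet lam) (z : Z)
    (M : Matrix (AlgBasis ℓ q lam A.w) (AlgBasis ℓ q lam A.w) ℂ) :
    A.acceptProb S z M = (inner ℂ (A.evolve (breakFamily ℓ q S) z q)
      (act M (A.evolve (breakFamily ℓ q S) z q))).re := by
  unfold QueryAlg.acceptProb QueryAlg.final
  rw [QueryAlg.state_eq_evolve, toEuclideanCLM_eq_act]

theorem integrable_acceptProb {Q : Sample Z lam → Oracle}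
    (hQ : ∀ x, Measurable fun ω => Q ω x)
    {M : Sample Z lam → Matrix (AlgBasis ℓ q lam A.w) (AlgBasis ℓ q lam A.w) ℂ}
    (hM : ∀ ω, IsEffect (M ω)) (hMm : ∀ a b, Measurable fun ω => M ω a b) :
    Integrable (fun ω => A.acceptProb (oracleOf (randH ω) (Q ω)) (Sample.z ω) (M ω))
      (μ.prod (randomOracle lam)) := by
  have r := measFamily_real (ℓ := ℓ) (q := q) hQ
  have hv := A.measVec_evolve r.meas measurable_z q
  refine integrable_of_abs_le (c := 1) ?_ fun ω => ?_
  · simp only [QueryAlg.acceptProb_eq, EuclideanSpace.inner_eq_star_dotProduct, dotProduct]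
    refine Complex.measurable_re.comp (Finset.measurable_sum _ fun a _ => ?_)
    exact ((hv.act hMm) a).mul (Complex.continuous_conj.measurable.comp (hv a))
  · rw [QueryAlg.acceptProb_eq, abs_of_nonneg ((hM ω).nonneg _)]
    exact (hM ω).le_one (A.norm_evolve_le (r.isDist ω) _ q)

end Main

theorem mainTheorem9 (ℓ : ℕ) :
    ∃ p : Polynomial ℕ, ∀ (lam q : ℕ) (Z : Type u) [MeasurableSpace Z]
      (μ : Measure (Oracle × Oracle × Z)) [IsProbabilityMeasure μ] (Δ : ℝ),
      (∀ (B : QueryAlg Z ℓ q lam) (out : AlgBasis ℓ q lam B.w → BStr q),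
        ∫ ω : Sample Z lam, B.hitProb (Sample.S ω) (Sample.z ω) out (Sample.T ω)
          ∂(μ.prod (randomOracle lam)) ≤ Δ) →
      ∀ (A : QueryAlg Z ℓ q lam)
        (M : Sample Z lam → Matrix (AlgBasis ℓ q lam A.w) (AlgBasis ℓ q lam A.w) ℂ),
        (∀ ω, IsEffect (M ω)) → (∀ a b, Measurable fun ω => M ω a b) →
        |(∫ ω, A.acceptProb (Sample.S ω) (Sample.z ω) (M ω) ∂(μ.prod (randomOracle lam))) -
          ∫ ω, A.acceptProb (Sample.S' ω) (Sample.z ω) (M ω) ∂(μ.prod (randomOracle lam))| ≤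
          ((p.eval q : ℕ) : ℝ) * (max Δ ((2 : ℝ) ^ (-(lam : ℝ) / 2))) ^ (1 / (2 * 4 ^ ℓ) : ℝ) := by
  -- Twice the bound of `integral_real_sub_le`, the `2` coming from the measurement. The additional
  -- `1` makes the bound trivial when the maximum exceeds `1`.
  refine ⟨2 * ((28 * .X + 9 * .C ℓ * .X ^ 2 + 5 * .X ^ 2) * (1 + 5 * .X) + 5 * .X ^ 2) + 1,
    fun lam q Z _ μ _ Δ hΔ A M hM hMm => ?_⟩
  set ν := μ.prod (randomOracle lam)
  set D := max Δ ((2 : ℝ) ^ (-(lam : ℝ) / 2)) with hD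
  have hD0 : 0 < D := lt_max_of_lt_right (by positivity)
  have hp : ((((2 * ((28 * .X + 9 * .C ℓ * .X ^ 2 + 5 * .X ^ 2) * (1 + 5 * .X) + 5 * .X ^ 2) + 1 :
      Polynomial ℕ).eval q : ℕ) : ℝ)) =
      2 * ((28 * q + 9 * ℓ * q ^ 2 + 5 * q ^ 2) * (1 + 5 * q) + 5 * q ^ 2) + 1 := by
    simp
  rw [hp]
  have r₁ := measFamily_real (Z := Z) (lam := lam) (ℓ := ℓ) (q := q) measurable_oracle₁
  have r₂ := measFamily_real (Z := Z) (lam := lam) (ℓ := ℓ) (q := q) measurable_oracle₂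
  have i₁ : Integrable (fun ω => A.acceptProb (Sample.S ω) (Sample.z ω) (M ω)) ν :=
    integrable_acceptProb μ A measurable_oracle₁ hM hMm
  have i₂ : Integrable (fun ω => A.acceptProb (Sample.S' ω) (Sample.z ω) (M ω)) ν :=
    integrable_acceptProb μ A measurable_oracle₂ hM hMm
  rw [← integral_sub i₁ i₂]
  have n₁ : ∀ ω, ‖A.evolve (realFamily ℓ q oracle₁ ω) (Sample.z ω) q‖ ≤ 1 := fun ω =>
    A.norm_evolve_le (r₁.isDist ω) _ q
  have n₂ : ∀ ω, ‖A.evolve (realFamily ℓ q oracle₂ ω) (Sample.z ω) q‖ ≤ 1 := fun ω =>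
    A.norm_evolve_le (r₂.isDist ω) _ q
  have hpt : ∀ ω, |A.acceptProb (Sample.S ω) (Sample.z ω) (M ω) -
      A.acceptProb (Sample.S' ω) (Sample.z ω) (M ω)| ≤
      2 * ‖A.evolve (realFamily ℓ q oracle₁ ω) (Sample.z ω) q -
        A.evolve (realFamily ℓ q oracle₂ ω) (Sample.z ω) q‖ := fun ω => by
    rw [QueryAlg.acceptProb_eq, QueryAlg.acceptProb_eq]
    exact (hM ω).abs_sub_le (n₁ ω) (n₂ ω)
  have habs := abs_integral_le_integral_abs (μ := ν) (f := fun ω =>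
    A.acceptProb (Sample.S ω) (Sample.z ω) (M ω) -
      A.acceptProb (Sample.S' ω) (Sample.z ω) (M ω))
  have hint := integral_mono (μ := ν) (i₁.sub i₂).abs
    ((A.integrable_norm_evolve_sub r₁.isDist r₂.isDist r₁.meas r₂.meas measurable_z q).const_mul 2)
    hpt
  rw [integral_const_mul] at hint
  have hle := habs.trans hint
  set C' : ℝ := (28 * q + 9 * ℓ * q ^ 2 + 5 * q ^ 2) * (1 + 5 * q) + 5 * q ^ 2 with hC
  have hC0 : 0 ≤ C' := by positivity
  -- Without queries both final states equal the initial state. This case is separate because the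
  -- thresholds `farBound` vanish for `q = 0`, while puncturing divides by them.
  rcases Nat.eq_zero_or_pos q with rfl | hq
  · have hz : ∀ ω : Sample Z lam, ‖A.evolve (realFamily ℓ 0 oracle₁ ω) (Sample.z ω) 0 -
        A.evolve (realFamily ℓ 0 oracle₂ ω) (Sample.z ω) 0‖ = 0 := fun ω => by
      simp [QueryAlg.evolve, evolveFrom]
    simp only [hz, integral_zero, mul_zero] at hle
    exact hle.trans (by positivity)
  rcases lt_or_ge 1 D with hD1 | hD1
  · have h1 : 1 ≤ D ^ (1 / (2 * 4 ^ ℓ) : ℝ) := Real.one_le_rpow hD1.le (by positivity)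
    have h2 : ∀ ω, |A.acceptProb (Sample.S ω) (Sample.z ω) (M ω) -
      A.acceptProb (Sample.S' ω) (Sample.z ω) (M ω)| ≤ 1 := fun ω => by
      rw [QueryAlg.acceptProb_eq, QueryAlg.acceptProb_eq]
      have a1 := (hM ω).nonneg (A.evolve (realFamily ℓ q oracle₁ ω) (Sample.z ω) q)
      have a2 := (hM ω).le_one (n₁ ω)
      have a3 := (hM ω).nonneg (A.evolve (realFamily ℓ q oracle₂ ω) (Sample.z ω) q)
      have a4 := (hM ω).le_one (n₂ ω)
      exact abs_sub_le_iff.2 ⟨(sub_le_self _ a3).trans a2, (sub_le_self _ a1).trans a4⟩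
    have h3 := integral_le_of_le (ν := ν) (i₁.sub i₂).abs h2
    have h4 := habs.trans h3
    nlinarith
  -- The exponent solves `ε ^ (2 * ℓ) * ε ^ 2 = D`, which balances the loss `Δ / δ` from masking
  -- against `ε ^ 2`.
  · set e : ℝ := 1 / (2 * (ℓ + 1)) with he
    set ε := D ^ e with hε
    have e0 : 0 < ε := Real.rpow_pos_of_pos hD0 _
    have e1 : ε ≤ 1 := Real.rpow_le_one hD0.le hD1 (by positivity)
    have epow : ε ^ (2 * ℓ) * ε ^ 2 = D := by
      rw [← pow_add, hε, ← Real.rpow_natCast, ← Real.rpow_mul hD0.le]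
      have : e * ((2 * ℓ + 2 : ℕ) : ℝ) = 1 := by
        rw [he]; push_cast; field_simp
      rw [this, Real.rpow_one]
    have hDε : D ≤ ε := by
      have : e ≤ 1 := by
        rw [he, div_le_one (by positivity)]
        have : (0 : ℝ) ≤ ℓ := Nat.cast_nonneg ℓ
        linarith
      simpa using Real.rpow_le_rpow_of_exponent_ge hD0 hD1 this
    -- The square root `2 ^ (-lam / 2)` of the guessing probability is at most `D`, and `D ≤ ε`
    -- because `D ≤ 1` and `e ≤ 1`.
    have hlam : ((2 : ℝ) ^ lam)⁻¹ ≤ ε ^ 2 := by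
      have h2 : ((2 : ℝ) ^ (-(lam : ℝ) / 2)) ^ 2 = ((2 : ℝ) ^ lam)⁻¹ := by
        rw [← Real.rpow_natCast, ← Real.rpow_mul (by norm_num)]
        have : -(lam : ℝ) / 2 * ((2 : ℕ) : ℝ) = -(lam : ℝ) := by push_cast; ring
        rw [this, Real.rpow_neg (by norm_num), Real.rpow_natCast]
      rw [← h2]
      have : (2 : ℝ) ^ (-(lam : ℝ) / 2) ≤ ε := (le_max_right _ _).trans hDε
      gcongr
    have hmain := integral_real_sub_le μ A hΔ hq e0 e1 (by rw [epow]; exact le_max_left _ _) hlam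
    -- For `D ≤ 1` a smaller exponent gives a larger power, and `ℓ + 1 ≤ 4 ^ ℓ`.
    have hexp : ε ≤ D ^ (1 / (2 * 4 ^ ℓ) : ℝ) := by
      refine Real.rpow_le_rpow_of_exponent_ge hD0 hD1 ?_
      rw [he]
      have h4 : ((ℓ + 1 : ℕ) : ℝ) ≤ ((4 ^ ℓ : ℕ) : ℝ) := by
        exact_mod_cast Nat.lt_pow_self (by norm_num)
      push_cast at h4
      gcongr
    calc _ ≤ 2 * (C' * ε) := by linarith
      _ ≤ (2 * C' + 1) * ε := by linarith
      _ ≤ _ := by gcongr
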